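/- \textbf{Setting.} Fix function symbols, predicate symbols for built-in constraints, and disjoint sets of \emph{linear} and \emph{persistent} predicate symbols for user-defined (CHR) constraints. Built-in constraints are $\mathit{true}$, $\mathit{false}$, equations and atoms over the built-in symbols; conjunctions of constraints are identified with finite multisets. The constraint theory $\mathcal{CT}$ is a set of coherent axioms $\forall(\mathbb C\to\exists\bar Z.\,\mathbb D)$ with $\mathbb C,\mathbb D$ conjunctions of built-in constraints. We write $\exists_{-V}\varphi$ for the existential closure of $\varphi$ except for the variables in $V$. A \emph{hybrid program} $\mathcal P$ is a finite set of rules $\mathbb K\backslash\mathbb H\Leftrightarrow\mathbb G\mid\mathbb C,\mathbb B$, where $\mathbb K$ is a multiset of persistent constraints, $\mathbb H$ a multiset of linear constraints ($\mathbb K,\mathbb H$ not both empty), $\mathbb G,\mathbb C$ are conjunctions of built-in constraints, and $\mathbb B$ is a multiset of CHR constraints. The local variables of a rule $r$ are $\mathrm{lv}(r)=\mathrm{fv}(\mathbb G,\mathbb C,\mathbb B)\setminus\mathrm{fv}(\mathbb K,\mathbb H)$. $\mathcal P^s$ denotes the set of rules of $\mathcal P$ with $\mathbb H\neq\emptyset$.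 The logical reading of a rule is $\forall\big((\mathbb K\wedge\mathbb G)\to(\mathbb H\leftrightarrow\exists_{-\mathrm{fv}(\mathbb K,\mathbb H)}(\mathbb G\wedge\mathbb C\wedge\mathbb B))\big)$; $\mathcal{CP}$ is $\mathcal{CT}$ together with the logical readings of the rules of $\mathcal P$. A state is a triple $\langle\mathbb C;\mathbb E;\bar X\rangle$ of a finite multiset of CHR constraints, a conjunction of built-in constraints and a finite set of (global) variables; $\Sigma$ is the set of states and $\Sigma_p$ the set of purely persistent states (all CHR constraints are persistent). The hybrid equivalence $\equiv_h$ is the least equivalence relation on $\Sigma$ such that (1) $\langle\mathbb C;Y{=}t\wedge\mathbb D;\bar X\rangle\equiv_h\langle\mathbb C[Y\backslash t];Y{=}t\wedge\mathbb D;\bar X\rangle$; (2) $\langle\mathbb C;\mathit{false};\bar X\rangle\equiv_h\langle\mathbb D;\mathit{false};\bar X\rangle$; (3) $\langle\mathbb C;\mathbb D;\bar X\rangle\equiv_h\langle\mathbb C;\mathbb E;\bar X\rangle$ if $\mathcal{CT}\models\exists_{-\mathrm{fv}(\mathbb C,\bar X)}\mathbb D\leftrightarrow\exists_{-\mathrm{fv}(\mathbb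 C,\bar X)}\mathbb E$; (4) $\langle\mathbb C;\mathbb E;\bar X\rangle\equiv_h\langle\mathbb C;\mathbb E;\{Y\}\cup\bar X\rangle$ if $Y\notin\mathrm{fv}(\mathbb C,\mathbb E)$; (5) $\langle c,c,\mathbb C;\mathbb D;\bar X\rangle\equiv_h\langle c,\mathbb C;\mathbb D;\bar X\rangle$ if $c$ is persistent. For a program $\mathcal Q$, $\to_{\mathcal Q}$ is the least relation on $\Sigma$ that is closed under $\equiv_h$ on both sides and satisfies $\langle\mathbb K,\mathbb H,\mathbb D;\mathbb G\wedge\mathbb E;\bar X\rangle\to_{\mathcal Q}\langle\mathbb B,\mathbb K,\mathbb D;\mathbb C\wedge\mathbb G\wedge\mathbb E;\bar X\rangle$ for every variable renaming $r=(\mathbb K\backslash\mathbb H\Leftrightarrow\mathbb G\mid\mathbb C,\mathbb B)$ of a rule of $\mathcal Q$ with $\mathrm{lv}(r)\cap(\mathrm{fv}(\mathbb D,\mathbb E)\cup\bar X)=\emptyset$. Let $\to^*_{\mathcal Q}$ be the transitive closure of $\to_{\mathcal Q}\cup\equiv_h$; $\mathcal Q$ is \emph{confluent} if $\sigma\to^*_{\mathcal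 Q}\sigma_1$ and $\sigma\to^*_{\mathcal Q}\sigma_2$ imply $\sigma_1\to^*_{\mathcal Q}\sigma'$ and $\sigma_2\to^*_{\mathcal Q}\sigma'$ for some $\sigma'$. Put $\langle\mathcal Q\rangle(\mathcal X)=\{\sigma\mid\exists\sigma'\in\mathcal X.\ \sigma\to_{\mathcal Q}\sigma'\}$ and $[\mathcal Q](\mathcal X)=\{\sigma\mid\forall\sigma'.\ \sigma\to_{\mathcal Q}\sigma'\Rightarrow\sigma'\in\mathcal X\}$, and let $[\mathit{false}]$ be the $\equiv_h$-class of $\langle\emptyset;\mathit{false};\emptyset\rangle$. A state $\sigma$ is \emph{data-sufficient} for $\mathcal P$ if for every $\sigma'$ with $\sigma\to^*_{\mathcal P}\sigma'$ there is $\sigma''\in\Sigma_p$ with $\sigma'\to^*_{\mathcal P^s}\sigma''$. \textbf{Theorem (soundness and completeness of hybrid transition system semantics).} Let $\mathcal P$ be a hybrid program such that $\mathcal P^s$ is confluent, let $\mathbb L$ be a multiset of linear constraints and $\mathbb P$ a multiset of persistent constraints, and let $\langle\mathbb L,\mathbb P;\mathbb E;\bar X\rangle$ be a state that is data-sufficient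 for $\mathcal P$. Then \[ \langle\mathbb L,\mathbb P;\mathbb E;\bar X\rangle\in\nu\mathcal X.\Big([\mathcal P](\mathcal X)\cap\mu\mathcal Y.\big(\langle\mathcal P^s\rangle(\mathcal Y)\cup(\Sigma_p\setminus[\mathit{false}])\big)\Big) \] if and only if $\mathbb L\wedge\mathbb P\wedge\mathbb E$ is satisfiable within $\mathcal{CP}$ (some model of $\mathcal{CP}$ satisfies it under some valuation of the variables). -/

import Mathlib

universe u

namespace CHR

/-! ## Syntax -/

/-- Function symbols, predicate symbols of built-in constraints (besides `=`, `true`, `false`), and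
predicate symbols of CHR constraints, which are divided into linear and persistent ones; all of them
are indexed by their arity. -/
structure Signature where
  Func : ℕ → Type u
  BuiltIn : ℕ → Type u
  Linear : ℕ → Type u
  Persistent : ℕ → Type u

/-- The first-order language of a signature: all predicate symbols together. -/
def Signature.lang (S : Signature.{u}) : FirstOrder.Language.{u, u} :=
  ⟨S.Func, fun n => S.BuiltIn n ⊕ (S.Linear n ⊕ S.Persistent n)⟩

variable {S : Signature.{u}}

/-- Variables are the natural numbers. -/
abbrev Var := ℕ

/-- Terms over the function symbols and the variables. -/
abbrev Tm (S : Signature.{u}) := S.lang.Term Var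

/-- Atomic built-in constraints. -/
inductive BuiltInConstraint (S : Signature.{u}) : Type u
  | tru : BuiltInConstraint S
  | fls : BuiltInConstraint S
  | eq (s t : Tm S) : BuiltInConstraint S
  | rel {n : ℕ} (R : S.BuiltIn n) (ts : Fin n → Tm S) : BuiltInConstraint S

/-- User-defined (CHR) constraints. -/
inductive UserConstraint (S : Signature.{u}) : Type u
  | lin {n : ℕ} (R : S.Linear n) (ts : Fin n → Tm S) : UserConstraint S
  | per {n : ℕ} (R : S.Persistent n) (ts : Fin n → Tm S) : UserConstraint S

/-- The constraint is built from a linear symbol. -/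
def UserConstraint.IsLinear : UserConstraint S → Prop
  | .lin _ _ => True
  | .per _ _ => False

/-- The constraint is built from a persistent symbol. -/
def UserConstraint.IsPersistent : UserConstraint S → Prop
  | .lin _ _ => False
  | .per _ _ => True

/-- Conjunctions of built-in constraints, written as multisets. -/
abbrev BStore (S : Signature.{u}) := Multiset (BuiltInConstraint S)

/-- Multisets of user-defined constraints. -/
abbrev UStore (S : Signature.{u}) := Multiset (UserConstraint S)

/-- Free variables. -/
def BuiltInConstraint.fv : BuiltInConstraint S → Set Var
  | .tru => ∅
  | .fls => ∅
  | .eq s t => ↑s.varFinset ∪ ↑t.varFinset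
  | .rel _ ts => ⋃ i, ↑(ts i).varFinset

def UserConstraint.fv : UserConstraint S → Set Var
  | .lin _ ts => ⋃ i, ↑(ts i).varFinset
  | .per _ ts => ⋃ i, ↑(ts i).varFinset

def bfv (E : BStore S) : Set Var := {x | ∃ c ∈ E, x ∈ c.fv}

def ufv (C : UStore S) : Set Var := {x | ∃ c ∈ C, x ∈ c.fv}

/-- Simultaneous substitution of terms for variables. -/
def BuiltInConstraint.subst (θ : Var → Tm S) : BuiltInConstraint S → BuiltInConstraint S
  | .tru => .tru
  | .fls => .fls
  | .eq s t => .eq (s.subst θ) (t.subst θ)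
  | .rel R ts => .rel R (fun i => (ts i).subst θ)

def UserConstraint.subst (θ : Var → Tm S) : UserConstraint S → UserConstraint S
  | .lin R ts => .lin R (fun i => (ts i).subst θ)
  | .per R ts => .per R (fun i => (ts i).subst θ)

/-- The substitution `[Y \ t]`. -/
def single (Y : Var) (t : Tm S) : Var → Tm S := Function.update FirstOrder.Language.Term.var Y t

/-- A CHR rule `kept \ removed ⟺ guard | bodyB, bodyU` (`bodyB` is the built-in part and `bodyU` the
user-defined part of the body). Rules where both heads are empty are prohibited. -/
structure Rule (S : Signature.{u}) where
  kept : UStore S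
  removed : UStore S
  guard : BStore S
  bodyB : BStore S
  bodyU : UStore S
  head_ne : kept + removed ≠ 0

namespace Rule

/-- Variables of the head. -/
def headVars (r : Rule S) : Set Var := ufv r.kept ∪ ufv r.removed

/-- Local variables: those of the guard and of the body that do not occur in the head. -/
def localVars (r : Rule S) : Set Var :=
  (bfv r.guard ∪ bfv r.bodyB ∪ ufv r.bodyU) \ r.headVars

/-- Simplification rules are the rules with a non-empty removed head (the other rules are
propagation rules). -/
def IsSimplification (r : Rule S) : Prop := r.removed ≠ 0

/-- Hybrid rules: the kept head is persistent and the removed head is linear. -/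
def IsHybrid (r : Rule S) : Prop :=
  (∀ c ∈ r.kept, c.IsPersistent) ∧ (∀ c ∈ r.removed, c.IsLinear)

/-- The variant of a rule by a renaming of the variables. -/
def rename (ρ : Equiv.Perm Var) (r : Rule S) : Rule S where
  kept := r.kept.map (UserConstraint.subst fun x => .var (ρ x))
  removed := r.removed.map (UserConstraint.subst fun x => .var (ρ x))
  guard := r.guard.map (BuiltInConstraint.subst fun x => .var (ρ x))
  bodyB := r.bodyB.map (BuiltInConstraint.subst fun x => .var (ρ x))
  bodyU := r.bodyU.map (UserConstraint.subst fun x => .var (ρ x))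
  head_ne := by
    rw [← Multiset.map_add]
    simpa [Multiset.map_eq_zero] using r.head_ne

end Rule

/-- A CHR program is a finite set of rules. -/
structure Program (S : Signature.{u}) where
  rules : Set (Rule S)
  finite : rules.Finite

namespace Program

/-- A hybrid program consists of hybrid rules. -/
def IsHybrid (P : Program S) : Prop := ∀ r ∈ P.rules, r.IsHybrid

/-- The set of simplification rules of a program. -/
def simp (P : Program S) : Program S where
  rules := {r ∈ P.rules | r.IsSimplification}
  finite := P.finite.subset (Set.sep_subset _ _)

end Program

/-- A CHR state `⟨C; E; X⟩`. -/
structure State (S : Signature.{u}) where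
  chr : UStore S
  builtin : BStore S
  globals : Finset Var

/-! ## Declarative semantics -/

section Semantics

variable (M : Type u) [S.lang.Structure M]

/-- Truth of a constraint in a structure under a valuation. -/
def BuiltInConstraint.Holds (v : Var → M) : BuiltInConstraint S → Prop
  | .tru => True
  | .fls => False
  | .eq s t => s.realize v = t.realize v
  | .rel (n := n) R ts =>
      FirstOrder.Language.Structure.RelMap (L := S.lang) (n := n) (Sum.inl R) fun i => (ts i).realize v

def UserConstraint.Holds (v : Var → M) : UserConstraint S → Prop
  | .lin (n := n) R ts =>
      FirstOrder.Language.Structure.RelMap (L := S.lang) (n := n) (Sum.inr (Sum.inl R))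
        fun i => (ts i).realize v
  | .per (n := n) R ts =>
      FirstOrder.Language.Structure.RelMap (L := S.lang) (n := n) (Sum.inr (Sum.inr R))
        fun i => (ts i).realize v

/-- Truth of a conjunction. -/
def BHolds (v : Var → M) (E : BStore S) : Prop := ∀ c ∈ E, c.Holds M v

def UHolds (v : Var → M) (C : UStore S) : Prop := ∀ c ∈ C, c.Holds M v

variable {M} in
/-- Truth under `v` of the existential closure of `φ` with the exception of the variables in `F`. -/
def ExistsExcept (F : Set Var) (φ : (Var → M) → Prop) (v : Var → M) : Prop :=
  ∃ w : Var → M, Set.EqOn w v F ∧ φ w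

/-- A coherent formula `∀ (prem → ∃ ex. concl)` over the built-in constraints. -/
structure CoherentAxiom (S : Signature.{u}) where
  prem : BStore S
  ex : Finset Var
  concl : BStore S

/-- Truth of a coherent formula in a structure. -/
def CoherentAxiom.Holds (a : CoherentAxiom S) : Prop :=
  ∀ v : Var → M, BHolds M v a.prem → ExistsExcept (↑a.ex)ᶜ (fun w => BHolds M w a.concl) v

/-- A constraint theory: a set of coherent axioms. -/
abbrev ConstraintTheory (S : Signature.{u}) := Set (CoherentAxiom S)

/-- The structure is a model of the constraint theory. -/
def ConstraintTheory.ModeledBy (CT : ConstraintTheory S) : Prop := ∀ a ∈ CT, a.Holds M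

/-- Truth of the logical reading of a rule,
`∀ ((K ∧ G) → (H ↔ ∃ -fv(K, H). (G ∧ C ∧ B)))`. -/
def Rule.Holds (r : Rule S) : Prop :=
  ∀ v : Var → M, UHolds M v r.kept ∧ BHolds M v r.guard →
    (UHolds M v r.removed ↔
      ExistsExcept r.headVars
        (fun w => BHolds M w r.guard ∧ BHolds M w r.bodyB ∧ UHolds M w r.bodyU) v)

/-- The structure is a model of the logical reading of the program. -/
def Program.ModeledBy (P : Program S) : Prop := ∀ r ∈ P.rules, r.Holds M

end Semantics

/-- `C ∧ E` is satisfiable within the logical reading of the program `P` together with the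
constraint theory `CT`: some model of both satisfies `C ∧ E` under some valuation. -/
def SatisfiableWithin (CT : ConstraintTheory S) (P : Program S) (C : UStore S) (E : BStore S) :
    Prop :=
  ∃ (M : Type u) (_ : S.lang.Structure M), CT.ModeledBy M ∧ P.ModeledBy M ∧
    ∃ v : Var → M, UHolds M v C ∧ BHolds M v E

/-- `CT ⊨ ∃ -F. D ↔ ∃ -F. E`. Structures without elements have no valuations, so the empty
structure plays no role. -/
def EquivExcept (CT : ConstraintTheory S) (F : Set Var) (D E : BStore S) : Prop :=
  ∀ (M : Type u) [S.lang.Structure M], CT.ModeledBy M → ∀ v : Var → M,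
    ExistsExcept F (fun w => BHolds M w D) v ↔ ExistsExcept F (fun w => BHolds M w E) v

/-! ## Equivalences of states -/

/-- The generating clauses of the abstract equivalence. -/
inductive AbstractStep (CT : ConstraintTheory S) : State S → State S → Prop
  | equality (C : UStore S) (D : BStore S) (X : Finset Var) (Y : Var) (t : Tm S) :
      AbstractStep CT ⟨C, .eq (.var Y) t ::ₘ D, X⟩
        ⟨C.map (UserConstraint.subst (single Y t)), .eq (.var Y) t ::ₘ D, X⟩
  | inconsistent (C D : UStore S) (X : Finset Var) :
      AbstractStep CT ⟨C, {.fls}, X⟩ ⟨D, {.fls}, X⟩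
  | transformation (C : UStore S) (D E : BStore S) (X : Finset Var)
      (h : EquivExcept CT (ufv C ∪ ↑X) D E) : AbstractStep CT ⟨C, D, X⟩ ⟨C, E, X⟩
  | omission (C : UStore S) (E : BStore S) (X : Finset Var) (Y : Var)
      (hY : Y ∉ ufv C ∪ bfv E) : AbstractStep CT ⟨C, E, X⟩ ⟨C, E, insert Y X⟩

/-- The abstract equivalence: the least equivalence satisfying the four clauses. -/
def AbstractEquiv (CT : ConstraintTheory S) : State S → State S → Prop :=
  Relation.EqvGen (AbstractStep CT)

/-- Contraction of a duplicated persistent constraint. -/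
inductive Contraction : State S → State S → Prop
  | contract (c : UserConstraint S) (hc : c.IsPersistent) (C : UStore S) (D : BStore S)
      (X : Finset Var) : Contraction ⟨c ::ₘ c ::ₘ C, D, X⟩ ⟨c ::ₘ C, D, X⟩

/-- The hybrid equivalence: the least equivalence that contains the abstract equivalence and
contraction. -/
def HybridEquiv (CT : ConstraintTheory S) : State S → State S → Prop :=
  Relation.EqvGen fun σ τ => AbstractEquiv CT σ τ ∨ Contraction σ τ

/-! ## Transitions -/

/-- The transition relation of a program modulo an equivalence of states. A rule variant is applied
with local variables that are fresh for the remaining part of the state. -/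
inductive Transition (eqv : State S → State S → Prop) (P : Program S) : State S → State S → Prop
  | apply (r₀ r : Rule S) (ρ : Equiv.Perm Var) (hr₀ : r₀ ∈ P.rules) (hr : r = r₀.rename ρ)
      (D : UStore S) (E : BStore S) (X : Finset Var)
      (fresh : Disjoint r.localVars (ufv D ∪ bfv E ∪ ↑X)) :
      Transition eqv P ⟨r.kept + r.removed + D, r.guard + E, X⟩
        ⟨r.bodyU + r.kept + D, r.bodyB + r.guard + E, X⟩
  | congr {σ₁ σ₁' σ₂' σ₂ : State S} (h₁ : eqv σ₁ σ₁') (h : Transition eqv P σ₁' σ₂')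
      (h₂ : eqv σ₂' σ₂) : Transition eqv P σ₁ σ₂

/-- The transitive closure of the union of the transition relation and the equivalence. -/
def Reaches (eqv : State S → State S → Prop) (P : Program S) : State S → State S → Prop :=
  Relation.TransGen fun σ τ => Transition eqv P σ τ ∨ eqv σ τ

/-- Confluence of the transition relation of a program. -/
def Confluent (eqv : State S → State S → Prop) (P : Program S) : Prop :=
  ∀ σ σ₁ σ₂ : State S, Reaches eqv P σ σ₁ → Reaches eqv P σ σ₂ →
    ∃ σ' : State S, Reaches eqv P σ₁ σ' ∧ Reaches eqv P σ₂ σ'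

/-! ## Transition system semantics -/

/-- The existential immediate cause operator `⟨P⟩`. -/
def existsCause (eqv : State S → State S → Prop) (P : Program S) :
    Set (State S) →o Set (State S) where
  toFun A := {σ | ∃ σ', Transition eqv P σ σ' ∧ σ' ∈ A}
  monotone' := fun _ _ hAB _ ⟨σ', h, hA⟩ => ⟨σ', h, hAB hA⟩

/-- The universal immediate cause operator `[P]`. -/
def forallCause (eqv : State S → State S → Prop) (P : Program S) :
    Set (State S) →o Set (State S) where
  toFun A := {σ | ∀ σ', Transition eqv P σ σ' → σ' ∈ A}
  monotone' := fun _ _ hAB _ h σ' hσ' => hAB (h σ' hσ')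

/-- The purely persistent states. -/
def purelyPersistent (S : Signature.{u}) : Set (State S) := {σ | ∀ c ∈ σ.chr, c.IsPersistent}

/-- The hybrid equivalence class of the inconsistent state `⟨∅; false; ∅⟩`. -/
def falseClass (CT : ConstraintTheory S) : Set (State S) :=
  {σ | HybridEquiv CT σ ⟨0, {.fls}, ∅⟩}

/-- The inner fixpoint `μ Y. (⟨P^s⟩(Y) ∪ (Σ_p \ [false]))`. -/
def innerSemantics (CT : ConstraintTheory S) (P : Program S) : Set (State S) :=
  OrderHom.lfp
    { toFun := fun Y =>
        existsCause (HybridEquiv CT) P.simp Y ∪ (purelyPersistent S \ falseClass CT)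
      monotone' := fun _ _ h =>
        Set.union_subset_union_left _ ((existsCause (HybridEquiv CT) P.simp).monotone h) }

/-- The hybrid transition system semantics
`ν X. ([P](X) ∩ μ Y. (⟨P^s⟩(Y) ∪ (Σ_p \ [false])))`. -/
def hybridSemantics (CT : ConstraintTheory S) (P : Program S) : Set (State S) :=
  OrderHom.gfp
    { toFun := fun A => forallCause (HybridEquiv CT) P A ∩ innerSemantics CT P
      monotone' := fun _ _ h =>
        Set.inter_subset_inter_left _ ((forallCause (HybridEquiv CT) P).monotone h) }

/-- Every state accessible from `σ` can be rewritten by the simplification rules into a purely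
persistent state. -/
def DataSufficient (CT : ConstraintTheory S) (P : Program S) (σ : State S) : Prop :=
  ∀ σ' : State S, Reaches (HybridEquiv CT) P σ σ' →
    ∃ σ'' ∈ purelyPersistent S, Reaches (HybridEquiv CT) P.simp σ' σ''

end CHR

/-!
The transition system semantics and satisfiability within the logical reading of the program are two
ways of saying that no derivation from the state fails.

*Satisfiable states are in the semantics* (`mem_hybridSemantics_of_satisfiableWithin`). Equivalences
and rule applications preserve satisfiability, because the model satisfies the logical readings of
the rules (`Reaches.satisfiableWithin`). Hence the satisfiable states among the accessible ones form
a post-fixed point of the outer operator: data-sufficiency provides a derivation by simplification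
rules to a purely persistent state, which is satisfiable and so differs from `false`; this puts the
state into the inner least fixed point.

*States in the semantics are satisfiable* (`satisfiableWithin_of_mem_hybridSemantics`). A state in
the semantics can be rewritten by simplification rules into a consistent purely persistent state
`σ₀`, and every state accessible from `σ₀` can again be rewritten into a consistent purely
persistent one.

The persistent and built-in symbols are interpreted in a generic model `GenericModel`, the limit of
the purely persistent states accessible from `σ₀`. For this limit, derivations must be monotone in
the built-in store and their results must be amalgamated. Accumulating derivations (`Acc`) achieve
the former: they never remove built-in constraints, and they simulate all derivations
(`Simulates.reaches`). The stages (`IsStage`) achieve the latter: variables that are introduced by a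
derivation carry the derivation as their name (`Gen.wit`), so that every derivation is performed at
most once and the stages are directed (`IsStage.directed`). A built-in atom is true in the model if
the later stages entail it, and a persistent atom if it occurs in the later stages.

The linear symbols are interpreted by reducibility (`Reducible`): a multiset of ground linear
constraints is reducible if ground instances of simplification rules, with their other constraints
true in the model, rewrite it to the empty multiset, and a ground linear constraint is true if it
belongs to a reducible multiset (`LinearTruth`). If the body of a simplification rule is true, then
so is its removed head, by one more rewriting step. Conversely, if the removed head is true, then it
is part of a reducible multiset; this reduction is lifted to a derivation between states, and
confluence joins it with the application of the rule, so that the body is true as well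
(`Reducible.satState_of_reaches`, `exists_body_of_linearTruth`). Propagation rules hold because of
the closure of the generic model under derivations: the body of a rule that is fired in a stage can
be rewritten into a consistent purely persistent state, and this state is reflected in the model and
certifies that the linear constraints of the body are reducible (`GenericModel.propagation`).
Finally, the initial state is true since it can be rewritten to `σ₀`.
-/

namespace CHR

open FirstOrder Language

variable {S : Signature.{u}}

/-! ### Substitution, free variables and truth -/

/-- The substitution that renames the variables along `f`. -/
abbrev ren (S : Signature.{u}) (f : Var → Var) : Var → Tm S := fun x => .var (f x)

/-- Substitution in a multiset of user-defined constraints. -/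
abbrev usub (θ : Var → Tm S) (C : UStore S) : UStore S := C.map (UserConstraint.subst θ)

/-- Substitution in a conjunction of built-in constraints. -/
abbrev bsub (θ : Var → Tm S) (E : BStore S) : BStore S := E.map (BuiltInConstraint.subst θ)

theorem term_subst_congr {α β : Type*} [DecidableEq α] {L : Language} (t : L.Term α)
    {θ η : α → L.Term β} (h : ∀ x ∈ t.varFinset, θ x = η x) : t.subst θ = t.subst η := by
  induction t with
  | var x => exact h x (by simp [Term.varFinset])
  | func f ts ih =>
    simp only [Term.subst]
    congr 1
    funext i
    exact ih i fun x hx => h x (by simpa [Term.varFinset] using ⟨i, hx⟩)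

theorem term_subst_subst {α β γ : Type*} {L : Language} (t : L.Term α)
    (θ : α → L.Term β) (η : β → L.Term γ) :
    (t.subst θ).subst η = t.subst fun x => (θ x).subst η := by
  induction t with
  | var x => rfl
  | func f ts ih => simp only [Term.subst, ih]

theorem term_subst_var {α : Type*} {L : Language} (t : L.Term α) : t.subst Term.var = t := by
  induction t with
  | var x => rfl
  | func f ts ih => simp only [Term.subst, ih]

theorem mem_varFinset_subst {α β : Type*} [DecidableEq α] [DecidableEq β] {L : Language}
    (t : L.Term α) (θ : α → L.Term β) (y : β) :
    y ∈ (t.subst θ).varFinset ↔ ∃ x ∈ t.varFinset, y ∈ (θ x).varFinset := by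
  induction t with
  | var x => simp [Term.subst, Term.varFinset]
  | func f ts ih =>
    simp only [Term.subst, Term.varFinset, Finset.mem_biUnion, Finset.mem_univ, true_and, ih]
    exact ⟨fun ⟨i, x, h⟩ => ⟨x, ⟨i, h.1⟩, h.2⟩, fun ⟨x, ⟨i, h⟩, h'⟩ => ⟨i, x, h, h'⟩⟩

theorem term_realize_congr {α : Type*} [DecidableEq α] {L : Language} {M : Type*} [L.Structure M]
    (t : L.Term α) {v w : α → M} (h : ∀ x ∈ t.varFinset, v x = w x) :
    t.realize v = t.realize w := by
  induction t with
  | var x => exact h x (by simp [Term.varFinset])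
  | func f ts ih =>
    simp only [Term.realize]
    congr 1
    funext i
    exact ih i fun x hx => h x (by simpa [Term.varFinset] using ⟨i, hx⟩)

namespace BuiltInConstraint

theorem subst_congr (c : BuiltInConstraint S) {θ η : Var → Tm S} (h : ∀ x ∈ c.fv, θ x = η x) :
    c.subst θ = c.subst η := by
  cases c with
  | tru => rfl
  | fls => rfl
  | eq s t =>
    simp only [subst]
    rw [term_subst_congr s fun x hx => h x (Or.inl hx),
      term_subst_congr t fun x hx => h x (Or.inr hx)]
  | rel R ts =>
    simp only [subst]
    congr 1
    funext i
    exact term_subst_congr _ fun x hx => h x (Set.mem_iUnion.2 ⟨i, hx⟩)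

theorem subst_subst (c : BuiltInConstraint S) (θ η : Var → Tm S) :
    (c.subst θ).subst η = c.subst fun x => (θ x).subst η := by
  cases c <;> simp [subst, term_subst_subst]

theorem subst_var (c : BuiltInConstraint S) : c.subst Term.var = c := by
  cases c <;> simp [subst, term_subst_var]

theorem mem_fv_subst (c : BuiltInConstraint S) (θ : Var → Tm S) (y : Var) :
    y ∈ (c.subst θ).fv ↔ ∃ x ∈ c.fv, y ∈ (θ x).varFinset := by
  cases c with
  | tru => simp [subst, fv]
  | fls => simp [subst, fv]
  | eq s t =>
    simp only [subst, fv, Set.mem_union, Finset.mem_coe, mem_varFinset_subst]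
    exact ⟨fun h => h.elim (fun ⟨x, h⟩ => ⟨x, Or.inl h.1, h.2⟩)
        (fun ⟨x, h⟩ => ⟨x, Or.inr h.1, h.2⟩),
      fun ⟨x, h, h'⟩ => h.imp (fun h => ⟨x, h, h'⟩) (fun h => ⟨x, h, h'⟩)⟩
  | rel R ts =>
    simp only [subst, fv, Set.mem_iUnion, Finset.mem_coe, mem_varFinset_subst]
    exact ⟨fun ⟨i, x, h⟩ => ⟨x, ⟨i, h.1⟩, h.2⟩, fun ⟨x, ⟨i, h⟩, h'⟩ => ⟨i, x, h, h'⟩⟩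

theorem finite_fv (c : BuiltInConstraint S) : c.fv.Finite := by
  cases c with
  | tru => exact Set.finite_empty
  | fls => exact Set.finite_empty
  | eq s t => exact (Finset.finite_toSet _).union (Finset.finite_toSet _)
  | rel R ts => exact Set.finite_iUnion fun i => Finset.finite_toSet _

variable {M : Type u} [S.lang.Structure M]

theorem holds_subst (c : BuiltInConstraint S) (θ : Var → Tm S) (v : Var → M) :
    (c.subst θ).Holds M v ↔ c.Holds M fun x => (θ x).realize v := by
  cases c <;> simp [subst, Holds, Term.realize_subst]

theorem holds_congr (c : BuiltInConstraint S) {v w : Var → M} (h : ∀ x ∈ c.fv, v x = w x) :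
    c.Holds M v ↔ c.Holds M w := by
  cases c with
  | tru => rfl
  | fls => rfl
  | eq s t =>
    simp only [Holds]
    rw [term_realize_congr s fun x hx => h x (Or.inl hx),
      term_realize_congr t fun x hx => h x (Or.inr hx)]
  | rel R ts =>
    simp only [Holds]
    have : (fun i => (ts i).realize v) = fun i => (ts i).realize w := by
      funext i
      exact term_realize_congr _ fun x hx => h x (Set.mem_iUnion.2 ⟨i, hx⟩)
    rw [this]

end BuiltInConstraint

/-- User-defined constraints over the elements of a structure. -/
inductive GroundConstraint (S : Signature.{u}) (M : Type u) : Type u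
  | lin {n : ℕ} (R : S.Linear n) (a : Fin n → M) : GroundConstraint S M
  | per {n : ℕ} (R : S.Persistent n) (a : Fin n → M) : GroundConstraint S M

/-- Truth of a ground constraint. -/
def GroundConstraint.Holds {M : Type u} [S.lang.Structure M] : GroundConstraint S M → Prop
  | .lin (n := n) R a => Structure.RelMap (L := S.lang) (n := n) (Sum.inr (Sum.inl R)) a
  | .per (n := n) R a => Structure.RelMap (L := S.lang) (n := n) (Sum.inr (Sum.inr R)) a

namespace UserConstraint

theorem subst_congr (c : UserConstraint S) {θ η : Var → Tm S} (h : ∀ x ∈ c.fv, θ x = η x) :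
    c.subst θ = c.subst η := by
  cases c <;>
  · simp only [subst]
    congr 1
    funext i
    exact term_subst_congr _ fun x hx => h x (Set.mem_iUnion.2 ⟨i, hx⟩)

theorem subst_subst (c : UserConstraint S) (θ η : Var → Tm S) :
    (c.subst θ).subst η = c.subst fun x => (θ x).subst η := by
  cases c <;> simp [subst, term_subst_subst]

theorem subst_var (c : UserConstraint S) : c.subst Term.var = c := by
  cases c <;> simp [subst, term_subst_var]

theorem mem_fv_subst (c : UserConstraint S) (θ : Var → Tm S) (y : Var) :
    y ∈ (c.subst θ).fv ↔ ∃ x ∈ c.fv, y ∈ (θ x).varFinset := by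
  cases c <;>
  · simp only [subst, fv, Set.mem_iUnion, Finset.mem_coe, mem_varFinset_subst]
    exact ⟨fun ⟨i, x, h⟩ => ⟨x, ⟨i, h.1⟩, h.2⟩, fun ⟨x, ⟨i, h⟩, h'⟩ => ⟨i, x, h, h'⟩⟩

theorem finite_fv (c : UserConstraint S) : c.fv.Finite := by
  cases c <;> exact Set.finite_iUnion fun i => Finset.finite_toSet _

theorem isLinear_iff_not (c : UserConstraint S) : c.IsLinear ↔ ¬ c.IsPersistent := by
  cases c <;> simp [IsLinear, IsPersistent]

@[simp] theorem isLinear_subst (c : UserConstraint S) (θ : Var → Tm S) :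
    (c.subst θ).IsLinear ↔ c.IsLinear := by
  cases c <;> rfl

@[simp] theorem isPersistent_subst (c : UserConstraint S) (θ : Var → Tm S) :
    (c.subst θ).IsPersistent ↔ c.IsPersistent := by
  cases c <;> rfl

/-- The instance of a constraint under a valuation. -/
def ground (M : Type u) [S.lang.Structure M] (v : Var → M) :
    UserConstraint S → GroundConstraint S M
  | .lin R ts => .lin R fun i => (ts i).realize v
  | .per R ts => .per R fun i => (ts i).realize v

variable {M : Type u} [S.lang.Structure M]

theorem holds_ground (c : UserConstraint S) (v : Var → M) :
    (c.ground M v).Holds ↔ c.Holds M v := by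
  cases c <;> rfl

theorem ground_subst (c : UserConstraint S) (θ : Var → Tm S) (v : Var → M) :
    (c.subst θ).ground M v = c.ground M fun x => (θ x).realize v := by
  cases c <;> simp [subst, ground, Term.realize_subst]

theorem ground_congr (c : UserConstraint S) {v w : Var → M} (h : ∀ x ∈ c.fv, v x = w x) :
    c.ground M v = c.ground M w := by
  cases c <;>
  · simp only [ground]
    congr 1
    funext i
    exact term_realize_congr _ fun x hx => h x (Set.mem_iUnion.2 ⟨i, hx⟩)

theorem holds_subst (c : UserConstraint S) (θ : Var → Tm S) (v : Var → M) :
    (c.subst θ).Holds M v ↔ c.Holds M fun x => (θ x).realize v := by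
  rw [← holds_ground, ← holds_ground, ground_subst]

theorem holds_congr (c : UserConstraint S) {v w : Var → M} (h : ∀ x ∈ c.fv, v x = w x) :
    c.Holds M v ↔ c.Holds M w := by
  rw [← holds_ground, ← holds_ground, ground_congr c h]

theorem isPersistent_of_ground_eq {c d : UserConstraint S} {v w : Var → M}
    (h : c.ground M v = d.ground M w) : c.IsPersistent ↔ d.IsPersistent := by
  cases c <;> cases d <;> simp_all [ground, IsPersistent]

end UserConstraint

theorem finite_ufv (C : UStore S) : (ufv C).Finite := by
  induction C using Multiset.induction_on with
  | empty => exact Set.finite_empty.subset fun x ⟨c, hc, _⟩ => by simp at hc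
  | cons a C ih =>
    refine (a.finite_fv.union ih).subset fun x ⟨c, hc, hx⟩ => ?_
    rcases Multiset.mem_cons.1 hc with rfl | hc
    · exact Or.inl hx
    · exact Or.inr ⟨c, hc, hx⟩

theorem finite_bfv (E : BStore S) : (bfv E).Finite := by
  induction E using Multiset.induction_on with
  | empty => exact Set.finite_empty.subset fun x ⟨c, hc, _⟩ => by simp at hc
  | cons a C ih =>
    refine (a.finite_fv.union ih).subset fun x ⟨c, hc, hx⟩ => ?_
    rcases Multiset.mem_cons.1 hc with rfl | hc
    · exact Or.inl hx
    · exact Or.inr ⟨c, hc, hx⟩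

@[simp] theorem ufv_add (C D : UStore S) : ufv (C + D) = ufv C ∪ ufv D := by
  ext x
  simp [ufv, or_and_right, exists_or]

@[simp] theorem bfv_add (C D : BStore S) : bfv (C + D) = bfv C ∪ bfv D := by
  ext x
  simp [bfv, or_and_right, exists_or]

@[simp] theorem ufv_cons (c : UserConstraint S) (D : UStore S) : ufv (c ::ₘ D) = c.fv ∪ ufv D := by
  ext x
  simp [ufv]

@[simp] theorem ufv_zero : ufv (0 : UStore S) = ∅ := by
  ext x
  simp [ufv]

@[simp] theorem bfv_zero : bfv (0 : BStore S) = ∅ := by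
  ext x
  simp [bfv]

theorem mem_ufv_usub (C : UStore S) (θ : Var → Tm S) (y : Var) :
    y ∈ ufv (usub θ C) ↔ ∃ x ∈ ufv C, y ∈ (θ x).varFinset := by
  constructor
  · rintro ⟨c, hc, hy⟩
    obtain ⟨d, hd, rfl⟩ := Multiset.mem_map.1 hc
    obtain ⟨x, hx, h⟩ := (d.mem_fv_subst θ y).1 hy
    exact ⟨x, ⟨d, hd, hx⟩, h⟩
  · rintro ⟨x, ⟨d, hd, hx⟩, h⟩
    exact ⟨_, Multiset.mem_map_of_mem _ hd, (d.mem_fv_subst θ y).2 ⟨x, hx, h⟩⟩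

theorem mem_bfv_bsub (C : BStore S) (θ : Var → Tm S) (y : Var) :
    y ∈ bfv (bsub θ C) ↔ ∃ x ∈ bfv C, y ∈ (θ x).varFinset := by
  constructor
  · rintro ⟨c, hc, hy⟩
    obtain ⟨d, hd, rfl⟩ := Multiset.mem_map.1 hc
    obtain ⟨x, hx, h⟩ := (d.mem_fv_subst θ y).1 hy
    exact ⟨x, ⟨d, hd, hx⟩, h⟩
  · rintro ⟨x, ⟨d, hd, hx⟩, h⟩
    exact ⟨_, Multiset.mem_map_of_mem _ hd, (d.mem_fv_subst θ y).2 ⟨x, hx, h⟩⟩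

theorem ufv_ren (C : UStore S) (f : Var → Var) : ufv (usub (ren S f) C) = f '' ufv C := by
  ext y
  rw [mem_ufv_usub]
  simp [Term.varFinset, eq_comm]

theorem bfv_ren (C : BStore S) (f : Var → Var) : bfv (bsub (ren S f) C) = f '' bfv C := by
  ext y
  rw [mem_bfv_bsub]
  simp [Term.varFinset, eq_comm]

theorem usub_congr (C : UStore S) {θ η : Var → Tm S} (h : ∀ x ∈ ufv C, θ x = η x) :
    usub θ C = usub η C :=
  Multiset.map_congr rfl fun c hc => c.subst_congr fun x hx => h x ⟨c, hc, hx⟩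

theorem bsub_congr (C : BStore S) {θ η : Var → Tm S} (h : ∀ x ∈ bfv C, θ x = η x) :
    bsub θ C = bsub η C :=
  Multiset.map_congr rfl fun c hc => c.subst_congr fun x hx => h x ⟨c, hc, hx⟩

theorem usub_usub (C : UStore S) (θ η : Var → Tm S) :
    usub η (usub θ C) = usub (fun x => (θ x).subst η) C := by
  simp [usub, Multiset.map_map, UserConstraint.subst_subst]

theorem bsub_bsub (C : BStore S) (θ η : Var → Tm S) :
    bsub η (bsub θ C) = bsub (fun x => (θ x).subst η) C := by
  simp [bsub, Multiset.map_map, BuiltInConstraint.subst_subst]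

theorem usub_var (C : UStore S) : usub Term.var C = C := by
  simp [usub, UserConstraint.subst_var]

theorem bsub_var (C : BStore S) : bsub Term.var C = C := by
  simp [bsub, BuiltInConstraint.subst_var]

theorem usub_eq_self (C : UStore S) {θ : Var → Tm S} (h : ∀ x ∈ ufv C, θ x = .var x) :
    usub θ C = C := (usub_congr C h).trans (usub_var C)

section Truth

variable {M : Type u} [S.lang.Structure M]

@[simp] theorem bHolds_add (v : Var → M) (D E : BStore S) :
    BHolds M v (D + E) ↔ BHolds M v D ∧ BHolds M v E := by
  simp [BHolds, or_imp, forall_and]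

@[simp] theorem bHolds_cons (v : Var → M) (c : BuiltInConstraint S) (E : BStore S) :
    BHolds M v (c ::ₘ E) ↔ c.Holds M v ∧ BHolds M v E := by
  simp [BHolds]

@[simp] theorem uHolds_add (v : Var → M) (D E : UStore S) :
    UHolds M v (D + E) ↔ UHolds M v D ∧ UHolds M v E := by
  simp [UHolds, or_imp, forall_and]

theorem bHolds_bsub (v : Var → M) (θ : Var → Tm S) (E : BStore S) :
    BHolds M v (bsub θ E) ↔ BHolds M (fun x => (θ x).realize v) E := by
  simp [BHolds, BuiltInConstraint.holds_subst]

theorem uHolds_usub (v : Var → M) (θ : Var → Tm S) (C : UStore S) :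
    UHolds M v (usub θ C) ↔ UHolds M (fun x => (θ x).realize v) C := by
  simp [UHolds, UserConstraint.holds_subst]

theorem bHolds_congr {v w : Var → M} (E : BStore S) (h : ∀ x ∈ bfv E, v x = w x) :
    BHolds M v E ↔ BHolds M w E :=
  forall₂_congr fun c hc => c.holds_congr fun x hx => h x ⟨c, hc, hx⟩

theorem uHolds_congr {v w : Var → M} (C : UStore S) (h : ∀ x ∈ ufv C, v x = w x) :
    UHolds M v C ↔ UHolds M w C :=
  forall₂_congr fun c hc => c.holds_congr fun x hx => h x ⟨c, hc, hx⟩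

end Truth

/-- The variables of a state, including the global ones. -/
def State.vars (σ : State S) : Set Var := ufv σ.chr ∪ bfv σ.builtin ∪ ↑σ.globals

theorem State.finite_vars (σ : State S) : σ.vars.Finite :=
  ((finite_ufv _).union (finite_bfv _)).union (Finset.finite_toSet _)

/-- The variables of a rule. -/
def Rule.vars (r : Rule S) : Set Var :=
  ufv r.kept ∪ ufv r.removed ∪ bfv r.guard ∪ bfv r.bodyB ∪ ufv r.bodyU

theorem Rule.finite_vars (r : Rule S) : r.vars.Finite :=
  ((((finite_ufv _).union (finite_ufv _)).union (finite_bfv _)).union (finite_bfv _)).union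
    (finite_ufv _)

theorem Rule.mem_vars_iff (r : Rule S) (x : Var) :
    x ∈ r.vars ↔ x ∈ r.headVars ∨ x ∈ r.localVars := by
  simp only [Rule.vars, Rule.localVars, Rule.headVars, Set.mem_union, Set.mem_sdiff]
  tauto

theorem Rule.headVars_rename (ρ : Equiv.Perm Var) (r : Rule S) :
    (r.rename ρ).headVars = ρ '' r.headVars := by
  simp only [Rule.headVars, Rule.rename, Set.image_union]
  rw [← ufv_ren, ← ufv_ren]

theorem Rule.localVars_rename (ρ : Equiv.Perm Var) (r : Rule S) :
    (r.rename ρ).localVars = ρ '' r.localVars := by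
  rw [Rule.localVars, Rule.headVars_rename, Rule.localVars, Set.image_sdiff ρ.injective]
  simp only [Rule.rename, Set.image_union]
  rw [← ufv_ren, ← bfv_ren, ← bfv_ren]

theorem Rule.rename_rename (ρ π : Equiv.Perm Var) (r : Rule S) :
    (r.rename ρ).rename π = r.rename (ρ.trans π) := by
  simp only [Rule.rename, Multiset.map_map, Function.comp_def, UserConstraint.subst_subst,
    BuiltInConstraint.subst_subst]
  rfl

theorem Rule.IsHybrid.rename {r : Rule S} (h : r.IsHybrid) (ρ : Equiv.Perm Var) :
    (r.rename ρ).IsHybrid := by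
  constructor <;> intro c hc <;> obtain ⟨d, hd, rfl⟩ := Multiset.mem_map.1 hc
  · simpa using h.1 d hd
  · simpa using h.2 d hd

theorem Program.IsHybrid.simp {P : Program S} (h : P.IsHybrid) : P.simp.IsHybrid :=
  fun r hr => h r hr.1

/-- A finite set of variables is bounded. -/
theorem exists_var_bound {A : Set Var} (hA : A.Finite) : ∃ m : ℕ, ∀ x ∈ A, x < m := by
  obtain ⟨m, hm⟩ := hA.bddAbove
  exact ⟨m + 1, fun x hx => Nat.lt_succ_of_le (hm hx)⟩


/-! ### Elementary steps -/

/-- The application of a variant of a rule, without closure under equivalence. -/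
inductive RuleStep (Q : Program S) : State S → State S → Prop
  | apply (r₀ : Rule S) (ρ : Equiv.Perm Var) (hr₀ : r₀ ∈ Q.rules)
      (D : UStore S) (E : BStore S) (X : Finset Var)
      (fresh : Disjoint (r₀.rename ρ).localVars (ufv D ∪ bfv E ∪ ↑X)) :
      RuleStep Q ⟨(r₀.rename ρ).kept + (r₀.rename ρ).removed + D, (r₀.rename ρ).guard + E, X⟩
        ⟨(r₀.rename ρ).bodyU + (r₀.rename ρ).kept + D,
          (r₀.rename ρ).bodyB + (r₀.rename ρ).guard + E, X⟩

/-- The generating clauses of the hybrid equivalence, in both directions. -/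
inductive EquivStep (CT : ConstraintTheory S) : State S → State S → Prop
  | abs {σ τ : State S} (h : AbstractStep CT σ τ) : EquivStep CT σ τ
  | absSymm {σ τ : State S} (h : AbstractStep CT σ τ) : EquivStep CT τ σ
  | contr {σ τ : State S} (h : Contraction σ τ) : EquivStep CT σ τ
  | contrSymm {σ τ : State S} (h : Contraction σ τ) : EquivStep CT τ σ

theorem EquivStep.symm {CT : ConstraintTheory S} {σ τ : State S} (h : EquivStep CT σ τ) :
    EquivStep CT τ σ := by
  cases h with
  | abs h => exact .absSymm h
  | absSymm h => exact .abs h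
  | contr h => exact .contrSymm h
  | contrSymm h => exact .contr h

theorem reflTransGen_equivStep_symm {CT : ConstraintTheory S} {σ τ : State S}
    (h : Relation.ReflTransGen (EquivStep CT) σ τ) : Relation.ReflTransGen (EquivStep CT) τ σ := by
  induction h with
  | refl => exact .refl
  | tail _ h ih => exact .head h.symm ih

theorem HybridEquiv.symm {CT : ConstraintTheory S} {σ τ : State S} (h : HybridEquiv CT σ τ) :
    HybridEquiv CT τ σ := Relation.EqvGen.symm _ _ h

theorem HybridEquiv.trans {CT : ConstraintTheory S} {σ τ υ : State S} (h : HybridEquiv CT σ τ)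
    (h' : HybridEquiv CT τ υ) : HybridEquiv CT σ υ := Relation.EqvGen.trans _ _ _ h h'

theorem HybridEquiv.refl (CT : ConstraintTheory S) (σ : State S) : HybridEquiv CT σ σ :=
  Relation.EqvGen.refl _

theorem AbstractStep.hybridEquiv {CT : ConstraintTheory S} {σ τ : State S}
    (h : AbstractStep CT σ τ) : HybridEquiv CT σ τ :=
  .rel _ _ (Or.inl (.rel _ _ h))

theorem Contraction.hybridEquiv {CT : ConstraintTheory S} {σ τ : State S}
    (h : Contraction σ τ) : HybridEquiv CT σ τ :=
  .rel _ _ (Or.inr h)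

theorem AbstractEquiv.reflTransGen {CT : ConstraintTheory S} {σ τ : State S}
    (h : AbstractEquiv CT σ τ) : Relation.ReflTransGen (EquivStep CT) σ τ := by
  induction h with
  | rel _ _ h => exact .single (.abs h)
  | refl => exact .refl
  | symm _ _ _ ih => exact reflTransGen_equivStep_symm ih
  | trans _ _ _ _ _ ih₁ ih₂ => exact ih₁.trans ih₂

theorem HybridEquiv.reflTransGen {CT : ConstraintTheory S} {σ τ : State S}
    (h : HybridEquiv CT σ τ) : Relation.ReflTransGen (EquivStep CT) σ τ := by
  induction h with
  | rel _ _ h =>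
    rcases h with h | h
    · exact AbstractEquiv.reflTransGen h
    · exact .single (.contr h)
  | refl => exact .refl
  | symm _ _ _ ih => exact reflTransGen_equivStep_symm ih
  | trans _ _ _ _ _ ih₁ ih₂ => exact ih₁.trans ih₂

/-- A step of the equivalence or the application of a rule variant. -/
def Step (CT : ConstraintTheory S) (Q : Program S) (σ τ : State S) : Prop :=
  EquivStep CT σ τ ∨ RuleStep Q σ τ

theorem HybridEquiv.reflTransGen_step {CT : ConstraintTheory S} (Q : Program S) {σ τ : State S}
    (h : HybridEquiv CT σ τ) : Relation.ReflTransGen (Step CT Q) σ τ := by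
  have h' := h.reflTransGen
  clear h
  induction h' with
  | refl => exact .refl
  | tail _ h ih => exact ih.tail (Or.inl h)

theorem Transition.reflTransGen {CT : ConstraintTheory S} {Q : Program S} {σ τ : State S}
    (h : Transition (HybridEquiv CT) Q σ τ) : Relation.ReflTransGen (Step CT Q) σ τ := by
  induction h with
  | apply r₀ r ρ hr₀ hr D E X fresh =>
    subst hr
    exact .single (Or.inr (.apply r₀ ρ hr₀ D E X fresh))
  | congr h₁ _ h₂ ih =>
    exact (h₁.reflTransGen_step Q).trans (ih.trans (h₂.reflTransGen_step Q))

theorem Reaches.reflTransGen {CT : ConstraintTheory S} {Q : Program S} {σ τ : State S}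
    (h : Reaches (HybridEquiv CT) Q σ τ) : Relation.ReflTransGen (Step CT Q) σ τ := by
  induction h with
  | single h =>
    exact h.elim Transition.reflTransGen fun h => HybridEquiv.reflTransGen_step Q h
  | tail _ h ih =>
    exact ih.trans
      (h.elim Transition.reflTransGen fun h => HybridEquiv.reflTransGen_step Q h)

theorem HybridEquiv.reaches {CT : ConstraintTheory S} (Q : Program S) {σ τ : State S}
    (h : HybridEquiv CT σ τ) : Reaches (HybridEquiv CT) Q σ τ := .single (Or.inr h)

theorem RuleStep.transition {Q : Program S} {σ τ : State S} (eqv : State S → State S → Prop)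
    (h : RuleStep Q σ τ) : Transition eqv Q σ τ := by
  obtain ⟨r₀, ρ, hr₀, D, E, X, fresh⟩ := h
  exact .apply r₀ _ ρ hr₀ rfl D E X fresh

theorem RuleStep.reaches (CT : ConstraintTheory S) {Q : Program S} {σ τ : State S}
    (h : RuleStep Q σ τ) : Reaches (HybridEquiv CT) Q σ τ := .single (Or.inl (h.transition _))

theorem Reaches.trans {CT : ConstraintTheory S} {Q : Program S} {σ τ υ : State S}
    (h : Reaches (HybridEquiv CT) Q σ τ) (h' : Reaches (HybridEquiv CT) Q τ υ) :
    Reaches (HybridEquiv CT) Q σ υ := Relation.TransGen.trans h h'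

theorem Transition.mono {eqv : State S → State S → Prop} {Q Q' : Program S}
    (hQ : Q.rules ⊆ Q'.rules) {σ τ : State S} (h : Transition eqv Q σ τ) :
    Transition eqv Q' σ τ := by
  induction h with
  | apply r₀ r ρ hr₀ hr D E X fresh => exact .apply r₀ r ρ (hQ hr₀) hr D E X fresh
  | congr h₁ _ h₂ ih => exact .congr h₁ ih h₂

theorem Reaches.mono {eqv : State S → State S → Prop} {Q Q' : Program S}
    (hQ : Q.rules ⊆ Q'.rules) {σ τ : State S} (h : Reaches eqv Q σ τ) : Reaches eqv Q' σ τ := by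
  induction h with
  | single h => exact .single (h.imp (Transition.mono hQ) id)
  | tail _ h ih => exact .tail ih (h.imp (Transition.mono hQ) id)

theorem Program.simp_subset (P : Program S) : P.simp.rules ⊆ P.rules := Set.sep_subset _ _

/-! ### Linear and persistent parts -/

open Classical in
/-- The linear constraints of a store. -/
noncomputable def linPart (C : UStore S) : UStore S := C.filter UserConstraint.IsLinear

@[simp] theorem linPart_add (C D : UStore S) : linPart (C + D) = linPart C + linPart D := by
  classical exact Multiset.filter_add _ _ _

theorem linPart_cons_of_persistent {c : UserConstraint S} (h : c.IsPersistent) (C : UStore S) :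
    linPart (c ::ₘ C) = linPart C := by
  classical
  exact Multiset.filter_cons_of_neg _ (by rw [UserConstraint.isLinear_iff_not]; simpa using h)

theorem linPart_eq_self {C : UStore S} (h : ∀ c ∈ C, c.IsLinear) : linPart C = C := by
  classical exact Multiset.filter_eq_self.2 h

theorem linPart_eq_zero {C : UStore S} : linPart C = 0 ↔ ∀ c ∈ C, c.IsPersistent := by
  classical
  rw [linPart, Multiset.filter_eq_nil]
  simp [UserConstraint.isLinear_iff_not]

theorem linPart_usub (θ : Var → Tm S) (C : UStore S) :
    linPart (usub θ C) = usub θ (linPart C) := by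
  classical
  simp only [linPart, usub, Multiset.filter_map]
  congr 1
  refine Multiset.filter_congr fun c _ => ?_
  simp

theorem mem_linPart {c : UserConstraint S} {C : UStore S} :
    c ∈ linPart C ↔ c ∈ C ∧ c.IsLinear := by
  simp [linPart]

theorem exists_eq_linPart_add (C : UStore S) :
    ∃ C', C = linPart C + C' ∧ ∀ c, c ∈ C' ↔ c ∈ C ∧ c.IsPersistent := by
  classical
  refine ⟨C.filter fun c => ¬ c.IsLinear, (Multiset.filter_add_not _ _).symm, fun c => ?_⟩
  simp [UserConstraint.isLinear_iff_not]

section Models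

variable {M : Type u} [S.lang.Structure M]

/-- The multiset of the instances of the linear constraints of a store under a valuation. -/
noncomputable def groundLin (v : Var → M) (C : UStore S) : Multiset (GroundConstraint S M) :=
  (linPart C).map (UserConstraint.ground M v)

/-- The built-in constraints hold under `v`, the instances of the persistent constraints have the
property `Ψ`, and those of the linear constraints form a multiset with the property `Φ`. -/
def SatAt (Ψ : GroundConstraint S M → Prop)
    (Φ : Multiset (GroundConstraint S M) → Prop) (v : Var → M) (C : UStore S)
    (E : BStore S) : Prop :=
  BHolds M v E ∧ (∀ c ∈ C, c.IsPersistent → Ψ (c.ground M v)) ∧ Φ (groundLin v C)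

/-- The state, with its non-global variables existentially quantified, holds under `v` in the sense
of `SatAt`. -/
def SatState (Ψ : GroundConstraint S M → Prop)
    (Φ : Multiset (GroundConstraint S M) → Prop) (v : Var → M) (σ : State S) : Prop :=
  ∃ w : Var → M, Set.EqOn w v ↑σ.globals ∧ SatAt Ψ Φ w σ.chr σ.builtin

variable {Ψ : GroundConstraint S M → Prop} {Φ : Multiset (GroundConstraint S M) → Prop}

theorem groundLin_add (v : Var → M) (C D : UStore S) :
    groundLin v (C + D) = groundLin v C + groundLin v D := by
  simp [groundLin]

theorem groundLin_congr {v w : Var → M} (C : UStore S) (h : ∀ x ∈ ufv C, v x = w x) :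
    groundLin v C = groundLin w C :=
  Multiset.map_congr rfl fun c hc => c.ground_congr fun x hx => h x ⟨c, (mem_linPart.1 hc).1, hx⟩

theorem groundLin_usub (v : Var → M) (θ : Var → Tm S) (C : UStore S) :
    groundLin v (usub θ C) = groundLin (fun x => (θ x).realize v) C := by
  simp [groundLin, linPart_usub, usub, Multiset.map_map, UserConstraint.ground_subst]

theorem satAt_congr {v w : Var → M} {C : UStore S} {E : BStore S}
    (hC : ∀ x ∈ ufv C, v x = w x) (hE : ∀ x ∈ bfv E, v x = w x) :
    SatAt Ψ Φ v C E ↔ SatAt Ψ Φ w C E := by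
  rw [SatAt, SatAt, bHolds_congr E hE, groundLin_congr C hC]
  refine and_congr_right fun _ => and_congr_left fun _ => forall₂_congr fun c hc => ?_
  rw [c.ground_congr fun x hx => hC x ⟨c, hc, hx⟩]

theorem satAt_usub (v : Var → M) (θ : Var → Tm S) (C : UStore S) (E : BStore S) :
    (SatAt Ψ Φ v (usub θ C) (bsub θ E)) ↔ SatAt Ψ Φ (fun x => (θ x).realize v) C E := by
  simp [SatAt, bHolds_bsub, groundLin_usub, UserConstraint.ground_subst]

theorem realize_single {Y : Var} {t : Tm S} {v : Var → M} (h : v Y = t.realize v) (x : Var) :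
    (single Y t x).realize v = v x := by
  by_cases hx : x = Y
  · subst hx
    simp [single, h]
  · simp [single, Function.update_of_ne hx]

theorem AbstractStep.satState_iff {CT : ConstraintTheory S} (hM : CT.ModeledBy M)
    {σ τ : State S} (h : AbstractStep CT σ τ) (v : Var → M) :
    SatState Ψ Φ v σ ↔ SatState Ψ Φ v τ := by
  cases h with
  | equality C D X Y t =>
    refine exists_congr fun w => and_congr_right fun _ => ?_
    simp only [SatAt, bHolds_cons]
    refine and_congr_right fun h => ?_
    have h1 : (fun x => (single Y t x).realize w) = w :=
      funext (realize_single (by simpa [BuiltInConstraint.Holds] using h.1))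
    have h2 := groundLin_usub w (single Y t) C
    rw [h1] at h2
    simp [h2, UserConstraint.ground_subst, h1]
  | inconsistent C D X =>
    simp [SatState, SatAt, BHolds, BuiltInConstraint.Holds]
  | transformation C D E X h =>
    have key : ∀ D E : BStore S, EquivExcept CT (ufv C ∪ ↑X) D E →
        SatState Ψ Φ v ⟨C, D, X⟩ → SatState Ψ Φ v ⟨C, E, X⟩ := by
      rintro D E h ⟨w, hw, hs⟩
      obtain ⟨w', hw', hE⟩ := (h M hM w).1 ⟨w, fun _ _ => rfl, hs.1⟩
      refine ⟨w', fun x hx => (hw' (Or.inr hx)).trans (hw hx), hE, fun c hc hp => ?_, ?_⟩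
      · rw [c.ground_congr fun x hx => hw' (Or.inl ⟨c, hc, hx⟩)]
        exact hs.2.1 c hc hp
      · rw [groundLin_congr C fun x hx => hw' (Or.inl hx)]
        exact hs.2.2
    exact ⟨key D E h, key E D fun M _ hM v => (h M hM v).symm⟩
  | omission C E X Y hY =>
    constructor
    · rintro ⟨w, hw, hs⟩
      refine ⟨Function.update w Y (v Y), fun x hx => ?_, ?_⟩
      · by_cases h : x = Y
        · subst h
          simp
        · rw [Function.update_of_ne h]
          exact hw (Finset.mem_of_mem_insert_of_ne hx h)
      · refine (satAt_congr (fun x hx => ?_) fun x hx => ?_).1 hs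
        · exact (Function.update_of_ne (fun h : x = Y => hY (Or.inl (h ▸ hx))) _ _).symm
        · exact (Function.update_of_ne (fun h : x = Y => hY (Or.inr (h ▸ hx))) _ _).symm
    · rintro ⟨w, hw, hs⟩
      exact ⟨w, fun x hx => hw (Finset.mem_insert_of_mem hx), hs⟩

theorem Contraction.satState_iff {σ τ : State S} (h : Contraction σ τ) (v : Var → M) :
    SatState Ψ Φ v σ ↔ SatState Ψ Φ v τ := by
  obtain ⟨c, hc, C, D, X⟩ := h
  refine exists_congr fun w => and_congr_right fun _ => ?_
  simp [SatAt, groundLin, linPart_cons_of_persistent hc]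

theorem EquivStep.satState_iff {CT : ConstraintTheory S} (hM : CT.ModeledBy M)
    {σ τ : State S} (h : EquivStep CT σ τ) (v : Var → M) :
    SatState Ψ Φ v σ ↔ SatState Ψ Φ v τ := by
  cases h with
  | abs h => exact h.satState_iff hM v
  | absSymm h => exact (h.satState_iff hM v).symm
  | contr h => exact h.satState_iff v
  | contrSymm h => exact (h.satState_iff v).symm

theorem HybridEquiv.satState_iff {CT : ConstraintTheory S} (hM : CT.ModeledBy M)
    {σ τ : State S} (h : HybridEquiv CT σ τ) (v : Var → M) :
    SatState Ψ Φ v σ ↔ SatState Ψ Φ v τ := by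
  have h' := h.reflTransGen
  clear h
  induction h' with
  | refl => rfl
  | tail _ h ih => exact ih.trans (h.satState_iff hM v)

/-- Among the states that hold in some model of the constraint theory, being purely persistent is
invariant under the hybrid equivalence. -/
theorem HybridEquiv.purelyPersistent_iff {CT : ConstraintTheory S} (hM : CT.ModeledBy M)
    {σ τ : State S} (h : HybridEquiv CT σ τ) (v : Var → M) (hσ : SatState Ψ Φ v σ)
    (hp : σ ∈ purelyPersistent S) : τ ∈ purelyPersistent S := by
  have h0 : SatState Ψ (fun N : Multiset (GroundConstraint S M) => N = 0) v σ := by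
    obtain ⟨w, hw, hs⟩ := hσ
    refine ⟨w, hw, hs.1, hs.2.1, ?_⟩
    rw [groundLin, linPart_eq_zero.2 hp, Multiset.map_zero]
  obtain ⟨w, -, hs⟩ := (h.satState_iff hM v).1 h0
  exact linPart_eq_zero.1 (Multiset.map_eq_zero.1 hs.2.2)

end Models

/-! ### Consistency of built-in stores -/

/-- The conjunction holds in some model of the constraint theory under some valuation. -/
def Consistent (CT : ConstraintTheory S) (E : BStore S) : Prop :=
  ∃ (M : Type u) (_ : S.lang.Structure M), CT.ModeledBy M ∧ ∃ v : Var → M, BHolds M v E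

theorem EquivExcept.of_not_consistent {CT : ConstraintTheory S} {D E : BStore S}
    (hD : ¬ Consistent CT D) (hE : ¬ Consistent CT E) (F : Set Var) : EquivExcept CT F D E :=
  fun M _ hM _ => ⟨fun ⟨w, _, h⟩ => (hD ⟨M, _, hM, w, h⟩).elim,
    fun ⟨w, _, h⟩ => (hE ⟨M, _, hM, w, h⟩).elim⟩

theorem not_consistent_fls (CT : ConstraintTheory S) : ¬ Consistent CT {.fls} := by
  rintro ⟨M, _, _, v, h⟩
  exact h .fls (Multiset.mem_singleton_self _)

theorem hybridEquiv_of_globals {CT : ConstraintTheory S} (X : Finset Var) :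
    HybridEquiv CT ⟨0, {.fls}, X⟩ ⟨0, {.fls}, ∅⟩ := by
  induction X using Finset.induction_on with
  | empty => exact .refl _ _
  | insert Y X _ ih =>
    refine .trans (.symm (AbstractStep.omission 0 {.fls} X Y ?_).hybridEquiv) ih
    simp [bfv, BuiltInConstraint.fv]

theorem hybridEquiv_of_not_consistent {CT : ConstraintTheory S} {C D : UStore S} {E E' : BStore S}
    {X : Finset Var} (hE : ¬ Consistent CT E) (hE' : ¬ Consistent CT E') :
    HybridEquiv CT ⟨C, E, X⟩ ⟨D, E', X⟩ :=
  .trans (AbstractStep.transformation C E {.fls} X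
      (.of_not_consistent hE (not_consistent_fls CT) _)).hybridEquiv <|
    .trans (AbstractStep.inconsistent C D X).hybridEquiv
      (AbstractStep.transformation D {.fls} E' X
        (.of_not_consistent (not_consistent_fls CT) hE' _)).hybridEquiv

theorem mem_falseClass_iff {CT : ConstraintTheory S} (σ : State S) :
    σ ∈ falseClass CT ↔ ¬ Consistent CT σ.builtin := by
  constructor
  · rintro h ⟨M, _, hM, v, hv⟩
    obtain ⟨w, -, hw⟩ := (HybridEquiv.satState_iff (Ψ := fun _ => True) (Φ := fun _ => True)
      hM h v).1
      ⟨v, fun _ _ => rfl, hv, fun _ _ _ => trivial, trivial⟩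
    exact hw.1 .fls (Multiset.mem_singleton_self _)
  · intro h
    exact (hybridEquiv_of_not_consistent (D := 0) h (not_consistent_fls CT)).trans
      (hybridEquiv_of_globals σ.globals)


/-! ### Entailment and replacement of equal constraints -/

/-- The constraint theory entails `∀ (E → D)`. -/
def Entails (CT : ConstraintTheory S) (E D : BStore S) : Prop :=
  ∀ (M : Type u) [S.lang.Structure M], CT.ModeledBy M → ∀ v : Var → M,
    BHolds M v E → BHolds M v D

/-- Under the built-in store `E`, the constraint theory entails that the two user-defined
constraints have the same symbol and equal arguments. -/
def UEq (CT : ConstraintTheory S) (E : BStore S) (c d : UserConstraint S) : Prop :=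
  ∀ (M : Type u) [S.lang.Structure M], CT.ModeledBy M → ∀ v : Var → M,
    BHolds M v E → c.ground M v = d.ground M v

/-- Under the built-in store `E`, the constraint theory entails `∃ -V. D`. -/
def EntailsExists (CT : ConstraintTheory S) (V : Set Var) (E D : BStore S) : Prop :=
  ∀ (M : Type u) [S.lang.Structure M], CT.ModeledBy M → ∀ v : Var → M,
    BHolds M v E → ∃ w : Var → M, Set.EqOn w v V ∧ BHolds M w D

section

variable {CT : ConstraintTheory S}

theorem Entails.refl (E : BStore S) : Entails CT E E := fun _ _ _ _ h => h

theorem Entails.trans {E D F : BStore S} (h : Entails CT E D) (h' : Entails CT D F) :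
    Entails CT E F := fun M _ hM v hv => h' M hM v (h M hM v hv)

theorem Entails.of_le {E D : BStore S} (h : D ≤ E) : Entails CT E D :=
  fun _ _ _ _ hv c hc => hv c (Multiset.mem_of_le h hc)

theorem entails_add_left (E D : BStore S) : Entails CT (E + D) E :=
  .of_le (Multiset.le_add_right _ _)

theorem entails_add_right (E D : BStore S) : Entails CT (E + D) D :=
  .of_le (Multiset.le_add_left _ _)

theorem UEq.refl (E : BStore S) (c : UserConstraint S) : UEq CT E c c := fun _ _ _ _ _ => rfl

theorem UEq.symm {E : BStore S} {c d : UserConstraint S} (h : UEq CT E c d) : UEq CT E d c :=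
  fun M _ hM v hv => (h M hM v hv).symm

theorem UEq.trans {E : BStore S} {c d e : UserConstraint S} (h : UEq CT E c d)
    (h' : UEq CT E d e) : UEq CT E c e :=
  fun M _ hM v hv => (h M hM v hv).trans (h' M hM v hv)

theorem UEq.mono {E E' : BStore S} {c d : UserConstraint S} (hE : Entails CT E' E)
    (h : UEq CT E c d) : UEq CT E' c d := fun M _ hM v hv => h M hM v (hE M hM v hv)

theorem UEq.isPersistent_iff {E : BStore S} {c d : UserConstraint S} (hE : Consistent CT E)
    (h : UEq CT E c d) : c.IsPersistent ↔ d.IsPersistent := by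
  obtain ⟨M, _, hM, v, hv⟩ := hE
  exact UserConstraint.isPersistent_of_ground_eq (h M hM v hv)

theorem hybridEquiv_of_entails {C : UStore S} {E E' : BStore S} {X : Finset Var}
    (h : Entails CT E E') (h' : Entails CT E' E) : HybridEquiv CT ⟨C, E, X⟩ ⟨C, E', X⟩ :=
  (AbstractStep.transformation C E E' X fun M _ hM _ =>
    ⟨fun ⟨w, hw, hE⟩ => ⟨w, hw, h M hM w hE⟩,
      fun ⟨w, hw, hE⟩ => ⟨w, hw, h' M hM w hE⟩⟩).hybridEquiv

/-- Built-in constraints that are entailed, up to the choice of values for new variables, can be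
added to a state. -/
theorem hybridEquiv_add_of_entailsExists {C : UStore S} {E D : BStore S} {X : Finset Var}
    {V : Set Var} (hV : ufv C ∪ bfv E ∪ ↑X ⊆ V) (h : EntailsExists CT V E D) :
    HybridEquiv CT ⟨C, E, X⟩ ⟨C, E + D, X⟩ := by
  refine (AbstractStep.transformation C E (E + D) X fun M _ hM v => ⟨?_, ?_⟩).hybridEquiv
  · rintro ⟨w, hw, hE⟩
    obtain ⟨w', hw', hD⟩ := h M hM w hE
    refine ⟨w', fun x hx => (hw' (hV ?_)).trans (hw hx), (bHolds_add _ _ _).2 ⟨?_, hD⟩⟩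
    · exact hx.elim (fun h => Or.inl (Or.inl h)) Or.inr
    · exact (bHolds_congr E fun x hx => hw' (hV (Or.inl (Or.inr hx)))).2 hE
  · rintro ⟨w, hw, hE⟩
    exact ⟨w, hw, ((bHolds_add _ _ _).1 hE).1⟩

/-- An argument of a constraint can be replaced by a fresh variable that is equated to it. -/
theorem hybridEquiv_abstract_argument {n : ℕ} (mk : (Fin n → Tm S) → UserConstraint S)
    (hmk : ∀ ts θ, (mk ts).subst θ = mk fun i => (ts i).subst θ)
    (D : UStore S) (E : BStore S) (X : Finset Var) (ts : Fin n → Tm S) (i : Fin n) (s : Tm S)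
    (z : Var) (hC : z ∉ (mk (Function.update ts i s)).fv) (hD : z ∉ ufv D) (hE : z ∉ bfv E)
    (hX : z ∉ X) (hs : z ∉ s.varFinset) (hts : ∀ j, z ∉ (ts j).varFinset) :
    HybridEquiv CT ⟨mk (Function.update ts i s) ::ₘ D, E, X⟩
      ⟨mk (Function.update ts i (.var z)) ::ₘ D, .eq (.var z) s ::ₘ E, X⟩ := by
  have hsingle : ∀ x, x ≠ z → single z s x = Term.var x := fun x hx =>
    Function.update_of_ne hx _ _
  have h1 : HybridEquiv CT ⟨mk (Function.update ts i s) ::ₘ D, E, X⟩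
      ⟨mk (Function.update ts i s) ::ₘ D, E + {.eq (.var z) s}, X⟩ := by
    refine hybridEquiv_add_of_entailsExists (V := {z}ᶜ) ?_ fun M _ hM v hv => ?_
    · rintro x hx rfl
      simp only [ufv_cons, Set.mem_union, Finset.mem_coe] at hx
      tauto
    · refine ⟨Function.update v z (s.realize v), fun x hx => Function.update_of_ne hx _ _, ?_⟩
      intro c hc
      rw [Multiset.mem_singleton.1 hc]
      simp only [BuiltInConstraint.Holds, Term.realize_var, Function.update_self]
      exact term_realize_congr s fun x hx =>
        (Function.update_of_ne (fun h : x = z => hs (h ▸ hx)) _ _).symm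
  have h2 := (AbstractStep.equality (CT := CT) (mk (Function.update ts i (.var z)) ::ₘ D) E X z
    s).hybridEquiv
  have h3 : (mk (Function.update ts i (.var z)) ::ₘ D).map (UserConstraint.subst (single z s)) =
      mk (Function.update ts i s) ::ₘ D := by
    rw [Multiset.map_cons, hmk]
    congr 1
    · congr 1
      funext j
      by_cases hj : j = i
      · subst hj
        simp [Term.subst, single]
      · rw [Function.update_of_ne hj, Function.update_of_ne hj]
        refine (term_subst_congr _ fun x hx => ?_).trans (term_subst_var _)
        exact hsingle x fun h => hts j (h ▸ hx)
    · exact usub_eq_self D fun x hx => hsingle x fun h => hD (h ▸ hx)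
  rw [h3] at h2
  rw [Multiset.add_comm, Multiset.singleton_add] at h1
  exact h1.trans h2.symm

theorem hybridEquiv_replace_argument {n : ℕ} (mk : (Fin n → Tm S) → UserConstraint S)
    (hmk : ∀ ts θ, (mk ts).subst θ = mk fun i => (ts i).subst θ)
    (D : UStore S) (E : BStore S) (X : Finset Var) (ts : Fin n → Tm S) (i : Fin n) (s t : Tm S)
    (hst : Entails CT E {.eq s t}) :
    HybridEquiv CT ⟨mk (Function.update ts i s) ::ₘ D, E, X⟩
      ⟨mk (Function.update ts i t) ::ₘ D, E, X⟩ := by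
  obtain ⟨z, hz⟩ := exists_var_bound ((((((((mk (Function.update ts i s)).finite_fv.union
    (mk (Function.update ts i t)).finite_fv).union (finite_ufv D)).union (finite_bfv E)).union
    (Finset.finite_toSet X)).union (Finset.finite_toSet s.varFinset)).union
    (Finset.finite_toSet t.varFinset)).union
    (Set.finite_iUnion fun j => Finset.finite_toSet (ts j).varFinset))
  have hz' := mt (hz z) (lt_irrefl z)
  simp only [Set.mem_union, not_or, Finset.mem_coe, Set.mem_iUnion, not_exists] at hz'
  obtain ⟨⟨⟨⟨⟨⟨⟨h1, h2⟩, h3⟩, h4⟩, h5⟩, h6⟩, h7⟩, h8⟩ := hz'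
  refine (hybridEquiv_abstract_argument mk hmk D E X ts i s z h1 h3 h4 h5 h6 h8).trans
    (.trans ?_ (hybridEquiv_abstract_argument mk hmk D E X ts i t z h2 h3 h4 h5 h7 h8).symm)
  have key : ∀ M [S.lang.Structure M], CT.ModeledBy M → ∀ v : Var → M, BHolds M v E →
      s.realize v = t.realize v := fun M _ hM v hv =>
    hst M hM v hv _ (Multiset.mem_singleton_self _)
  apply hybridEquiv_of_entails <;> intro M _ hM v hv <;> rw [bHolds_cons] at hv ⊢ <;>
    refine ⟨?_, hv.2⟩
  · exact Eq.trans hv.1 (key M hM v hv.2)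
  · exact Eq.trans hv.1 (key M hM v hv.2).symm

theorem hybridEquiv_replace_arguments {n : ℕ} (mk : (Fin n → Tm S) → UserConstraint S)
    (hmk : ∀ ts θ, (mk ts).subst θ = mk fun i => (ts i).subst θ)
    (D : UStore S) (E : BStore S) (X : Finset Var) (s t : Fin n → Tm S)
    (hst : ∀ i, Entails CT E {.eq (s i) (t i)}) :
    HybridEquiv CT ⟨mk s ::ₘ D, E, X⟩ ⟨mk t ::ₘ D, E, X⟩ := by
  have key : ∀ I : Finset (Fin n),
      HybridEquiv CT ⟨mk s ::ₘ D, E, X⟩ ⟨mk (I.piecewise t s) ::ₘ D, E, X⟩ := by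
    intro I
    induction I using Finset.induction_on with
    | empty => simpa using HybridEquiv.refl CT _
    | insert i I hi ih =>
      refine ih.trans ?_
      have h := hybridEquiv_replace_argument mk hmk D E X (I.piecewise t s) i (s i) (t i) (hst i)
      rwa [← Finset.piecewise_insert, Function.update_eq_self_iff.2
        (Finset.piecewise_eq_of_notMem _ _ _ hi).symm] at h
  simpa using key Finset.univ

theorem hybridEquiv_replace {D : UStore S} {E : BStore S} {X : Finset Var}
    {c d : UserConstraint S} (h : UEq CT E c d) :
    HybridEquiv CT ⟨c ::ₘ D, E, X⟩ ⟨d ::ₘ D, E, X⟩ := by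
  by_cases hE : Consistent CT E
  · have hE' := hE
    obtain ⟨M, _, hM, v, hv⟩ := hE'
    have h0 := h M hM v hv
    cases c with
    | lin R s =>
      cases d with
      | per R' t => cases h0
      | lin R' t =>
        cases h0_eq : (GroundConstraint.lin.inj h0).1
        obtain rfl := eq_of_heq (GroundConstraint.lin.inj h0).2.1
        refine hybridEquiv_replace_arguments (fun ts => .lin R ts) (fun _ _ => rfl) D E X s t
          fun i M _ hM v hv c hc => ?_
        rw [Multiset.mem_singleton.1 hc]
        exact congrFun (eq_of_heq (GroundConstraint.lin.inj (h M hM v hv)).2.2) i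
    | per R s =>
      cases d with
      | lin R' t => cases h0
      | per R' t =>
        cases h0_eq : (GroundConstraint.per.inj h0).1
        obtain rfl := eq_of_heq (GroundConstraint.per.inj h0).2.1
        refine hybridEquiv_replace_arguments (fun ts => .per R ts) (fun _ _ => rfl) D E X s t
          fun i M _ hM v hv c hc => ?_
        rw [Multiset.mem_singleton.1 hc]
        exact congrFun (eq_of_heq (GroundConstraint.per.inj (h M hM v hv)).2.2) i
  · exact hybridEquiv_of_not_consistent hE hE

theorem hybridEquiv_replace_rel {A B : UStore S} (D : UStore S) {E : BStore S} {X : Finset Var}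
    (h : Multiset.Rel (UEq CT E) A B) :
    HybridEquiv CT ⟨A + D, E, X⟩ ⟨B + D, E, X⟩ := by
  induction h generalizing D with
  | zero => exact .refl _ _
  | @cons a b as bs hab _ ih =>
    rw [Multiset.cons_add, Multiset.cons_add]
    refine (hybridEquiv_replace hab).trans ?_
    rw [← Multiset.add_cons, ← Multiset.add_cons]
    exact ih _

/-- Copies of persistent constraints of a state can be added to it. -/
theorem hybridEquiv_add_copies {K C : UStore S} {E : BStore S} {X : Finset Var}
    (hK : ∀ k ∈ K, k.IsPersistent) (h : ∀ k ∈ K, ∃ c ∈ C, UEq CT E c k) :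
    HybridEquiv CT ⟨C, E, X⟩ ⟨K + C, E, X⟩ := by
  by_cases hE : Consistent CT E
  · induction K using Multiset.induction_on with
    | empty => simpa using HybridEquiv.refl CT _
    | cons k K ih =>
      refine (ih (fun k hk => hK k (Multiset.mem_cons_of_mem hk))
        fun k hk => h k (Multiset.mem_cons_of_mem hk)).trans ?_
      obtain ⟨c, hc, hck⟩ := h k (Multiset.mem_cons_self k K)
      obtain ⟨C', hC'⟩ := Multiset.exists_cons_of_mem (Multiset.mem_add.2 (Or.inr hc) : c ∈ K + C)
      rw [Multiset.cons_add, hC']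
      have hp : c.IsPersistent := (hck.isPersistent_iff hE).2 (hK k (Multiset.mem_cons_self k K))
      exact (Contraction.contract c hp C' E X).hybridEquiv.symm.trans (hybridEquiv_replace hck)
  · exact hybridEquiv_of_not_consistent hE hE

end

/-! ### Accumulating derivations -/

/-- Macro steps of derivations in which the built-in store only grows. Either built-in constraints
that are entailed, up to the choice of values for new variables, are added, or a rule variant is
applied whose head constraints need only be equal, under the built-in store, to constraints of the
state. The variables of the head and of the removed constraints have to occur in the built-in store,
so that no variable disappears from the state. -/
inductive Acc (CT : ConstraintTheory S) (Q : Program S) : State S → State S → Prop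
  | enrich (C : UStore S) (E D : BStore S) (X : Finset Var)
      (h : EntailsExists CT (State.vars ⟨C, E, X⟩) E D) : Acc CT Q ⟨C, E, X⟩ ⟨C, E + D, X⟩
  | fire (r₀ r : Rule S) (ρ : Equiv.Perm Var) (hr₀ : r₀ ∈ Q.rules) (hr : r = r₀.rename ρ)
      (H C : UStore S) (E : BStore S) (X : Finset Var)
      (removed : Multiset.Rel (UEq CT E) H r.removed)
      (kept : ∀ k ∈ r.kept, ∃ c ∈ C, UEq CT E c k)
      (guard : EntailsExists CT r.localVarsᶜ E r.guard)
      (fresh : Disjoint r.localVars (State.vars ⟨H + C, E, X⟩))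
      (hH : ufv H ⊆ bfv E) (head : r.headVars ⊆ bfv E) :
      Acc CT Q ⟨H + C, E, X⟩ ⟨r.bodyU + C, E + (r.guard + r.bodyB), X⟩

section

variable {CT : ConstraintTheory S} {Q : Program S}

theorem Acc.mono {Q' : Program S} (hQ : Q.rules ⊆ Q'.rules) {σ τ : State S} (h : Acc CT Q σ τ) :
    Acc CT Q' σ τ := by
  cases h with
  | enrich C E D X h => exact .enrich C E D X h
  | fire r₀ r ρ hr₀ hr H C E X removed kept guard fresh hH head =>
    exact .fire r₀ r ρ (hQ hr₀) hr H C E X removed kept guard fresh hH head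

theorem Acc.vars_subset {σ τ : State S} (h : Acc CT Q σ τ) : σ.vars ⊆ τ.vars := by
  cases h with
  | enrich C E D X h =>
    intro x
    simp only [State.vars, bfv_add, Set.mem_union]
    tauto
  | fire r₀ r ρ hr₀ hr H C E X removed kept guard fresh hH head =>
    intro x hx
    have := @hH x
    simp only [State.vars, bfv_add, ufv_add, Set.mem_union] at hx ⊢
    tauto

theorem Acc.globals_eq {σ τ : State S} (h : Acc CT Q σ τ) : τ.globals = σ.globals := by
  cases h <;> rfl

theorem Acc.reaches (hQ : Q.IsHybrid) {σ τ : State S} (h : Acc CT Q σ τ) :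
    Reaches (HybridEquiv CT) Q σ τ := by
  cases h with
  | enrich C E D X h => exact (hybridEquiv_add_of_entailsExists (le_refl _) h).reaches Q
  | fire r₀ r ρ hr₀ hr H C E X removed kept guard fresh hH head =>
    have hyb : r.IsHybrid := hr ▸ (hQ r₀ hr₀).rename ρ
    have hfresh : ∀ x ∈ r.localVars, x ∉ State.vars (⟨H + C, E, X⟩ : State S) := fun x hx hx' =>
      fresh.ne_of_mem hx hx' rfl
    have hhead : ∀ x ∈ r.localVars, x ∉ r.headVars := fun x hx => hx.2
    simp only [State.vars, Set.mem_union, ufv_add, not_or] at hfresh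
    have h1 : HybridEquiv CT ⟨H + C, E, X⟩ ⟨r.removed + C, E, X⟩ :=
      hybridEquiv_replace_rel C removed
    have h2 : HybridEquiv CT ⟨r.removed + C, E, X⟩ ⟨r.kept + (r.removed + C), E, X⟩ :=
      hybridEquiv_add_copies hyb.1 fun k hk => by
        obtain ⟨c, hc, h⟩ := kept k hk
        exact ⟨c, Multiset.mem_add.2 (Or.inr hc), h⟩
    have h3 : HybridEquiv CT ⟨r.kept + (r.removed + C), E, X⟩
        ⟨r.kept + (r.removed + C), E + r.guard, X⟩ := by
      refine hybridEquiv_add_of_entailsExists ?_ guard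
      intro x hx hl
      have h1 := hfresh x hl
      have h2 := hhead x hl
      simp only [Rule.headVars, ufv_add, Set.mem_union] at hx h2
      tauto
    have h4 : RuleStep Q ⟨r.kept + r.removed + C, r.guard + E, X⟩
        ⟨r.bodyU + r.kept + C, r.bodyB + r.guard + E, X⟩ := by
      subst hr
      refine .apply r₀ ρ hr₀ C E X (Set.disjoint_left.2 fun x hx hx' => ?_)
      have h1 := hfresh x hx
      simp only [Set.mem_union] at hx'
      tauto
    have h5 : HybridEquiv CT ⟨r.bodyU + C, E + (r.guard + r.bodyB), X⟩
        ⟨r.kept + (r.bodyU + C), E + (r.guard + r.bodyB), X⟩ :=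
      hybridEquiv_add_copies hyb.1 fun k hk => by
        obtain ⟨c, hc, h⟩ := kept k hk
        exact ⟨c, Multiset.mem_add.2 (Or.inr hc), h.mono (entails_add_left _ _)⟩
    have e1 : r.kept + (r.removed + C) = r.kept + r.removed + C := by abel
    have e2 : E + r.guard = r.guard + E := by abel
    have e3 : r.kept + (r.bodyU + C) = r.bodyU + r.kept + C := by abel
    have e4 : E + (r.guard + r.bodyB) = r.bodyB + r.guard + E := by abel
    rw [e1, e2] at h3
    rw [e3, e4] at h5
    rw [e1] at h2
    rw [e4]
    exact (((h1.trans h2).trans h3).reaches Q).trans ((h4.reaches CT).trans (h5.symm.reaches Q))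

theorem Acc.reflTransGen_reaches (hQ : Q.IsHybrid) {σ τ : State S}
    (h : Relation.ReflTransGen (Acc CT Q) σ τ) : Reaches (HybridEquiv CT) Q σ τ := by
  induction h with
  | refl => exact (HybridEquiv.refl CT σ).reaches Q
  | tail _ h ih => exact ih.trans (h.reaches hQ)

theorem Acc.reflTransGen_vars_subset {σ τ : State S}
    (h : Relation.ReflTransGen (Acc CT Q) σ τ) : σ.vars ⊆ τ.vars := by
  induction h with
  | refl => exact subset_rfl
  | tail _ h ih => exact ih.trans h.vars_subset

theorem Acc.reflTransGen_globals_eq {σ τ : State S}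
    (h : Relation.ReflTransGen (Acc CT Q) σ τ) : τ.globals = σ.globals := by
  induction h with
  | refl => rfl
  | tail _ h ih => exact h.globals_eq.trans ih

theorem Acc.reflTransGen_mono {Q' : Program S} (hQ : Q.rules ⊆ Q'.rules) {σ τ : State S}
    (h : Relation.ReflTransGen (Acc CT Q) σ τ) : Relation.ReflTransGen (Acc CT Q') σ τ := by
  induction h with
  | refl => exact .refl
  | tail _ h ih => exact ih.tail (h.mono hQ)

/-- The variant of a state by a renaming of the variables. -/
def State.rename (π : Equiv.Perm Var) (σ : State S) : State S :=
  ⟨usub (ren S π) σ.chr, bsub (ren S π) σ.builtin, σ.globals.map π.toEmbedding⟩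

theorem State.vars_rename (π : Equiv.Perm Var) (σ : State S) :
    (σ.rename π).vars = π '' σ.vars := by
  simp only [State.vars, State.rename, Set.image_union]
  rw [ufv_ren, bfv_ren]
  simp

theorem bHolds_ren {M : Type u} [S.lang.Structure M] (v : Var → M) (π : Var → Var) (E : BStore S) :
    BHolds M v (bsub (ren S π) E) ↔ BHolds M (v ∘ π) E := by
  rw [bHolds_bsub]
  rfl

theorem UEq.rename {E : BStore S} {c d : UserConstraint S} (h : UEq CT E c d) (π : Var → Var) :
    UEq CT (bsub (ren S π) E) (c.subst (ren S π)) (d.subst (ren S π)) := by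
  intro M _ hM v hv
  rw [UserConstraint.ground_subst, UserConstraint.ground_subst]
  exact h M hM _ ((bHolds_bsub v _ E).1 hv)

theorem EntailsExists.rename {V : Set Var} {E D : BStore S} (h : EntailsExists CT V E D)
    (π : Equiv.Perm Var) :
    EntailsExists CT (π '' V) (bsub (ren S π) E) (bsub (ren S π) D) := by
  intro M _ hM v hv
  obtain ⟨w, hw, hD⟩ := h M hM _ ((bHolds_ren v π E).1 hv)
  refine ⟨w ∘ π.symm, ?_, ?_⟩
  · rintro _ ⟨x, hx, rfl⟩
    simpa using hw hx
  · rw [bHolds_ren]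
    simpa [Function.comp_assoc] using hD

theorem Acc.rename {σ τ : State S} (h : Acc CT Q σ τ) (π : Equiv.Perm Var) :
    Acc CT Q (σ.rename π) (τ.rename π) := by
  cases h with
  | enrich C E D X h =>
    have h' := h.rename π
    rw [← State.vars_rename] at h'
    have := Acc.enrich (Q := Q) _ _ _ _ h'
    simpa only [State.rename, bsub, Multiset.map_add] using this
  | fire r₀ r ρ hr₀ hr H C E X removed kept guard fresh hH head =>
    have hr' : r.rename π = r₀.rename (ρ.trans π) := by rw [hr, Rule.rename_rename]
    have := Acc.fire (CT := CT) r₀ (r.rename π) (ρ.trans π) hr₀ hr' (usub (ren S π) H)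
      (usub (ren S π) C) (bsub (ren S π) E) (X.map π.toEmbedding) ?_ ?_ ?_ ?_ ?_ ?_
    · simpa only [State.rename, Rule.rename, usub, bsub, Multiset.map_add] using this
    · rw [Rule.rename, Multiset.rel_map]
      exact removed.mono fun c _ d _ h => h.rename π
    · intro k hk
      obtain ⟨k', hk', rfl⟩ := Multiset.mem_map.1 hk
      obtain ⟨c, hc, h⟩ := kept k' hk'
      exact ⟨_, Multiset.mem_map_of_mem _ hc, h.rename π⟩
    · rw [Rule.localVars_rename, ← Set.image_compl_eq π.bijective]
      exact guard.rename π
    · have e : State.vars (⟨usub (ren S π) H + usub (ren S π) C, bsub (ren S π) E,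
          X.map π.toEmbedding⟩ : State S) = π '' State.vars (⟨H + C, E, X⟩ : State S) := by
        rw [← State.vars_rename]
        simp only [State.rename, usub, Multiset.map_add]
      rw [Rule.localVars_rename, e]
      exact (Set.disjoint_image_iff π.injective).2 fresh
    · rw [ufv_ren, bfv_ren]
      exact Set.image_mono hH
    · rw [Rule.headVars_rename, bfv_ren]
      exact Set.image_mono head

theorem Acc.reflTransGen_rename {σ τ : State S} (h : Relation.ReflTransGen (Acc CT Q) σ τ)
    (π : Equiv.Perm Var) : Relation.ReflTransGen (Acc CT Q) (σ.rename π) (τ.rename π) := by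
  induction h with
  | refl => exact .refl
  | tail _ h ih => exact ih.tail (h.rename π)

/-- Addition of constraints to a state. -/
def State.extend (σ : State S) (A : UStore S) (B : BStore S) : State S :=
  ⟨σ.chr + A, σ.builtin + B, σ.globals⟩

theorem Acc.extend {σ τ : State S} (h : Acc CT Q σ τ) (A : UStore S) (B : BStore S)
    (hAB : Disjoint (τ.vars \ σ.vars) (ufv A ∪ bfv B)) :
    Acc CT Q (σ.extend A B) (τ.extend A B) := by
  classical
  cases h with
  | enrich C E D X h =>
    have := Acc.enrich (CT := CT) (Q := Q) (C + A) (E + B) D X ?_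
    · rw [State.extend, State.extend]
      rwa [show E + D + B = E + B + D by abel]
    · intro M _ hM v hv
      obtain ⟨w, hw, hD⟩ := h M hM v ((bHolds_add _ _ _).1 hv).1
      refine ⟨fun x => if x ∈ bfv D then w x else v x, fun x hx => ?_, ?_⟩
      · by_cases hxD : x ∈ bfv D
        · simp only [hxD, if_true]
          apply hw
          by_contra hxσ
          have h1 : x ∈ State.vars (⟨C, E + D, X⟩ : State S) := by
            simp [State.vars, hxD]
          refine Set.disjoint_left.1 hAB ⟨h1, hxσ⟩ ?_
          simp only [State.vars, ufv_add, bfv_add, Set.mem_union] at hx hxσ ⊢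
          tauto
        · simp [hxD]
      · refine (bHolds_congr D fun x hx => ?_).1 hD
        simp [hx]
  | fire r₀ r ρ hr₀ hr H C E X removed kept guard fresh hH head =>
    have := Acc.fire (CT := CT) r₀ r ρ hr₀ hr H (C + A) (E + B) X ?_ ?_ ?_ ?_ ?_ ?_
    · rw [State.extend, State.extend]
      rw [Multiset.add_assoc, Multiset.add_assoc]
      rwa [show E + (r.guard + r.bodyB) + B = E + B + (r.guard + r.bodyB) by abel]
    · exact removed.mono fun c _ d _ h => h.mono (entails_add_left _ _)
    · intro k hk
      obtain ⟨c, hc, h⟩ := kept k hk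
      exact ⟨c, Multiset.mem_add.2 (Or.inl hc), h.mono (entails_add_left _ _)⟩
    · intro M _ hM v hv
      exact guard M hM v ((bHolds_add _ _ _).1 hv).1
    · refine Set.disjoint_left.2 fun x hx hx' => ?_
      have h1 := Set.disjoint_left.1 fresh hx
      have h2 : x ∈ State.vars (⟨r.bodyU + C, E + (r.guard + r.bodyB), X⟩ : State S) := by
        have := hx.1
        simp only [State.vars, ufv_add, bfv_add, Set.mem_union] at this ⊢
        tauto
      have h3 := Set.disjoint_left.1 hAB ⟨h2, h1⟩
      simp only [State.vars, ufv_add, bfv_add, Set.mem_union] at hx' h1 h3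
      tauto
    · rw [bfv_add]
      exact hH.trans Set.subset_union_left
    · rw [bfv_add]
      exact head.trans Set.subset_union_left

theorem Acc.reflTransGen_extend {σ τ : State S} (h : Relation.ReflTransGen (Acc CT Q) σ τ)
    (A : UStore S) (B : BStore S) (hAB : Disjoint (τ.vars \ σ.vars) (ufv A ∪ bfv B)) :
    Relation.ReflTransGen (Acc CT Q) (σ.extend A B) (τ.extend A B) := by
  induction h with
  | refl => exact .refl
  | tail h' h ih =>
    refine (ih (hAB.mono_left (Set.sdiff_subset_sdiff_left h.vars_subset))).tail (h.extend A B ?_)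
    exact hAB.mono_left (Set.sdiff_subset_sdiff_right (Acc.reflTransGen_vars_subset h'))

end


/-! ### Firing a rule at a substitution instance -/

/-- The permutation of the variables that exchanges `x` and `x + m` for all `x < m`. -/
def shiftPerm (m : ℕ) : Equiv.Perm Var :=
  Function.Involutive.toPerm (α := ℕ)
    (fun x : ℕ => if x < m then x + m else if x < m + m then x - m else x) <| by
      intro x
      dsimp only
      split_ifs <;> omega

theorem shiftPerm_of_lt {m x : ℕ} (h : x < m) : shiftPerm m x = x + m := if_pos h

/-- The conjunction of the equations `f x = t x` for `x` in `V`. -/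
def equations (V : Finset Var) (f : Var → Var) (t : Var → Tm S) : BStore S :=
  V.val.map fun x => .eq (.var (f x)) (t x)

theorem bHolds_equations {M : Type u} [S.lang.Structure M] (v : Var → M) (V : Finset Var)
    (f : Var → Var) (t : Var → Tm S) :
    BHolds M v (equations V f t) ↔ ∀ x ∈ V, v (f x) = (t x).realize v := by
  simp only [BHolds, equations, Multiset.mem_map, Finset.mem_val]
  constructor
  · intro h x hx
    exact h _ ⟨x, hx, rfl⟩
  · rintro h _ ⟨x, hx, rfl⟩
    exact h x hx

theorem subset_bfv_equations (V : Finset Var) (f : Var → Var) (t : Var → Tm S) :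
    f '' V ⊆ bfv (equations V f t) := by
  rintro _ ⟨x, hx, rfl⟩
  exact ⟨_, Multiset.mem_map_of_mem _ hx, Or.inl (by simp [Term.varFinset])⟩

section

variable {CT : ConstraintTheory S} {Q : Program S}

/-- A rule can be fired as soon as the state contains the instance of its head under a substitution
`κ`, up to equality, and entails the instance of its guard: a variant of the rule with fresh
variables `f x` is fired after the equations `f x = κ x` have been added for the head variables `x`.
The local variables of the variant are generic, so they can take any values that satisfy the guard
and the body. -/
theorem exists_acc_fire {r : Rule S} (hr : r ∈ Q.rules) (κ : Var → Tm S) (H C : UStore S)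
    (E : BStore S) (X : Finset Var) {A : Set Var} (hA : A.Finite)
    (removed : Multiset.Rel (UEq CT E) H (usub κ r.removed))
    (kept : ∀ k ∈ r.kept, ∃ c ∈ C, UEq CT E c (k.subst κ))
    (guard : Entails CT E (bsub κ r.guard)) :
    ∃ (f : Var → Var) (E' : BStore S),
      Relation.ReflTransGen (Acc CT Q) ⟨H + C, E, X⟩ ⟨usub (ren S f) r.bodyU + C, E', X⟩ ∧
      Entails CT E' E ∧ Entails CT E' (bsub (ren S f) (r.guard + r.bodyB)) ∧
      (∀ (M : Type u) [S.lang.Structure M], ∀ v : Var → M, BHolds M v E' →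
        ∀ x ∈ r.headVars, v (f x) = (κ x).realize v) ∧
      ∀ (M : Type u) [S.lang.Structure M] (v w : Var → M), BHolds M v E →
        (∀ x ∈ r.headVars, w x = (κ x).realize v) → BHolds M w (r.guard + r.bodyB) →
        ∃ v' : Var → M, Set.EqOn v' v A ∧ BHolds M v' E' ∧ ∀ x ∈ r.vars, v' (f x) = w x := by
  classical
  have hhead : r.headVars.Finite := (finite_ufv _).union (finite_ufv _)
  obtain ⟨m, hm⟩ := exists_var_bound (((State.finite_vars (⟨H + C, E, X⟩ : State S)).union hA).union
    (r.finite_vars.union (hhead.biUnion fun x _ => Finset.finite_toSet (κ x).varFinset)))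
  have hmσ : ∀ x ∈ State.vars (⟨H + C, E, X⟩ : State S), x < m := fun x hx =>
    hm x (Or.inl (Or.inl hx))
  have hmA : ∀ x ∈ A, x < m := fun x hx => hm x (Or.inl (Or.inr hx))
  have hmr : ∀ x ∈ r.vars, x < m := fun x hx => hm x (Or.inr (Or.inl hx))
  have hmκ : ∀ x ∈ r.headVars, ∀ y ∈ (κ x).varFinset, y < m := fun x hx y hy =>
    hm y (Or.inr (Or.inr (Set.mem_biUnion hx hy)))
  have hhr : ∀ x ∈ r.headVars, x ∈ r.vars := fun x hx => (r.mem_vars_iff x).2 (Or.inl hx)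
  have hlr : ∀ x ∈ r.localVars, x ∈ r.vars := fun x hx => (r.mem_vars_iff x).2 (Or.inr hx)
  set ρ := shiftPerm m with hρ
  have hρr : ∀ x ∈ r.vars, ρ x = x + m := fun x hx => shiftPerm_of_lt (hmr x hx)
  -- The equations `x = x` for the variables of `H` keep these variables in the state.
  set D : BStore S := equations hhead.toFinset ρ κ +
    equations (finite_ufv H).toFinset id Term.var with hD
  have hDiff : ∀ (M : Type u) [S.lang.Structure M] (v : Var → M), BHolds M v D ↔
      ∀ x ∈ r.headVars, v (ρ x) = (κ x).realize v := by
    intro M _ v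
    rw [hD, bHolds_add, bHolds_equations, bHolds_equations]
    simp
  -- A valuation that agrees with `v` on the old variables and with `w` on the copies of the
  -- variables of the rule.
  have hval : ∀ (M : Type u) [S.lang.Structure M] (v w : Var → M),
      ∃ v' : Var → M, (∀ x < m, v' x = v x) ∧ ∀ x ∈ r.vars, v' (ρ x) = w x := by
    intro M _ v w
    refine ⟨fun y => if y < m then v y else w (y - m), fun x hx => by simp [hx], fun x hx => ?_⟩
    rw [hρr x hx]
    simp
  have hκv : ∀ (M : Type u) [S.lang.Structure M] (v v' : Var → M), (∀ x < m, v' x = v x) →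
      ∀ x ∈ r.headVars, (κ x).realize v' = (κ x).realize v := fun M _ v v' h x hx =>
    term_realize_congr _ fun y hy => h y (hmκ x hx y hy)
  have hEv : ∀ (M : Type u) [S.lang.Structure M] (v v' : Var → M), (∀ x < m, v' x = v x) →
      (BHolds M v' E ↔ BHolds M v E) := fun M _ v v' h =>
    bHolds_congr E fun x hx => h x (hmσ x (Or.inl (Or.inr hx)))
  have s1 : Acc CT Q ⟨H + C, E, X⟩ ⟨H + C, E + D, X⟩ := by
    refine .enrich _ _ _ _ fun M _ hM v hv => ?_
    obtain ⟨v', h1, h2⟩ := hval M v fun x => (κ x).realize v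
    refine ⟨v', fun x hx => h1 x (hmσ x hx), (hDiff M v').2 fun x hx => ?_⟩
    rw [h2 x (hhr x hx), hκv M v v' h1 x hx]
  have hlow : ∀ x ∈ r.vars, ¬ ρ x < m := fun x hx => by
    rw [hρr x hx]
    exact Nat.not_lt.2 (Nat.le_add_left _ _)
  have s2 : Acc CT Q ⟨H + C, E + D, X⟩ ⟨(r.rename ρ).bodyU + C,
      E + D + ((r.rename ρ).guard + (r.rename ρ).bodyB), X⟩ := by
    refine .fire r _ ρ hr rfl H C (E + D) X ?_ ?_ ?_ ?_ ?_ ?_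
    · rw [usub, Multiset.rel_map_right] at removed
      rw [Rule.rename, Multiset.rel_map_right]
      refine removed.mono fun c _ d hd h => (h.mono (entails_add_left _ _)).trans ?_
      intro M _ hM v hv
      rw [bHolds_add, hDiff] at hv
      rw [UserConstraint.ground_subst, UserConstraint.ground_subst]
      exact d.ground_congr fun x hx => (hv.2 x (Or.inr ⟨d, hd, hx⟩)).symm
    · intro k hk
      obtain ⟨k, hk', rfl⟩ := Multiset.mem_map.1 hk
      obtain ⟨c, hc, h⟩ := kept k hk'
      refine ⟨c, hc, (h.mono (entails_add_left _ _)).trans ?_⟩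
      intro M _ hM v hv
      rw [bHolds_add, hDiff] at hv
      rw [UserConstraint.ground_subst, UserConstraint.ground_subst]
      exact k.ground_congr fun x hx => (hv.2 x (Or.inl ⟨k, hk', hx⟩)).symm
    · intro M _ hM v hv
      rw [bHolds_add, hDiff] at hv
      have hg := (bHolds_bsub v κ _).1 (guard M hM v hv.1)
      obtain ⟨v', h1, h2⟩ := hval M v fun x => (κ x).realize v
      refine ⟨fun y => if y ∈ (r.rename ρ).localVars then v' y else v y, fun y hy => if_neg hy, ?_⟩
      refine (bHolds_ren _ ρ r.guard).2 ((bHolds_congr _ fun x hx => ?_).2 hg)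
      rcases (r.mem_vars_iff x).1 (Or.inl (Or.inl (Or.inr hx))) with h | h
      · have : ρ x ∉ ρ '' r.localVars := by
          rintro ⟨y, hy, hyx⟩
          exact hy.2 (ρ.injective hyx ▸ h)
        simp only [Function.comp, Rule.localVars_rename, if_neg this]
        exact hv.2 x h
      · simp only [Function.comp, Rule.localVars_rename, if_pos (Set.mem_image_of_mem ρ h)]
        exact h2 x (hlr x h)
    · rw [Rule.localVars_rename]
      refine Set.disjoint_left.2 ?_
      rintro _ ⟨x, hx, rfl⟩ hx'
      have hxm := hlow x (hlr x hx)
      simp only [State.vars, bfv_add, Set.mem_union] at hx'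
      rcases hx' with (hx' | hx' | hx') | hx'
      · exact hxm (hmσ _ (Or.inl (Or.inl hx')))
      · exact hxm (hmσ _ (Or.inl (Or.inr hx')))
      · rw [hD, bfv_add] at hx'
        rcases hx' with ⟨c, hc, hx'⟩ | ⟨c, hc, hx'⟩
        · obtain ⟨y, hy, rfl⟩ := Multiset.mem_map.1 hc
          have hy : y ∈ r.headVars := by simpa using hy
          rcases hx' with hx' | hx'
          · have : ρ x = ρ y := by simpa [Term.varFinset] using hx'
            exact hx.2 (ρ.injective this ▸ hy)
          · exact hxm (hmκ y hy _ hx')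
        · obtain ⟨y, hy, rfl⟩ := Multiset.mem_map.1 hc
          have : ρ x = y := by simpa [BuiltInConstraint.fv, Term.varFinset] using hx'
          subst this
          refine hxm (hmσ _ (Or.inl (Or.inl ?_)))
          rw [ufv_add]
          exact Or.inl (by simpa using hy)
      · exact hxm (hmσ _ (Or.inr hx'))
    · rw [bfv_add, hD, bfv_add]
      intro x hx
      refine Or.inr (Or.inr (subset_bfv_equations _ _ _ ⟨x, by simpa using hx, rfl⟩))
    · rw [bfv_add, hD, bfv_add, Rule.headVars_rename]
      rintro _ ⟨x, hx, rfl⟩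
      exact Or.inr (Or.inl (subset_bfv_equations _ _ _ ⟨x, by simpa using hx, rfl⟩))
  have hbody : (r.rename ρ).guard + (r.rename ρ).bodyB = bsub (ren S ρ) (r.guard + r.bodyB) := by
    rw [bsub, Multiset.map_add]
    rfl
  refine ⟨ρ, E + D + ((r.rename ρ).guard + (r.rename ρ).bodyB),
    (Relation.ReflTransGen.single s1).tail s2, ?_, ?_, ?_, ?_⟩
  · exact (entails_add_left _ _).trans (entails_add_left _ _)
  · rw [← hbody]
    exact entails_add_right _ _
  · intro M _ v hv
    rw [bHolds_add, bHolds_add, hDiff] at hv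
    exact hv.1.2
  · intro M _ v w hv hw hG
    obtain ⟨v', h1, h2⟩ := hval M v w
    refine ⟨v', fun x hx => h1 x (hmA x hx), ?_, h2⟩
    rw [bHolds_add, bHolds_add, hEv M v v' h1, hDiff, hbody, bHolds_ren]
    refine ⟨⟨hv, fun x hx => ?_⟩, (bHolds_congr _ fun x hx => ?_).2 hG⟩
    · rw [h2 x (hhr x hx), hw x hx, hκv M v v' h1 x hx]
    · refine h2 x ?_
      simp only [bfv_add, Set.mem_union] at hx
      simp only [Rule.vars, Set.mem_union]
      tauto

/-! ### Simulation of derivations by accumulating derivations -/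

/-- The state `τ` contains the instance of the state `σ` under the substitution `θ`, up to equality
of arguments, and possibly further persistent and built-in constraints. Global variables of `σ` are
not instantiated. -/
structure SimulatesVia (CT : ConstraintTheory S) (θ : Var → Tm S) (σ τ : State S) : Prop where
  globals : ∀ x ∈ σ.globals, θ x = .var x
  builtin : Entails CT τ.builtin (bsub θ σ.builtin)
  lin : Multiset.Rel (UEq CT τ.builtin) (linPart τ.chr) (usub θ (linPart σ.chr))
  per : ∀ c ∈ σ.chr, c.IsPersistent → ∃ d ∈ τ.chr, UEq CT τ.builtin d (c.subst θ)

/-- The state `τ` is inconsistent or contains an instance of `σ`. -/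
def Simulates (CT : ConstraintTheory S) (σ τ : State S) : Prop :=
  Consistent CT τ.builtin → ∃ θ, SimulatesVia CT θ σ τ

theorem Simulates.refl (σ : State S) : Simulates CT σ σ := by
  refine fun _ => ⟨Term.var, fun _ _ => rfl, ?_, ?_, ?_⟩
  · rw [bsub_var]
    exact .refl _
  · rw [usub_var]
    exact Multiset.rel_refl_of_refl_on fun c _ => UEq.refl _ c
  · intro c hc _
    exact ⟨c, hc, by rw [UserConstraint.subst_var]; exact UEq.refl _ c⟩

theorem Simulates.contraction {σ σ' τ : State S} (h : Contraction σ σ') :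
    Simulates CT σ τ ↔ Simulates CT σ' τ := by
  obtain ⟨c, hc, C, D, X⟩ := h
  refine imp_congr_right fun _ => exists_congr fun θ => ?_
  constructor <;> rintro ⟨h1, h2, h3, h4⟩ <;> refine ⟨h1, h2, ?_, ?_⟩
  · simpa [linPart_cons_of_persistent hc] using h3
  · intro d hd
    exact h4 d (Multiset.mem_cons_of_mem hd)
  · simpa [linPart_cons_of_persistent hc] using h3
  · intro d hd
    refine h4 d ?_
    simpa using hd

theorem Simulates.equality {C : UStore S} {D : BStore S} {X : Finset Var} {Y : Var} {t : Tm S}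
    {τ : State S} : Simulates CT ⟨C, .eq (.var Y) t ::ₘ D, X⟩ τ ↔
      Simulates CT ⟨usub (single Y t) C, .eq (.var Y) t ::ₘ D, X⟩ τ := by
  refine imp_congr_right fun _ => exists_congr fun θ => ?_
  have key : Entails CT τ.builtin (bsub θ (.eq (.var Y) t ::ₘ D)) → ∀ c : UserConstraint S,
      UEq CT τ.builtin (c.subst θ) ((c.subst (single Y t)).subst θ) := by
    intro h c M _ hM v hv
    have h1 := (bHolds_bsub v θ _).1 (h M hM v hv)
    rw [bHolds_cons] at h1
    have h2 : (θ Y).realize v = t.realize fun x => (θ x).realize v := h1.1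
    rw [UserConstraint.ground_subst, UserConstraint.ground_subst, UserConstraint.ground_subst]
    congr 1
    funext x
    exact (realize_single (v := fun x => (θ x).realize v) h2 x).symm
  constructor
  · rintro ⟨h1, h2, h3, h4⟩
    refine ⟨h1, h2, ?_, ?_⟩
    · dsimp only at h3 ⊢
      rw [linPart_usub, usub, usub, Multiset.rel_map_right, Multiset.rel_map_right]
      rw [usub, Multiset.rel_map_right] at h3
      exact h3.mono fun c _ d _ h => h.trans (key h2 d)
    · intro c hc hp
      obtain ⟨c, hc', rfl⟩ := Multiset.mem_map.1 hc
      obtain ⟨d, hd, h⟩ := h4 c hc' (by simpa using hp)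
      exact ⟨d, hd, h.trans (key h2 c)⟩
  · rintro ⟨h1, h2, h3, h4⟩
    refine ⟨h1, h2, ?_, ?_⟩
    · dsimp only at h3 ⊢
      rw [linPart_usub, usub, usub, Multiset.rel_map_right, Multiset.rel_map_right] at h3
      rw [usub, Multiset.rel_map_right]
      exact h3.mono fun c _ d _ h => h.trans (key h2 d).symm
    · intro c hc hp
      obtain ⟨d, hd, h⟩ := h4 (c.subst (single Y t)) (Multiset.mem_map_of_mem _ hc)
        (by simpa using hp)
      exact ⟨d, hd, h.trans (key h2 c).symm⟩

theorem SimulatesVia.congr {θ η : Var → Tm S} {C : UStore S} {E : BStore S} {X X' : Finset Var}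
    {τ : State S} (h : SimulatesVia CT θ ⟨C, E, X⟩ τ) (hX : ∀ x ∈ X', η x = .var x)
    (hC : ∀ x ∈ ufv C, θ x = η x) (hE : ∀ x ∈ bfv E, θ x = η x) :
    SimulatesVia CT η ⟨C, E, X'⟩ τ := by
  obtain ⟨h1, h2, h3, h4⟩ := h
  refine ⟨hX, ?_, ?_, ?_⟩
  · dsimp only at h2 ⊢
    rwa [← bsub_congr E hE]
  · dsimp only at h3 ⊢
    rwa [← usub_congr _ fun x ⟨c, hc, hx⟩ => hC x ⟨c, (mem_linPart.1 hc).1, hx⟩]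
  · intro c hc hp
    obtain ⟨d, hd, h⟩ := h4 c hc hp
    exact ⟨d, hd, by rwa [← c.subst_congr fun x hx => hC x ⟨c, hc, hx⟩]⟩

theorem Simulates.omission {C : UStore S} {E : BStore S} {X : Finset Var} {Y : Var}
    (hY : Y ∉ ufv C ∪ bfv E) {τ : State S} :
    Simulates CT ⟨C, E, X⟩ τ ↔ Simulates CT ⟨C, E, insert Y X⟩ τ := by
  refine imp_congr_right fun _ => ⟨?_, ?_⟩
  · rintro ⟨θ, h⟩
    have hne : ∀ x, x ∈ ufv C ∪ bfv E → x ≠ Y := fun x hx hxY => hY (hxY ▸ hx)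
    refine ⟨Function.update θ Y (.var Y), h.congr (fun x hx => ?_) (fun x hx => ?_) fun x hx => ?_⟩
    · by_cases hxY : x = Y
      · subst hxY
        simp
      · rw [Function.update_of_ne hxY]
        exact h.globals x (Finset.mem_of_mem_insert_of_ne hx hxY)
    · exact (Function.update_of_ne (hne x (Or.inl hx)) _ _).symm
    · exact (Function.update_of_ne (hne x (Or.inr hx)) _ _).symm
  · rintro ⟨θ, h⟩
    exact ⟨θ, h.congr (fun x hx => h.globals x (Finset.mem_insert_of_mem hx)) (fun _ _ => rfl)
      fun _ _ => rfl⟩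

/-- An equivalent change of the built-in store of `σ` is simulated by adding an instance of the new
store to `τ`. -/
theorem SimulatesVia.transformation {C : UStore S} {D E : BStore S} {X : Finset Var} {τ : State S}
    {θ : Var → Tm S} (h : SimulatesVia CT θ ⟨C, D, X⟩ τ)
    (hDE : EquivExcept CT (ufv C ∪ ↑X) D E) :
    ∃ τ' θ', Acc CT Q τ τ' ∧ SimulatesVia CT θ' ⟨C, E, X⟩ τ' := by
  classical
  obtain ⟨h1, h2, h3, h4⟩ := h
  have hF : (ufv C ∪ ↑X).Finite := (finite_ufv C).union (Finset.finite_toSet X)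
  obtain ⟨m, hm⟩ := exists_var_bound (τ.finite_vars.union
    (hF.biUnion fun x _ => Finset.finite_toSet (θ x).varFinset))
  set η : Var → Tm S := fun x => if x ∈ ufv C ∪ ↑X then θ x else .var (x + m) with hη
  have hηF : ∀ x ∈ ufv C ∪ ↑X, θ x = η x := fun x hx => (if_pos hx).symm
  refine ⟨⟨τ.chr, τ.builtin + bsub η E, τ.globals⟩, η, .enrich _ _ _ _ ?_, ?_⟩
  · intro M _ hM v hv
    have hD := (bHolds_bsub v θ D).1 (h2 M hM v hv)
    obtain ⟨w, hw, hE⟩ := (hDE M hM _).1 ⟨_, fun _ _ => rfl, hD⟩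
    refine ⟨fun y => if y < m then v y else w (y - m), fun x hx => ?_, ?_⟩
    · exact if_pos (hm x (Or.inl hx))
    · rw [bHolds_bsub]
      refine (bHolds_congr E fun x _ => ?_).1 hE
      by_cases hx : x ∈ ufv C ∪ ↑X
      · rw [hw hx, ← hηF x hx]
        refine term_realize_congr _ fun y hy => ?_
        exact (if_pos (hm y (Or.inr (Set.mem_biUnion hx hy)))).symm
      · simp only [hη, if_neg hx, Term.realize_var]
        simp
  · refine ⟨fun x hx => ?_, entails_add_right _ _, ?_, ?_⟩
    · rw [← hηF x (Or.inr hx)]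
      exact h1 x hx
    · dsimp only at h3 ⊢
      rw [← usub_congr _ fun x ⟨c, hc, hx⟩ => hηF x (Or.inl ⟨c, (mem_linPart.1 hc).1, hx⟩)]
      exact h3.mono fun _ _ _ _ h => h.mono (entails_add_left _ _)
    · intro c hc hp
      obtain ⟨d, hd, h⟩ := h4 c hc hp
      refine ⟨d, hd, ?_⟩
      rw [← c.subst_congr fun x hx => hηF x (Or.inl ⟨c, hc, hx⟩)]
      exact h.mono (entails_add_left _ _)

/-- The application of a rule to `σ` is simulated by firing the rule in `τ` at the substitution by
which its head occurs there. -/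
theorem SimulatesVia.ruleStep (hQ : Q.IsHybrid) {σ σ' τ : State S} (hs : RuleStep Q σ σ')
    {θ : Var → Tm S} (h : SimulatesVia CT θ σ τ) (hτ : Consistent CT τ.builtin) :
    ∃ τ' θ', Relation.ReflTransGen (Acc CT Q) τ τ' ∧ SimulatesVia CT θ' σ' τ' := by
  classical
  obtain ⟨r, ρ, hr, D, E, X, fresh⟩ := hs
  obtain ⟨h1, h2, h3, h4⟩ := h
  obtain ⟨T, F, X'⟩ := τ
  dsimp only at h1 h2 h3 h4 hτ
  have hyb := (hQ r hr).rename ρ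
  set r' := r.rename ρ with hr'
  rw [linPart_add, linPart_add, linPart_eq_zero.2 hyb.1, zero_add, linPart_eq_self hyb.2, usub,
    Multiset.map_add, Multiset.rel_add_right] at h3
  -- The linear part of `τ` consists of instances `H` of the removed head and instances `L` of the
  -- remaining linear constraints.
  obtain ⟨H, L, hH, hL, hT⟩ := h3
  obtain ⟨T', hT', hmem⟩ := exists_eq_linPart_add T
  rw [hT, Multiset.add_assoc] at hT'
  have hκ : ∀ x, (ren S ρ x).subst θ = θ (ρ x) := fun x => rfl
  have hfv : ∀ x ∈ r'.localVars, x ∉ ufv D ∧ x ∉ bfv E ∧ x ∉ X := fun x hx => by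
    have := Set.disjoint_left.1 fresh hx
    simp only [Set.mem_union, not_or, Finset.mem_coe] at this
    tauto
  have hkept : ∀ k ∈ r'.kept, ∃ c ∈ L + T', UEq CT F c (k.subst θ) := by
    intro k hk
    obtain ⟨d, hd, h⟩ := h4 k (by simp [hk]) (hyb.1 k hk)
    refine ⟨d, ?_, h⟩
    have hp : d.IsPersistent := (h.isPersistent_iff hτ).2 (by simpa using hyb.1 k hk)
    exact Multiset.mem_add.2 (Or.inr ((hmem d).2 ⟨hd, hp⟩))
  obtain ⟨f, F', hacc, hF, hbody, heq, -⟩ := exists_acc_fire (CT := CT) hr (fun x => θ (ρ x)) H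
    (L + T') F X' Set.finite_empty
    (by
      have := hH
      rw [hr', Rule.rename] at this
      change Multiset.Rel _ H (usub θ (usub (ren S ρ) r.removed)) at this
      rwa [usub_usub] at this)
    (by
      intro k hk
      obtain ⟨c, hc, h⟩ := hkept _ (Multiset.mem_map_of_mem _ hk)
      rw [UserConstraint.subst_subst] at h
      exact ⟨c, hc, h⟩)
    (by
      intro M _ hM v hv
      have := h2 M hM v hv
      rw [bsub, Multiset.map_add, bHolds_add] at this
      have h' : BHolds M v (bsub θ (bsub (ren S ρ) r.guard)) := this.1
      rwa [bsub_bsub] at h')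
  rw [← hT'] at hacc
  -- The local variables of the rule are instantiated by those of the variant fired in `τ`.
  set η : Var → Tm S := fun x => if x ∈ r'.localVars then .var (f (ρ.symm x)) else θ x with hη
  have hηl : ∀ x, x ∉ r'.localVars → η x = θ x := fun x hx => if_neg hx
  have hηD : ∀ x ∈ ufv D, η x = θ x := fun x hx => hηl x fun hl => (hfv x hl).1 hx
  have hηE : ∀ x ∈ bfv E, η x = θ x := fun x hx => hηl x fun hl => (hfv x hl).2.1 hx
  have hηr : ∀ (M : Type u) [S.lang.Structure M], ∀ v : Var → M, BHolds M v F' →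
      ∀ x ∈ r.vars, (η (ρ x)).realize v = v (f x) := by
    intro M _ v hv x hx
    rcases (r.mem_vars_iff x).1 hx with h | h
    · rw [hηl, heq M v hv x h]
      rw [hr', Rule.localVars_rename]
      rintro ⟨y, hy, hyx⟩
      exact hy.2 (ρ.injective hyx ▸ h)
    · have : ρ x ∈ r'.localVars := by
        rw [hr', Rule.localVars_rename]
        exact Set.mem_image_of_mem ρ h
      simp [hη, if_pos this]
  have hUEq : ∀ c : UserConstraint S, c.fv ⊆ r.vars →
      UEq CT F' (c.subst (ren S f)) ((c.subst (ren S ρ)).subst η) := by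
    intro c hc M _ hM v hv
    rw [UserConstraint.ground_subst, UserConstraint.ground_subst, UserConstraint.ground_subst]
    exact c.ground_congr fun x hx => (hηr M v hv x (hc hx)).symm
  have hbodyfv : ∀ c ∈ r.bodyU, c.fv ⊆ r.vars := fun c hc x hx => Or.inr ⟨c, hc, hx⟩
  refine ⟨_, η, hacc, fun x hx => ?_, ?_, ?_, ?_⟩
  · rw [hηl x fun hl => (hfv x hl).2.2 hx]
    exact h1 x hx
  · intro M _ hM v hv
    have hb := hbody M hM v hv
    rw [bHolds_ren, bHolds_add] at hb
    have he := h2 M hM v (hF M hM v hv)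
    rw [bsub, Multiset.map_add, bHolds_add] at he
    have he2 : BHolds M v (bsub θ E) := he.2
    rw [bsub, Multiset.map_add, Multiset.map_add, bHolds_add, bHolds_add]
    refine ⟨⟨?_, ?_⟩, ?_⟩
    · change BHolds M v (bsub η (bsub (ren S ρ) r.bodyB))
      rw [bHolds_bsub, bHolds_ren]
      exact (bHolds_congr _ fun x hx => hηr M v hv x (Or.inl (Or.inr hx))).2 hb.2
    · change BHolds M v (bsub η (bsub (ren S ρ) r.guard))
      rw [bHolds_bsub, bHolds_ren]
      exact (bHolds_congr _ fun x hx => hηr M v hv x (Or.inl (Or.inl (Or.inr hx)))).2 hb.1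
    · change BHolds M v (bsub η E)
      rwa [bsub_congr E hηE]
  · dsimp only
    rw [linPart_add, linPart_add, linPart_add, linPart_add, linPart_eq_zero.2 hyb.1, add_zero]
    rw [show usub η (linPart r'.bodyU + linPart D) =
      usub η (linPart r'.bodyU) + usub η (linPart D) from Multiset.map_add _ _ _]
    refine Multiset.Rel.add ?_ ?_
    · have e : linPart r'.bodyU = usub (ren S ρ) (linPart r.bodyU) := linPart_usub _ _
      rw [e, linPart_usub, usub, usub, Multiset.map_map, Multiset.rel_map]
      exact Multiset.rel_refl_of_refl_on fun c hc => hUEq c (hbodyfv c (mem_linPart.1 hc).1)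
    · have hT0 : linPart T' = 0 := linPart_eq_zero.2 fun c hc => ((hmem c).1 hc).2
      have hlin : ∀ c ∈ L, c.IsLinear := fun c hc =>
        (mem_linPart.1 (hT ▸ Multiset.mem_add.2 (Or.inr hc) : c ∈ linPart T)).2
      rw [hT0, add_zero, linPart_eq_self hlin]
      change Multiset.Rel _ L (usub η (linPart D))
      rw [usub_congr (linPart D) fun x ⟨c, hc, hx⟩ => hηD x ⟨c, (mem_linPart.1 hc).1, hx⟩]
      exact hL.mono fun _ _ _ _ h => h.mono hF
  · intro c hc hp
    rw [Multiset.mem_add, Multiset.mem_add] at hc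
    rcases hc with (hc | hc) | hc
    · obtain ⟨c, hc', rfl⟩ := Multiset.mem_map.1 hc
      exact ⟨_, Multiset.mem_add.2 (Or.inl (Multiset.mem_map_of_mem _ hc')),
        hUEq c (hbodyfv c hc')⟩
    · obtain ⟨d, hd, h⟩ := hkept c hc
      refine ⟨d, Multiset.mem_add.2 (Or.inr hd), ?_⟩
      rw [c.subst_congr fun x hx => hηl x fun hl => hl.2 (Or.inl ⟨c, hc, hx⟩)]
      exact h.mono hF
    · obtain ⟨d, hd, h⟩ := h4 c (Multiset.mem_add.2 (Or.inr hc)) hp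
      have hdp : d.IsPersistent := (h.isPersistent_iff hτ).2 (by simpa using hp)
      refine ⟨d, Multiset.mem_add.2 (Or.inr (Multiset.mem_add.2
        (Or.inr ((hmem d).2 ⟨hd, hdp⟩)))), ?_⟩
      rw [c.subst_congr fun x hx => hηD x ⟨c, hc, hx⟩]
      exact h.mono hF

/-- Every step of a state is simulated by an accumulating derivation from any state that simulates
it. -/
theorem Simulates.step (hQ : Q.IsHybrid) {σ σ' τ : State S} (hs : Step CT Q σ σ')
    (h : Simulates CT σ τ) :
    ∃ τ', Relation.ReflTransGen (Acc CT Q) τ τ' ∧ Simulates CT σ' τ' := by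
  by_cases hτ : Consistent CT τ.builtin
  · obtain ⟨θ, hθ⟩ := h hτ
    have habs : ∀ σ σ' : State S, AbstractStep CT σ σ' →
        (∀ θ, SimulatesVia CT θ σ τ → ∃ τ', Relation.ReflTransGen (Acc CT Q) τ τ' ∧
          Simulates CT σ' τ') ∧
        (∀ θ, SimulatesVia CT θ σ' τ → ∃ τ', Relation.ReflTransGen (Acc CT Q) τ τ' ∧
          Simulates CT σ τ') := by
      intro σ σ' hs
      cases hs with
      | equality C D X Y t =>
        exact ⟨fun θ hθ => ⟨τ, .refl, Simulates.equality.1 fun _ => ⟨θ, hθ⟩⟩,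
          fun θ hθ => ⟨τ, .refl, Simulates.equality.2 fun _ => ⟨θ, hθ⟩⟩⟩
      | inconsistent C D X =>
        have key : ∀ {C : UStore S} {θ}, SimulatesVia CT θ ⟨C, {.fls}, X⟩ τ → False := by
          intro C θ hθ
          obtain ⟨M, _, hM, v, hv⟩ := hτ
          exact hθ.builtin M hM v hv .fls
            (Multiset.mem_map.2 ⟨.fls, Multiset.mem_singleton_self _, rfl⟩)
        exact ⟨fun θ hθ => (key hθ).elim, fun θ hθ => (key hθ).elim⟩
      | transformation C D E X hDE =>
        have key : ∀ {D E : BStore S}, EquivExcept CT (ufv C ∪ ↑X) D E → ∀ θ,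
            SimulatesVia CT θ ⟨C, D, X⟩ τ → ∃ τ', Relation.ReflTransGen (Acc CT Q) τ τ' ∧
              Simulates CT ⟨C, E, X⟩ τ' := by
          intro D E hDE θ hθ
          obtain ⟨τ', θ', h1, h2⟩ := hθ.transformation (Q := Q) hDE
          exact ⟨τ', .single h1, fun _ => ⟨θ', h2⟩⟩
        exact ⟨key hDE, key fun M _ hM v => (hDE M hM v).symm⟩
      | omission C E X Y hY =>
        exact ⟨fun θ hθ => ⟨τ, .refl, (Simulates.omission hY).1 fun _ => ⟨θ, hθ⟩⟩,
          fun θ hθ => ⟨τ, .refl, (Simulates.omission hY).2 fun _ => ⟨θ, hθ⟩⟩⟩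
    rcases hs with hs | hs
    · cases hs with
      | abs hs => exact (habs _ _ hs).1 θ hθ
      | absSymm hs => exact (habs _ _ hs).2 θ hθ
      | contr hs => exact ⟨τ, .refl, (Simulates.contraction hs).1 h⟩
      | contrSymm hs => exact ⟨τ, .refl, (Simulates.contraction hs).2 h⟩
    · obtain ⟨τ', θ', h1, h2⟩ := hθ.ruleStep hQ hs hτ
      exact ⟨τ', h1, fun _ => ⟨θ', h2⟩⟩
  · exact ⟨τ, .refl, fun h => (hτ h).elim⟩

theorem Simulates.reaches (hQ : Q.IsHybrid) {σ σ' τ : State S}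
    (hs : Reaches (HybridEquiv CT) Q σ σ') (h : Simulates CT σ τ) :
    ∃ τ', Relation.ReflTransGen (Acc CT Q) τ τ' ∧ Simulates CT σ' τ' := by
  have hs' := hs.reflTransGen
  clear hs
  induction hs' with
  | refl => exact ⟨τ, .refl, h⟩
  | tail _ hs ih =>
    obtain ⟨τ₁, h1, h2⟩ := ih
    obtain ⟨τ₂, h3, h4⟩ := h2.step hQ hs
    exact ⟨τ₂, h1.trans h3, h4⟩

end


/-! ### Ground reductions and the interpretation of the linear symbols -/

theorem Rule.rename_refl (r : Rule S) : r.rename (Equiv.refl Var) = r := by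
  have h1 : ∀ C : UStore S, C.map (UserConstraint.subst fun x => .var (Equiv.refl Var x)) = C :=
    usub_var
  have h2 : ∀ C : BStore S, C.map (BuiltInConstraint.subst fun x => .var (Equiv.refl Var x)) = C :=
    bsub_var
  cases r
  simp only [Rule.rename, h1, h2]

section

variable {M : Type u} [S.lang.Structure M]

/-- The multiset of ground constraints can be rewritten to the empty one by ground instances of
rules whose kept head, guard, and built-in and persistent body constraints are true in the structure.
The values of the local variables of a rule can be chosen freely. -/
inductive Reducible (M : Type u) [S.lang.Structure M] (Q : Program S) :
    Multiset (GroundConstraint S M) → Prop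
  | zero : Reducible M Q 0
  | step (r : Rule S) (hr : r ∈ Q.rules) (w : Var → M) (kept : UHolds M w r.kept)
      (builtin : BHolds M w (r.guard + r.bodyB))
      (per : ∀ c ∈ r.bodyU, c.IsPersistent → (c.ground M w).Holds)
      (N : Multiset (GroundConstraint S M)) (h : Reducible M Q (groundLin w r.bodyU + N)) :
      Reducible M Q (r.removed.map (UserConstraint.ground M w) + N)

theorem Reducible.add {Q : Program S} {N N' : Multiset (GroundConstraint S M)}
    (h : Reducible M Q N) (h' : Reducible M Q N') : Reducible M Q (N + N') := by
  induction h with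
  | zero => simpa using h'
  | step r hr w kept builtin per N h ih =>
    rw [Multiset.add_assoc] at ih ⊢
    exact .step r hr w kept builtin per _ ih

theorem map_ground_eq_of_rel {CT : ConstraintTheory S} (hM : CT.ModeledBy M) {E : BStore S}
    {v : Var → M} (hv : BHolds M v E) {A B : UStore S} (h : Multiset.Rel (UEq CT E) A B) :
    A.map (UserConstraint.ground M v) = B.map (UserConstraint.ground M v) := by
  rw [← Multiset.rel_eq, Multiset.rel_map]
  exact h.mono fun _ _ _ _ h => h M hM v hv

variable {CT : ConstraintTheory S} {Q : Program S}

/-- Truth with reducible linear part is inherited backwards along rule applications: the reduction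
is prolonged by one step. -/
theorem RuleStep.satState_of_satState (hQ : Q.IsHybrid) {σ τ : State S} (h : RuleStep Q σ τ)
    {v : Var → M} (hτ : SatState GroundConstraint.Holds (Reducible M Q) v τ) :
    SatState GroundConstraint.Holds (Reducible M Q) v σ := by
  obtain ⟨r, ρ, hr, D, E, X, fresh⟩ := h
  have hyb := (hQ r hr).rename ρ
  obtain ⟨w, hw, hb, hp, hl⟩ := hτ
  refine ⟨w, hw, ?_, ?_, ?_⟩
  · simp only [bHolds_add] at hb ⊢
    exact ⟨hb.1.2, hb.2⟩
  · intro c hc hcp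
    simp only [Multiset.mem_add] at hc
    rcases hc with (hc | hc) | hc
    · exact hp c (by simp [hc]) hcp
    · exact (((UserConstraint.isLinear_iff_not c).1 (hyb.2 c hc)) hcp).elim
    · exact hp c (by simp [hc]) hcp
  · have e0 : groundLin w (r.rename ρ).kept = 0 := by
      rw [groundLin, linPart_eq_zero.2 hyb.1, Multiset.map_zero]
    have e1 : groundLin w (r.rename ρ).removed =
        r.removed.map (UserConstraint.ground M fun x => w (ρ x)) := by
      rw [groundLin, linPart_eq_self hyb.2, Rule.rename, Multiset.map_map]
      exact Multiset.map_congr rfl fun c _ => c.ground_subst _ w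
    have e2 : groundLin w (r.rename ρ).bodyU = groundLin (fun x => w (ρ x)) r.bodyU :=
      groundLin_usub w (ren S ρ) r.bodyU
    dsimp only at hl hb hp ⊢
    rw [groundLin_add, groundLin_add, e0, zero_add, e1]
    rw [groundLin_add, groundLin_add, e0, add_zero, e2] at hl
    refine .step r hr _ ?_ ?_ ?_ _ hl
    · have : UHolds M w (usub (ren S ρ) r.kept) := fun c hc => by
        rw [← UserConstraint.holds_ground]
        exact hp c (Multiset.mem_add.2 (Or.inl (Multiset.mem_add.2 (Or.inr hc)))) (hyb.1 c hc)
      exact (uHolds_usub w _ _).1 this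
    · rw [bHolds_add, bHolds_add] at hb
      rw [bHolds_add]
      exact ⟨(bHolds_bsub w (ren S ρ) _).1 hb.1.2, (bHolds_bsub w (ren S ρ) _).1 hb.1.1⟩
    · intro c hc hcp
      have := hp (c.subst (ren S ρ)) (Multiset.mem_add.2 (Or.inl (Multiset.mem_add.2 (Or.inl
        (Multiset.mem_map_of_mem _ hc))))) (by simpa using hcp)
      rwa [UserConstraint.ground_subst] at this

theorem Reaches.satState_of_satState (hM : CT.ModeledBy M) (hQ : Q.IsHybrid) {σ τ : State S}
    (h : Reaches (HybridEquiv CT) Q σ τ) {v : Var → M}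
    (hτ : SatState GroundConstraint.Holds (Reducible M Q) v τ) :
    SatState GroundConstraint.Holds (Reducible M Q) v σ := by
  have h' := h.reflTransGen
  clear h
  induction h' with
  | refl => exact hτ
  | tail _ h ih =>
    rcases h with h | h
    · exact ih ((h.satState_iff hM v).2 hτ)
    · exact ih (h.satState_of_satState hQ hτ)

/-- Accumulating steps do not affect the values of the variables: truth is inherited backwards
under the same valuation. -/
theorem Acc.satAt_of_satAt (hM : CT.ModeledBy M) (hQ : Q.IsHybrid) {σ τ : State S}
    (h : Acc CT Q σ τ) {v : Var → M}
    (hτ : SatAt GroundConstraint.Holds (Reducible M Q) v τ.chr τ.builtin) :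
    SatAt GroundConstraint.Holds (Reducible M Q) v σ.chr σ.builtin := by
  obtain ⟨hb, hp, hl⟩ := hτ
  cases h with
  | enrich C E D X h => exact ⟨((bHolds_add _ _ _).1 hb).1, hp, hl⟩
  | fire r₀ r ρ hr₀ hr H C E X removed kept guard fresh hH head =>
    subst hr
    have hyb := (hQ r₀ hr₀).rename ρ
    dsimp only at hb hp hl ⊢
    rw [bHolds_add] at hb
    have hHlin : ∀ c ∈ H, c.IsLinear := by
      intro c hc
      obtain ⟨d, hd, h⟩ := Multiset.exists_mem_of_rel_of_mem removed hc
      rw [UserConstraint.isLinear_iff_not, h.isPersistent_iff ⟨M, _, hM, v, hb.1⟩,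
        ← UserConstraint.isLinear_iff_not]
      exact hyb.2 d hd
    refine ⟨hb.1, ?_, ?_⟩
    · intro c hc hcp
      rcases Multiset.mem_add.1 hc with hc | hc
      · exact ((UserConstraint.isLinear_iff_not c).1 (hHlin c hc) hcp).elim
      · exact hp c (Multiset.mem_add.2 (Or.inr hc)) hcp
    · have e1 : groundLin v H =
          r₀.removed.map (UserConstraint.ground M fun x => v (ρ x)) := by
        rw [groundLin, linPart_eq_self hHlin, map_ground_eq_of_rel hM hb.1 removed, Rule.rename,
          Multiset.map_map]
        exact Multiset.map_congr rfl fun c _ => c.ground_subst _ v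
      have e2 : groundLin v (r₀.rename ρ).bodyU = groundLin (fun x => v (ρ x)) r₀.bodyU :=
        groundLin_usub v (ren S ρ) r₀.bodyU
      rw [groundLin_add, e1]
      rw [groundLin_add, e2] at hl
      refine .step r₀ hr₀ _ ?_ ?_ ?_ _ hl
      · have : UHolds M v (usub (ren S ρ) r₀.kept) := fun k hk => by
          obtain ⟨c, hc, h⟩ := kept k hk
          rw [← UserConstraint.holds_ground, ← h M hM v hb.1]
          exact hp c (Multiset.mem_add.2 (Or.inr hc))
            ((h.isPersistent_iff ⟨M, _, hM, v, hb.1⟩).2 (hyb.1 k hk))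
        exact (uHolds_usub v _ _).1 this
      · have : BHolds M v (bsub (ren S ρ) (r₀.guard + r₀.bodyB)) := by
          rw [bsub, Multiset.map_add]
          exact hb.2
        exact (bHolds_bsub v _ _).1 this
      · intro c hc hcp
        have := hp (c.subst (ren S ρ)) (Multiset.mem_add.2 (Or.inl
          (Multiset.mem_map_of_mem _ hc))) (by simpa using hcp)
        rwa [UserConstraint.ground_subst] at this

theorem Acc.reflTransGen_satAt_of_satAt (hM : CT.ModeledBy M) (hQ : Q.IsHybrid) {σ τ : State S}
    (h : Relation.ReflTransGen (Acc CT Q) σ τ) {v : Var → M}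
    (hτ : SatAt GroundConstraint.Holds (Reducible M Q) v τ.chr τ.builtin) :
    SatAt GroundConstraint.Holds (Reducible M Q) v σ.chr σ.builtin := by
  induction h with
  | refl => exact hτ
  | tail _ h ih => exact ih (h.satAt_of_satAt hM hQ hτ)

theorem SimulatesVia.satAt {Ψ : GroundConstraint S M → Prop}
    {Φ : Multiset (GroundConstraint S M) → Prop} (hM : CT.ModeledBy M) {θ : Var → Tm S}
    {σ τ : State S} (h : SimulatesVia CT θ σ τ) {v : Var → M}
    (hτ : SatAt Ψ Φ v τ.chr τ.builtin) :
    SatAt Ψ Φ (fun x => (θ x).realize v) σ.chr σ.builtin := by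
  obtain ⟨hb, hp, hl⟩ := hτ
  rw [← satAt_usub]
  refine ⟨h.builtin M hM v hb, ?_, ?_⟩
  · intro c hc hcp
    obtain ⟨c, hc', rfl⟩ := Multiset.mem_map.1 hc
    have hcp' : c.IsPersistent := by simpa using hcp
    obtain ⟨d, hd, hdc⟩ := h.per c hc' hcp'
    rw [← hdc M hM v hb]
    exact hp d hd ((hdc.isPersistent_iff ⟨M, _, hM, v, hb⟩).2 hcp)
  · rw [groundLin, linPart_usub, ← map_ground_eq_of_rel hM hb h.lin]
    exact hl

theorem exists_uEq_of_ground_eq {c d : UserConstraint S} {v : Var → M}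
    (h : c.ground M v = d.ground M v) : ∃ F : BStore S, BHolds M v F ∧ UEq CT F c d := by
  have key : ∀ {n : ℕ} (s t : Fin n → Tm S), (∀ i, (s i).realize v = (t i).realize v) →
      ∃ F : BStore S, BHolds M v F ∧ ∀ (M' : Type u) [S.lang.Structure M'], ∀ v' : Var → M',
        BHolds M' v' F → ∀ i, (s i).realize v' = (t i).realize v' := by
    intro n s t hst
    refine ⟨Finset.univ.val.map fun i => .eq (s i) (t i), ?_, ?_⟩
    · intro c hc
      obtain ⟨i, -, rfl⟩ := Multiset.mem_map.1 hc
      exact hst i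
    · intro M' _ v' h i
      exact h (.eq (s i) (t i)) (Multiset.mem_map_of_mem _ (Finset.mem_univ i))
  cases c with
  | lin R s =>
    cases d with
    | per R' t => cases h
    | lin R' t =>
      cases h_eq : (GroundConstraint.lin.inj h).1
      obtain rfl := eq_of_heq (GroundConstraint.lin.inj h).2.1
      obtain ⟨F, h1, h2⟩ := key s t (congrFun (eq_of_heq (GroundConstraint.lin.inj h).2.2))
      refine ⟨F, h1, fun M' _ _ v' hv' => ?_⟩
      simp only [UserConstraint.ground, h2 M' v' hv']
  | per R s =>
    cases d with
    | lin R' t => cases h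
    | per R' t =>
      cases h_eq : (GroundConstraint.per.inj h).1
      obtain rfl := eq_of_heq (GroundConstraint.per.inj h).2.1
      obtain ⟨F, h1, h2⟩ := key s t (congrFun (eq_of_heq (GroundConstraint.per.inj h).2.2))
      refine ⟨F, h1, fun M' _ _ v' hv' => ?_⟩
      simp only [UserConstraint.ground, h2 M' v' hv']

theorem exists_rel_uEq_of_ground_eq {A B : UStore S} {v : Var → M}
    (h : Multiset.Rel (fun c d => c.ground M v = d.ground M v) A B) :
    ∃ F : BStore S, BHolds M v F ∧ Multiset.Rel (UEq CT F) A B := by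
  induction h with
  | zero => exact ⟨0, by simp [BHolds], .zero⟩
  | cons hab _ ih =>
    obtain ⟨F, h1, h2⟩ := ih
    obtain ⟨F', h3, h4⟩ := exists_uEq_of_ground_eq (CT := CT) hab
    exact ⟨F' + F, (bHolds_add _ _ _).2 ⟨h3, h1⟩, .cons (h4.mono (entails_add_left _ _))
      (h2.mono fun _ _ _ _ h => h.mono (entails_add_right _ _))⟩

/-- No simplification rule applies to a true state without linear constraints. -/
theorem Reaches.satState_zero (hM : CT.ModeledBy M) (hQ : Q.IsHybrid)
    (hQs : ∀ r ∈ Q.rules, r.removed ≠ 0) {Ψ : GroundConstraint S M → Prop} {σ τ : State S}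
    (h : Reaches (HybridEquiv CT) Q σ τ) {v : Var → M}
    (hσ : SatState Ψ (fun N => N = 0) v σ) : SatState Ψ (fun N => N = 0) v τ := by
  have h' := h.reflTransGen
  clear h
  induction h' with
  | refl => exact hσ
  | tail _ h ih =>
    rcases h with h | h
    · exact (h.satState_iff hM v).1 ih
    · exfalso
      obtain ⟨r, ρ, hr, D, E, X, fresh⟩ := h
      obtain ⟨w, -, -, -, hl⟩ := ih
      have hyb := (hQ r hr).rename ρ
      simp only [groundLin, linPart_add, linPart_eq_self hyb.2] at hl
      have hl' := Multiset.map_eq_zero.1 hl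
      rw [add_eq_zero, add_eq_zero] at hl'
      exact hQs r hr (Multiset.map_eq_zero.1 hl'.1.2)

/-- Truth with reducible linear part is preserved by the derivations of a confluent program. The
proof is by induction on the ground reduction of the linear part. The first ground step is lifted to
a derivation of an instance of `σ` enriched by the facts the step needs; confluence joins it with
the instance of the given derivation. -/
theorem Reducible.satState_of_reaches (hM : CT.ModeledBy M) (hQ : Q.IsHybrid)
    (hQs : ∀ r ∈ Q.rules, r.removed ≠ 0) (hconf : Confluent (HybridEquiv CT) Q)
    {N : Multiset (GroundConstraint S M)} (hN : Reducible M Q N) {σ τ : State S} {v w : Var → M}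
    (hwN : groundLin w σ.chr = N) (hb : BHolds M w σ.builtin)
    (hp : ∀ c ∈ σ.chr, c.IsPersistent → (c.ground M w).Holds) (hw : Set.EqOn w v ↑σ.globals)
    (hστ : Reaches (HybridEquiv CT) Q σ τ) :
    SatState GroundConstraint.Holds (Reducible M Q) v τ := by
  classical
  induction hN generalizing σ τ v w with
  | zero =>
    obtain ⟨w', h1, h2, h3, h4⟩ := hστ.satState_zero hM hQ hQs (v := v) ⟨w, hw, hb, hp, hwN⟩
    exact ⟨w', h1, h2, h3, by rw [h4]; exact .zero⟩
  | step r hr w₀ kept builtin per R h ih =>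
    obtain ⟨C, E, X⟩ := σ
    dsimp only at hwN hb hp hw
    -- The linear constraints of the state split into the removed ones and the rest.
    have hsplit : Multiset.Rel (fun c g => c.ground M w = g) (linPart C)
        (r.removed.map (UserConstraint.ground M w₀) + R) := by
      rw [← hwN, groundLin, Multiset.rel_map_right]
      exact Multiset.rel_refl_of_refl_on fun _ _ => rfl
    rw [Multiset.rel_add_right] at hsplit
    obtain ⟨L₁, L₂, hL₁, hL₂, hL⟩ := hsplit
    rw [Multiset.rel_map_right] at hL₁
    have hL₂R : L₂.map (UserConstraint.ground M w) = R := by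
      rw [← Multiset.rel_eq, Multiset.rel_map_left]
      exact hL₂
    have hlin : ∀ c ∈ L₁ + L₂, c.IsLinear := fun c hc => (mem_linPart.1 (hL ▸ hc)).2
    have hlin₁ : ∀ c ∈ L₁, c.IsLinear := fun c hc => hlin c (Multiset.mem_add.2 (Or.inl hc))
    have hlin₂ : ∀ c ∈ L₂, c.IsLinear := fun c hc => hlin c (Multiset.mem_add.2 (Or.inr hc))
    obtain ⟨C', hC', hmem⟩ := exists_eq_linPart_add C
    have hlinC' : linPart C' = 0 := linPart_eq_zero.2 fun c hc => ((hmem c).1 hc).2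
    have hyb := hQ r hr
    -- Names for the values of the local variables of the state and of the variables of the rule.
    obtain ⟨m, hm⟩ := exists_var_bound (Finset.finite_toSet (X ∪ τ.globals))
    set θ : Var → Tm S := fun x => if x ∈ X then .var x else .var (2 * x + m) with hθ
    set κ : Var → Tm S := fun x => .var (2 * x + 1 + m) with hκ
    set v₁ : Var → M := fun y : ℕ => if y < m then v y else
      if (y - m) % 2 = 0 then w ((y - m) / 2) else w₀ ((y - m) / 2) with hv₁
    have hv₁θ : (fun x => (θ x).realize v₁) = w := by
      funext x
      by_cases hx : x ∈ X
      · simp only [hθ, if_pos hx, Term.realize_var, hv₁]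
        rw [if_pos (hm x (by simp [hx])), hw hx]
      · have e1 : ¬ (2 * x + m : ℕ) < m := by simp
        have e2 : (2 * x + m - m : ℕ) = 2 * x := by simp
        simp only [hθ, if_neg hx, Term.realize_var, hv₁, if_neg e1, e2]
        simp
    have hv₁κ : (fun x => (κ x).realize v₁) = w₀ := by
      funext x
      have e1 : ¬ (2 * x + 1 + m : ℕ) < m := by simp
      have e2 : (2 * x + 1 + m - m : ℕ) = 2 * x + 1 := by simp
      have e3 : ¬ (2 * x + 1 : ℕ) % 2 = 0 := by simp [Nat.add_mod]
      have e4 : (2 * x + 1 : ℕ) / 2 = x := Nat.div_eq_of_lt_le (by simp [Nat.mul_comm]) (by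
        simp [Nat.add_mul, Nat.mul_comm])
      simp only [hκ, Term.realize_var, hv₁, if_neg e1, e2, if_neg e3, e4]
    have hground₁ : ∀ c : UserConstraint S, (c.subst θ).ground M v₁ = c.ground M w := fun c => by
      rw [UserConstraint.ground_subst, hv₁θ]
    have hground₂ : ∀ c : UserConstraint S, (c.subst κ).ground M v₁ = c.ground M w₀ := fun c => by
      rw [UserConstraint.ground_subst, hv₁κ]
    -- The equations that make the instances of the removed constraints equal to the head of the rule.
    obtain ⟨F, hF, hFrel⟩ := exists_rel_uEq_of_ground_eq (CT := CT) (v := v₁) (A := usub θ L₁)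
      (B := usub κ r.removed) (by
        rw [usub, usub, Multiset.rel_map]
        refine hL₁.mono fun c _ d _ h => ?_
        rw [hground₁, hground₂]
        exact h)
    -- The enriched instance of the state.
    set D : UStore S := usub θ (L₂ + C') + usub κ r.kept with hD
    set G : BStore S := bsub θ E + (bsub κ r.guard + F) with hG
    set U : Finset Var := X ∪ τ.globals with hU
    have hGv₁ : BHolds M v₁ G := by
      rw [hG, bHolds_add, bHolds_add, bHolds_bsub, bHolds_bsub, hv₁θ, hv₁κ]
      exact ⟨hb, ((bHolds_add _ _ _).1 builtin).1, hF⟩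
    have hGF : Entails CT G F := (entails_add_right _ _).trans (entails_add_right _ _)
    obtain ⟨f, G', hacc, hG'G, -, -, hval⟩ := exists_acc_fire (CT := CT) hr κ (usub θ L₁) D G U
      (State.finite_vars (⟨usub θ L₁ + D, G, U⟩ : State S))
      (hFrel.mono fun _ _ _ _ h => h.mono hGF)
      (fun k hk => ⟨_, Multiset.mem_add.2 (Or.inr (Multiset.mem_map_of_mem _ hk)), UEq.refl _ _⟩)
      ((entails_add_right _ _).trans (entails_add_left _ _))
    obtain ⟨v₂, hv₂, hG'v₂, hfv₂⟩ := hval M v₁ w₀ hGv₁ (fun x _ => (congrFun hv₁κ x).symm) builtin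
    have hground₃ : ∀ c ∈ r.bodyU, (c.subst (ren S f)).ground M v₂ = c.ground M w₀ := by
      intro c hc
      rw [UserConstraint.ground_subst]
      exact c.ground_congr fun x hx => hfv₂ x (Or.inr ⟨c, hc, hx⟩)
    have hground₄ : ∀ c ∈ D, c.ground M v₂ = c.ground M v₁ := fun c hc =>
      c.ground_congr fun x hx => hv₂ (Or.inl (Or.inl (by
        rw [ufv_add]
        exact Or.inr ⟨c, hc, hx⟩)))
    have hU₂ : Set.EqOn v₂ v₁ ↑U := fun x hx => hv₂ (Or.inr hx)
    have hDlin : groundLin v₂ D = R := by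
      have e1 : groundLin v₂ D = groundLin v₁ D :=
        Multiset.map_congr rfl fun c hc => hground₄ c (mem_linPart.1 hc).1
      have e2 : linPart (usub κ r.kept) = 0 := by
        rw [linPart_usub, linPart_eq_zero.2 hyb.1]
        rfl
      rw [e1, hD, groundLin, linPart_add, e2, add_zero, linPart_usub, linPart_add, hlinC', add_zero,
        linPart_eq_self hlin₂, Multiset.map_map, ← hL₂R]
      exact Multiset.map_congr rfl fun c _ => hground₁ c
    -- The induction hypothesis applies after the first step of the reduction.
    have hstart : ∀ ω, Reaches (HybridEquiv CT) Q ⟨usub (ren S f) r.bodyU + D, G', U⟩ ω →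
        SatState GroundConstraint.Holds (Reducible M Q) v₂ ω := by
      intro ω hω
      refine ih (σ := ⟨usub (ren S f) r.bodyU + D, G', U⟩) (w := v₂) ?_ hG'v₂ ?_ (fun _ _ => rfl) hω
      · dsimp only
        rw [groundLin_add, hDlin, groundLin, linPart_usub, Multiset.map_map]
        congr 1
        exact Multiset.map_congr rfl fun c hc => hground₃ c (mem_linPart.1 hc).1
      · intro c hc hcp
        rcases Multiset.mem_add.1 hc with hc | hc
        · obtain ⟨c, hc', rfl⟩ := Multiset.mem_map.1 hc
          rw [hground₃ c hc']
          exact per c hc' (by simpa using hcp)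
        · rw [hground₄ c hc]
          rcases Multiset.mem_add.1 hc with hc | hc
          · obtain ⟨c, hc', rfl⟩ := Multiset.mem_map.1 hc
            rw [hground₁ c]
            have hcp' : c.IsPersistent := by simpa using hcp
            rcases Multiset.mem_add.1 hc' with h | h
            · exact ((UserConstraint.isLinear_iff_not c).1 (hlin₂ c h) hcp').elim
            · exact hp c ((hmem c).1 h).1 hcp'
          · obtain ⟨c, hc', rfl⟩ := Multiset.mem_map.1 hc
            rw [hground₂ c, UserConstraint.holds_ground]
            exact kept c hc'
    have hsim : Simulates CT ⟨C, E, X⟩ ⟨usub θ L₁ + D, G, U⟩ := by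
      refine fun _ => ⟨θ, fun x hx => if_pos hx, entails_add_left _ _, ?_, ?_⟩
      · have e1 : linPart (usub θ L₁ + D) = usub θ (linPart C) := by
          have e2 : linPart (usub κ r.kept) = 0 := by
            rw [linPart_usub, linPart_eq_zero.2 hyb.1]
            rfl
          rw [hD, linPart_add, linPart_add, e2, add_zero, linPart_usub, linPart_usub, linPart_add,
            hlinC', add_zero, linPart_eq_self hlin₁, linPart_eq_self hlin₂, hL, usub, usub, usub,
            Multiset.map_add]
        dsimp only
        rw [e1]
        exact Multiset.rel_refl_of_refl_on fun c _ => UEq.refl _ c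
      · intro c hc hcp
        refine ⟨c.subst θ, ?_, UEq.refl _ _⟩
        refine Multiset.mem_add.2 (Or.inr (Multiset.mem_add.2 (Or.inl ?_)))
        exact Multiset.mem_map_of_mem _ (Multiset.mem_add.2 (Or.inr ((hmem c).2 ⟨hc, hcp⟩)))
    obtain ⟨τ', hacc', hsim'⟩ := hsim.reaches hQ hστ
    -- Truth at the common successor `ω` is inherited backwards by `τ'` and hence by `τ`.
    obtain ⟨ω, hω₁, hω₂⟩ := hconf _ _ _ (Acc.reflTransGen_reaches hQ hacc)
      (Acc.reflTransGen_reaches hQ hacc')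
    obtain ⟨w', hw', hsat⟩ := hω₂.satState_of_satState hM hQ (hstart ω hω₁)
    obtain ⟨η, hη⟩ := hsim' ⟨M, _, hM, w', hsat.1⟩
    refine ⟨_, fun x hx => ?_, hη.satAt hM hsat⟩
    have hxU : x ∈ U := Finset.mem_union_right _ hx
    rw [Acc.reflTransGen_globals_eq hacc'] at hw'
    simp only [hη.globals x hx, Term.realize_var]
    rw [hw' hxU, hU₂ hxU]
    simp only [hv₁, if_pos (hm x hxU)]

/-- The interpretation of the linear symbols: a ground constraint is true if it belongs to some
reducible multiset. -/
def LinearTruth (M : Type u) [S.lang.Structure M] (Q : Program S) (g : GroundConstraint S M) :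
    Prop := ∃ N, Reducible M Q N ∧ g ∈ N

theorem exists_reducible_of_linearTruth {N : Multiset (GroundConstraint S M)}
    (h : ∀ g ∈ N, LinearTruth M Q g) : ∃ R, Reducible M Q (N + R) := by
  induction N using Multiset.induction_on with
  | empty => exact ⟨0, .zero⟩
  | cons g N ih =>
    obtain ⟨R, hR⟩ := ih fun g hg => h g (Multiset.mem_cons_of_mem hg)
    obtain ⟨N', hN', hg⟩ := h g (Multiset.mem_cons_self g N)
    obtain ⟨R', rfl⟩ := Multiset.exists_cons_of_mem hg
    refine ⟨R + R', ?_⟩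
    have := hR.add hN'
    rwa [Multiset.add_cons, Multiset.add_assoc, ← Multiset.cons_add] at this

/-- The elements that occur in a multiset of ground constraints can be named by new variables. -/
theorem exists_ground_eq (R : Multiset (GroundConstraint S M)) (v : Var → M) (m : ℕ) :
    ∃ (C : UStore S) (w : Var → M), (∀ x < m, w x = v x) ∧
      C.map (UserConstraint.ground M w) = R ∧ ∀ x ∈ ufv C, m ≤ x := by
  induction R using Multiset.induction_on with
  | empty => exact ⟨0, v, fun _ _ => rfl, rfl, by simp⟩
  | cons g R ih =>
    obtain ⟨C, w, hw, hC, hx⟩ := ih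
    obtain ⟨k, hk⟩ := exists_var_bound ((finite_ufv C).union (Set.finite_Iio m))
    have hmk : m ≤ k := by
      by_contra h
      exact lt_irrefl k (hk k (Or.inr (not_le.1 h)))
    have key : ∀ {n : ℕ} (a : Fin n → M),
        ∃ w' : Var → M, (∀ x < k, w' x = w x) ∧ ∀ i : Fin n, w' (k + i) = a i := by
      intro n a
      refine ⟨fun y : ℕ => if h : k ≤ y ∧ y - k < n then a ⟨y - k, h.2⟩ else w y,
        fun x hx => dif_neg fun h => absurd h.1 (not_le.2 hx), fun i => ?_⟩
      have h : k ≤ k + (i : ℕ) ∧ k + (i : ℕ) - k < n := by simp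
      refine (dif_pos h).trans (congrArg a (Fin.ext ?_))
      simp
    have fin : ∀ (c : UserConstraint S) (w' : Var → M),
        (∀ x < k, w' x = w x) → c.ground M w' = g → (∀ x ∈ c.fv, k ≤ x) →
        ∃ (C : UStore S) (w : Var → M), (∀ x < m, w x = v x) ∧
          C.map (UserConstraint.ground M w) = g ::ₘ R ∧ ∀ x ∈ ufv C, m ≤ x := by
      intro c w' h1 h2 h3
      refine ⟨c ::ₘ C, w', fun x hx => (h1 x (lt_of_lt_of_le hx hmk)).trans (hw x hx), ?_, ?_⟩
      · rw [Multiset.map_cons, h2, ← hC]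
        congr 1
        exact Multiset.map_congr rfl fun d hd => d.ground_congr fun x hx =>
          h1 x (hk x (Or.inl ⟨d, hd, hx⟩))
      · intro x hx'
        rw [ufv_cons] at hx'
        exact hx'.elim (fun h => hmk.trans (h3 x h)) (hx x)
    cases g with
    | @lin n L a =>
      obtain ⟨w', h1, h2⟩ := key a
      refine fin (.lin L fun i => .var (k + (i : ℕ))) w' h1 ?_ ?_
      · simp [UserConstraint.ground, h2]
      · intro x hx
        obtain ⟨i, hi⟩ := Set.mem_iUnion.1 hx
        have : x = k + (i : ℕ) := by simpa [Term.varFinset] using hi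
        rw [this]
        exact Nat.le_add_right _ _
    | @per n L a =>
      obtain ⟨w', h1, h2⟩ := key a
      refine fin (.per L fun i => .var (k + (i : ℕ))) w' h1 ?_ ?_
      · simp [UserConstraint.ground, h2]
      · intro x hx
        obtain ⟨i, hi⟩ := Set.mem_iUnion.1 hx
        have : x = k + (i : ℕ) := by simpa [Term.varFinset] using hi
        rw [this]
        exact Nat.le_add_right _ _

/-- If the removed head of a simplification rule is true, then so is its body for some values of the
local variables. -/
theorem exists_body_of_linearTruth (hM : CT.ModeledBy M) (hQ : Q.IsHybrid)
    (hQs : ∀ r ∈ Q.rules, r.removed ≠ 0) (hconf : Confluent (HybridEquiv CT) Q) {r : Rule S}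
    (hr : r ∈ Q.rules) {v : Var → M} (hK : UHolds M v r.kept) (hG : BHolds M v r.guard)
    (hH : ∀ c ∈ r.removed, LinearTruth M Q (c.ground M v)) :
    ∃ w : Var → M, Set.EqOn w v r.headVars ∧ BHolds M w r.guard ∧ BHolds M w r.bodyB ∧
      (∀ c ∈ r.bodyU, c.IsPersistent → c.Holds M w) ∧
      ∀ c ∈ r.bodyU, c.IsLinear → LinearTruth M Q (c.ground M w) := by
  classical
  have hyb := hQ r hr
  obtain ⟨R, hR⟩ := exists_reducible_of_linearTruth
    (N := r.removed.map (UserConstraint.ground M v)) fun g hg => by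
      obtain ⟨c, hc, rfl⟩ := Multiset.mem_map.1 hg
      exact hH c hc
  have hRlin : ∀ {N : Multiset (GroundConstraint S M)}, Reducible M Q N → ∀ g ∈ N,
      ∃ (c : UserConstraint S) (w : Var → M), c.IsLinear ∧ c.ground M w = g := by
    intro N hN
    induction hN with
    | zero => simp
    | step r hr w kept builtin per N h ih =>
      intro g hg
      rcases Multiset.mem_add.1 hg with hg | hg
      · obtain ⟨c, hc, rfl⟩ := Multiset.mem_map.1 hg
        exact ⟨c, w, (hQ r hr).2 c hc, rfl⟩
      · exact ih g (Multiset.mem_add.2 (Or.inr hg))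
  obtain ⟨m, hm⟩ := exists_var_bound r.finite_vars
  -- The rest `R` of the reducible multiset is represented by constraints over new variables, so that
  -- the rule can be applied in its presence.
  obtain ⟨C, v₁, hv₁, hC, hCm⟩ := exists_ground_eq R v m
  have hClin : ∀ c ∈ C, c.IsLinear := by
    intro c hc
    obtain ⟨d, w, hd, hdc⟩ := hRlin hR (c.ground M v₁)
      (Multiset.mem_add.2 (Or.inr (hC ▸ Multiset.mem_map_of_mem _ hc)))
    rw [UserConstraint.isLinear_iff_not, ← UserConstraint.isPersistent_of_ground_eq hdc,
      ← UserConstraint.isLinear_iff_not]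
    exact hd
  have hhead : (r.headVars ∪ ufv C).Finite :=
    ((finite_ufv _).union (finite_ufv _)).union (finite_ufv C)
  have hv₁r : ∀ x ∈ r.vars, v₁ x = v x := fun x hx => hv₁ x (hm x hx)
  have hstep : RuleStep Q ⟨r.kept + r.removed + C, r.guard + 0, hhead.toFinset⟩
      ⟨r.bodyU + r.kept + C, r.bodyB + r.guard + 0, hhead.toFinset⟩ := by
    have := RuleStep.apply r (Equiv.refl Var) hr C 0 hhead.toFinset
    rw [Rule.rename_refl] at this
    refine this (Set.disjoint_left.2 fun x hx hx' => ?_)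
    have hxm : x ∉ ufv C := fun h => absurd (hCm x h)
      (not_le.2 (hm x ((r.mem_vars_iff x).2 (Or.inr hx))))
    simp only [Set.Finite.coe_toFinset, Set.mem_union, bfv_zero, Set.mem_empty_iff_false] at hx'
    have := hx.2
    tauto
  have hK' : linPart r.kept = 0 := linPart_eq_zero.2 hyb.1
  obtain ⟨w, hw, hb, hp, hl⟩ := Reducible.satState_of_reaches hM hQ hQs hconf hR
    (σ := ⟨r.kept + r.removed + C, r.guard + 0, hhead.toFinset⟩) (v := v₁) (w := v₁) (by
      simp only [groundLin, linPart_add, hK', linPart_eq_self hyb.2, linPart_eq_self hClin,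
        zero_add, Multiset.map_add, hC]
      congr 1
      exact Multiset.map_congr rfl fun c hc => c.ground_congr fun x hx =>
        hv₁r x (Or.inl (Or.inl (Or.inl (Or.inr ⟨c, hc, hx⟩)))))
    (by
      rw [add_zero]
      exact (bHolds_congr _ fun x hx => hv₁r x (Or.inl (Or.inl (Or.inr hx)))).2 hG)
    (by
      intro c hc hcp
      simp only [Multiset.mem_add] at hc
      rcases hc with (hc | hc) | hc
      · rw [UserConstraint.holds_ground]
        exact (c.holds_congr fun x hx =>
          hv₁r x (Or.inl (Or.inl (Or.inl (Or.inl ⟨c, hc, hx⟩))))).2 (hK c hc)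
      · exact ((UserConstraint.isLinear_iff_not c).1 (hyb.2 c hc) hcp).elim
      · exact ((UserConstraint.isLinear_iff_not c).1 (hClin c hc) hcp).elim)
    (fun _ _ => rfl) (hstep.reaches CT)
  dsimp only at hw hb hp hl
  rw [add_zero, bHolds_add] at hb
  refine ⟨w, fun x hx => ?_, hb.2, hb.1, fun c hc hcp => ?_, fun c hc hcl => ?_⟩
  · rw [hw (by simp [hx]), hv₁r x ((r.mem_vars_iff x).2 (Or.inl hx))]
  · rw [← UserConstraint.holds_ground]
    exact hp c (by simp [hc]) hcp
  · refine ⟨_, hl, ?_⟩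
    exact Multiset.mem_map_of_mem _ (mem_linPart.2 ⟨by simp [hc], hcl⟩)

/-- If the body of a simplification rule is true, then so is its removed head. -/
theorem linearTruth_removed_of_body {r : Rule S} (hr : r ∈ Q.rules) {v w : Var → M}
    (hw : Set.EqOn w v r.headVars) (hK : UHolds M v r.kept) (hG : BHolds M w r.guard)
    (hB : BHolds M w r.bodyB) (hp : ∀ c ∈ r.bodyU, c.IsPersistent → c.Holds M w)
    (hl : ∀ c ∈ r.bodyU, c.IsLinear → LinearTruth M Q (c.ground M w)) :
    ∀ c ∈ r.removed, LinearTruth M Q (c.ground M v) := by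
  obtain ⟨R, hR⟩ := exists_reducible_of_linearTruth (N := groundLin w r.bodyU) fun g hg => by
    obtain ⟨c, hc, rfl⟩ := Multiset.mem_map.1 hg
    exact hl c (mem_linPart.1 hc).1 (mem_linPart.1 hc).2
  have hK' : UHolds M w r.kept :=
    (uHolds_congr _ fun x hx => hw (Or.inl hx)).2 hK
  have := Reducible.step r hr w hK' ((bHolds_add _ _ _).2 ⟨hG, hB⟩)
    (fun c hc hcp => (UserConstraint.holds_ground c w).2 (hp c hc hcp)) R hR
  intro c hc
  refine ⟨_, this, Multiset.mem_add.2 (Or.inl ?_)⟩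
  rw [← c.ground_congr fun x hx => hw (Or.inr ⟨c, hc, hx⟩)]
  exact Multiset.mem_map_of_mem _ hc

/-- The structure obtained by interpreting the linear symbols by `T`. -/
@[reducible] def withLinear (M : Type u) [S.lang.Structure M] (T : GroundConstraint S M → Prop) :
    S.lang.Structure M where
  funMap {n} f a := Structure.funMap (L := S.lang) (n := n) f a
  RelMap {n} R a :=
    match R with
    | Sum.inl b => Structure.RelMap (L := S.lang) (n := n) (Sum.inl b) a
    | Sum.inr (Sum.inl l) => T (.lin l a)
    | Sum.inr (Sum.inr p) => Structure.RelMap (L := S.lang) (n := n) (Sum.inr (Sum.inr p)) a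

theorem realize_withLinear (T : GroundConstraint S M → Prop) (v : Var → M) (t : Tm S) :
    @Term.realize S.lang M (withLinear M T) _ v t = t.realize v := by
  induction t with
  | var x => rfl
  | func f ts ih =>
    simp only [Term.realize]
    exact (congrArg (Structure.funMap (L := S.lang) (M := M) f) (funext ih) :)

theorem bHolds_withLinear (T : GroundConstraint S M → Prop) (v : Var → M) (E : BStore S) :
    @BHolds S M (withLinear M T) v E ↔ BHolds M v E := by
  refine forall₂_congr fun c _ => ?_
  cases c <;> simp only [BuiltInConstraint.Holds, realize_withLinear]
  rfl

theorem uHolds_withLinear (T : GroundConstraint S M → Prop) (v : Var → M) (C : UStore S) :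
    @UHolds S M (withLinear M T) v C ↔ (∀ c ∈ C, c.IsPersistent → c.Holds M v) ∧
      ∀ c ∈ C, c.IsLinear → T (c.ground M v) := by
  rw [← forall₂_and]
  refine forall₂_congr fun c _ => ?_
  cases c <;> simp [UserConstraint.Holds, realize_withLinear, UserConstraint.IsPersistent,
    UserConstraint.IsLinear, UserConstraint.ground] <;> rfl

/-- A model of the constraint theory can be expanded to a model of a hybrid program if its
simplification rules are confluent and the propagation rules are respected up to reducibility. -/
theorem satisfiableWithin_of_model {P : Program S} (hP : P.IsHybrid)
    (hconf : Confluent (HybridEquiv CT) P.simp) (hM : CT.ModeledBy M)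
    (hprop : ∀ r ∈ P.rules, r.removed = 0 → ∀ v : Var → M, UHolds M v r.kept → BHolds M v r.guard →
      ∃ w : Var → M, Set.EqOn w v r.headVars ∧
        SatAt GroundConstraint.Holds (Reducible M P.simp) w r.bodyU (r.guard + r.bodyB))
    {C : UStore S} {E : BStore S} {v : Var → M}
    (hv : SatAt GroundConstraint.Holds (Reducible M P.simp) v C E) :
    SatisfiableWithin CT P C E := by
  have hlin : ∀ {v : Var → M} {C : UStore S} {E : BStore S},
      SatAt GroundConstraint.Holds (Reducible M P.simp) v C E →
        @UHolds S M (withLinear M (LinearTruth M P.simp)) v C := by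
    rintro v C E ⟨-, h1, h2⟩
    rw [uHolds_withLinear]
    refine ⟨fun c hc hcp => (UserConstraint.holds_ground c v).1 (h1 c hc hcp), fun c hc hcl => ?_⟩
    exact ⟨_, h2, Multiset.mem_map_of_mem _ (mem_linPart.2 ⟨hc, hcl⟩)⟩
  have hQs : ∀ r ∈ P.simp.rules, r.removed ≠ 0 := fun r hr => hr.2
  refine ⟨M, withLinear M (LinearTruth M P.simp), ?_, ?_, v, hlin hv,
    (bHolds_withLinear _ v E).2 hv.1⟩
  · intro a ha v hv
    obtain ⟨w, h1, h2⟩ := hM a ha v ((bHolds_withLinear _ v _).1 hv)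
    exact ⟨w, h1, (bHolds_withLinear _ w _).2 h2⟩
  · rintro r hr v ⟨hK, hG⟩
    have hyb := hP r hr
    have hK' : UHolds M v r.kept := fun c hc =>
      ((uHolds_withLinear _ v _).1 hK).1 c hc (hyb.1 c hc)
    have hG' := (bHolds_withLinear _ v _).1 hG
    by_cases h0 : r.removed = 0
    · refine iff_of_true (by simp [h0, UHolds]) ?_
      obtain ⟨w, hw, hs⟩ := hprop r hr h0 v hK' hG'
      have hb := (bHolds_add _ _ _).1 hs.1
      exact ⟨w, hw, (bHolds_withLinear _ w _).2 hb.1, (bHolds_withLinear _ w _).2 hb.2, hlin hs⟩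
    · have hr' : r ∈ P.simp.rules := ⟨hr, h0⟩
      constructor
      · intro hH
        obtain ⟨w, hw, h1, h2, h3, h4⟩ := exists_body_of_linearTruth hM hP.simp hQs hconf hr' hK'
          hG' fun c hc => ((uHolds_withLinear _ v _).1 hH).2 c hc (hyb.2 c hc)
        exact ⟨w, hw, (bHolds_withLinear _ w _).2 h1, (bHolds_withLinear _ w _).2 h2,
          (uHolds_withLinear _ w _).2 ⟨h3, h4⟩⟩
      · rintro ⟨w, hw, h1, h2, h3⟩
        have h3' := (uHolds_withLinear _ w _).1 h3
        have := linearTruth_removed_of_body hr' hw hK' ((bHolds_withLinear _ w _).1 h1)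
          ((bHolds_withLinear _ w _).1 h2) h3'.1 h3'.2
        refine (uHolds_withLinear _ v _).2 ⟨fun c hc hcp => ?_, fun c hc _ => this c hc⟩
        exact ((UserConstraint.isLinear_iff_not c).1 (hyb.2 c hc) hcp).elim

end


/-! ### Stages of the construction of a generic model -/

theorem exists_perm_eqOn {A : Set Var} (hA : A.Finite) {g : Var → Var} (hg : Set.InjOn g A) :
    ∃ π : Equiv.Perm Var, Set.EqOn π g A := by
  classical
  induction A, hA using Set.Finite.induction_on with
  | empty => exact ⟨Equiv.refl _, fun x hx => hx.elim⟩
  | @insert a A ha _ ih =>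
    obtain ⟨π, hπ⟩ := ih (hg.mono (Set.subset_insert a A))
    refine ⟨π.trans (Equiv.swap (π a) (g a)), fun x hx => ?_⟩
    rcases hx with rfl | hx
    · simp
    · have hxa : x ≠ a := fun h => ha (h ▸ hx)
      have h1 : π x ≠ π a := fun h => hxa (π.injective h)
      have h2 : π x ≠ g a := fun h => hxa (hg (Or.inr hx) (Or.inl rfl) ((hπ hx).symm.trans h))
      rw [Equiv.trans_apply, Equiv.swap_apply_of_ne_of_ne h1 h2, hπ hx]

/-- Names of the elements of a generic model: the variables of the initial state, and, for each
accumulating derivation from a state `σ` whose variables are named by `e` to a state `σ'`, a witness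
for each variable of `σ'`. -/
inductive Gen (S : Signature.{u}) : Type u
  | base (n : ℕ) : Gen S
  | wit (σ σ' : State S) (e : ℕ → Gen S) (x : ℕ) : Gen S

open Classical in
/-- The extension of a naming `e` of the variables of `σ` to those of `σ'` by new witnesses. -/
noncomputable def extName (σ σ' : State S) (e : Var → Gen S) : Var → Gen S := fun x =>
  if x ∈ σ.vars then e x else .wit σ σ' e x

/-- The renaming `ρ` embeds the state `σ` into the state `τ` in a way compatible with the namings of
their variables. -/
structure EmbedsVia (σ : State S) (e : Var → Gen S) (τ : State S) (f : Var → Gen S)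
    (ρ : Var → Var) : Prop where
  mem_vars : ∀ x ∈ σ.vars, ρ x ∈ τ.vars
  name : ∀ x ∈ σ.vars, f (ρ x) = e x
  chr : ∀ c ∈ σ.chr, c.subst (ren S ρ) ∈ τ.chr
  builtin : ∀ c ∈ σ.builtin, c.subst (ren S ρ) ∈ τ.builtin
  globals : ∀ x ∈ σ.globals, ρ x = x

/-- The named state `σ` is contained in the named state `τ`. -/
def Embeds (σ : State S) (e : Var → Gen S) (τ : State S) (f : Var → Gen S) : Prop :=
  ∃ ρ, EmbedsVia σ e τ f ρ

theorem Embeds.refl (σ : State S) (e : Var → Gen S) : Embeds σ e σ e :=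
  ⟨id, fun _ h => h, fun _ _ => rfl,
    fun c h => by rwa [show ren S id = Term.var from rfl, c.subst_var],
    fun c h => by rwa [show ren S id = Term.var from rfl, c.subst_var], fun _ _ => rfl⟩

theorem Embeds.trans {σ τ υ : State S} {e f g : Var → Gen S} (h : Embeds σ e τ f)
    (h' : Embeds τ f υ g) (hg : σ.globals = τ.globals) : Embeds σ e υ g := by
  obtain ⟨ρ, h⟩ := h
  obtain ⟨π, h'⟩ := h'
  refine ⟨π ∘ ρ, fun x hx => h'.mem_vars _ (h.mem_vars x hx), fun x hx => ?_, fun c hc => ?_,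
    fun c hc => ?_, fun x hx => ?_⟩
  · exact (h'.name _ (h.mem_vars x hx)).trans (h.name x hx)
  · have := h'.chr _ (h.chr c hc)
    rwa [UserConstraint.subst_subst] at this
  · have := h'.builtin _ (h.builtin c hc)
    rwa [BuiltInConstraint.subst_subst] at this
  · rw [Function.comp, h.globals x hx, h'.globals x (hg ▸ hx)]

/-- The union of a state and a variant of another state. -/
def State.union (τ σ : State S) (ι : Equiv.Perm Var) : State S :=
  ⟨τ.chr + usub (ren S ι) σ.chr, τ.builtin + bsub (ren S ι) σ.builtin, τ.globals⟩

theorem State.mem_vars_union {τ σ : State S} {ι : Equiv.Perm Var} {y : Var}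
    (hy : y ∈ (τ.union σ ι).vars) : y ∈ τ.vars ∨ ∃ x ∈ σ.vars, ι x = y := by
  simp only [State.union, State.vars, ufv_add, bfv_add, Set.mem_union] at hy ⊢
  rw [ufv_ren, bfv_ren] at hy
  rcases hy with ((h | ⟨x, hx, rfl⟩) | (h | ⟨x, hx, rfl⟩)) | h
  · exact Or.inl (Or.inl (Or.inl h))
  · exact Or.inr ⟨x, Or.inl (Or.inl hx), rfl⟩
  · exact Or.inl (Or.inl (Or.inr h))
  · exact Or.inr ⟨x, Or.inl (Or.inr hx), rfl⟩
  · exact Or.inl (Or.inr h)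

theorem State.vars_subset_union (τ σ : State S) (ι : Equiv.Perm Var) :
    τ.vars ⊆ (τ.union σ ι).vars := by
  intro y
  simp only [State.union, State.vars, ufv_add, bfv_add, Set.mem_union]
  tauto

theorem State.image_vars_subset_union {τ σ : State S} {ι : Equiv.Perm Var}
    (hX : ∀ x ∈ σ.globals, ι x ∈ τ.globals) : ι '' σ.vars ⊆ (τ.union σ ι).vars := by
  rintro _ ⟨x, hx, rfl⟩
  simp only [State.union, State.vars, ufv_add, bfv_add, Set.mem_union] at hx ⊢
  rw [ufv_ren, bfv_ren]
  rcases hx with (h | h) | h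
  · exact Or.inl (Or.inl (Or.inr ⟨x, h, rfl⟩))
  · exact Or.inl (Or.inr (Or.inr ⟨x, h, rfl⟩))
  · exact Or.inr (hX x h)

/-- The stages of the construction are named states. A stage grows by the result `σ'` of an
accumulating derivation from an earlier stage `σ`, where the new variables of `σ'` are named by
witnesses that do not occur yet. -/
inductive IsStage (CT : ConstraintTheory S) (P : Program S) (σ₀ : State S) :
    State S → (Var → Gen S) → Prop
  | base : IsStage CT P σ₀ σ₀ Gen.base
  | grow (τ : State S) (f : Var → Gen S) (hτ : IsStage CT P σ₀ τ f)
      (σ : State S) (e : Var → Gen S) (hσ : IsStage CT P σ₀ σ e)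
      (ρ : Var → Var) (hρ : EmbedsVia σ e τ f ρ)
      (σ' : State S) (hacc : Relation.ReflTransGen (Acc CT P) σ σ')
      (hper : σ' ∈ purelyPersistent S)
      (ι : Equiv.Perm Var) (hι : ∀ x ∈ σ.vars, ι x = ρ x)
      (hnew : ∀ x ∈ σ'.vars, x ∉ σ.vars → ι x ∉ τ.vars)
      (fresh : ∀ x ∈ σ'.vars, x ∉ σ.vars → ∀ y ∈ τ.vars, f y ≠ .wit σ σ' e x)
      (f' : Var → Gen S) (hf : ∀ y ∈ τ.vars, f' y = f y)
      (hf' : ∀ x ∈ σ'.vars, x ∉ σ.vars → f' (ι x) = .wit σ σ' e x) :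
      IsStage CT P σ₀ (τ.union σ' ι) f'

section

variable {CT : ConstraintTheory S} {P : Program S} {σ₀ : State S}

namespace IsStage

theorem globals_eq {τ : State S} {f : Var → Gen S} (h : IsStage CT P σ₀ τ f) :
    τ.globals = σ₀.globals := by
  induction h with
  | base => rfl
  | grow τ f hτ _ _ _ _ _ _ _ _ _ _ _ _ _ _ _ ih _ => exact ih

theorem persistent (h₀ : σ₀ ∈ purelyPersistent S) {τ : State S} {f : Var → Gen S}
    (h : IsStage CT P σ₀ τ f) : τ ∈ purelyPersistent S := by
  induction h with
  | base => exact h₀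
  | grow τ f hτ σ e hσ ρ hρ σ' hacc hper ι hι hnew fresh f' hf hf' ih _ =>
    intro c hc
    rcases Multiset.mem_add.1 hc with hc | hc
    · exact ih c hc
    · obtain ⟨c, hc', rfl⟩ := Multiset.mem_map.1 hc
      simpa using hper c hc'

theorem injOn {τ : State S} {f : Var → Gen S} (h : IsStage CT P σ₀ τ f) : Set.InjOn f τ.vars := by
  induction h with
  | base => exact fun x _ y _ h => Gen.base.inj h
  | grow τ f hτ σ e hσ ρ hρ σ' hacc hper ι hι hnew fresh f' hf hf' ih _ =>
    have key : ∀ y ∈ (τ.union σ' ι).vars, y ∈ τ.vars ∨ ∃ x ∈ σ'.vars, x ∉ σ.vars ∧ ι x = y := by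
      intro y hy
      rcases State.mem_vars_union hy with h | ⟨x, hx, rfl⟩
      · exact Or.inl h
      · by_cases hxσ : x ∈ σ.vars
        · rw [hι x hxσ]
          exact Or.inl (hρ.mem_vars x hxσ)
        · exact Or.inr ⟨x, hx, hxσ, rfl⟩
    intro y hy z hz hyz
    rcases key y hy with hy | ⟨x, hx, hxσ, rfl⟩ <;> rcases key z hz with hz | ⟨x', hx', hxσ', rfl⟩
    · rw [hf y hy, hf z hz] at hyz
      exact ih hy hz hyz
    · rw [hf y hy, hf' x' hx' hxσ'] at hyz
      exact (fresh x' hx' hxσ' y hy hyz).elim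
    · rw [hf z hz, hf' x hx hxσ] at hyz
      exact (fresh x hx hxσ z hz hyz.symm).elim
    · rw [hf' x hx hxσ, hf' x' hx' hxσ'] at hyz
      rw [(Gen.wit.inj hyz).2.2.2]

theorem embeds_union {τ σ' : State S} {ι : Equiv.Perm Var} {f f' : Var → Gen S}
    (hf : ∀ y ∈ τ.vars, f' y = f y) : Embeds τ f (τ.union σ' ι) f' := by
  have e : ren S id = Term.var := rfl
  refine ⟨id, fun x hx => State.vars_subset_union _ _ _ hx, hf, fun c hc => ?_, fun c hc => ?_,
    fun _ _ => rfl⟩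
  · rw [e, c.subst_var]
    exact Multiset.mem_add.2 (Or.inl hc)
  · rw [e, c.subst_var]
    exact Multiset.mem_add.2 (Or.inl hc)

theorem embeds_union' {τ σ σ' : State S} {f e f' : Var → Gen S} {ρ : Var → Var}
    (hρ : EmbedsVia σ e τ f ρ) {ι : Equiv.Perm Var} (hι : ∀ x ∈ σ.vars, ι x = ρ x)
    (hf : ∀ y ∈ τ.vars, f' y = f y)
    (hf' : ∀ x ∈ σ'.vars, x ∉ σ.vars → f' (ι x) = .wit σ σ' e x)
    (hg : σ'.globals = σ.globals) (hg' : σ.globals = τ.globals) :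
    EmbedsVia σ' (extName σ σ' e) (τ.union σ' ι) f' ι := by
  have hX : ∀ x ∈ σ'.globals, ι x = x := fun x hx => by
    rw [hg] at hx
    rw [hι x (Or.inr hx), hρ.globals x hx]
  refine ⟨fun x hx => State.image_vars_subset_union (fun x hx => ?_) ⟨x, hx, rfl⟩, fun x hx => ?_,
    fun c hc => ?_, fun c hc => ?_, hX⟩
  · rw [hX x hx, ← hg', ← hg]
    exact hx
  · by_cases hxσ : x ∈ σ.vars
    · rw [extName, if_pos hxσ, hι x hxσ, hf _ (hρ.mem_vars x hxσ), hρ.name x hxσ]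
    · rw [extName, if_neg hxσ, hf' x hx hxσ]
  · exact Multiset.mem_add.2 (Or.inr (Multiset.mem_map_of_mem _ hc))
  · exact Multiset.mem_add.2 (Or.inr (Multiset.mem_map_of_mem _ hc))

/-- If a witness for a derivation to `σ'` occurs in a stage, then the stage contains `σ'`. -/
theorem embeds_of_wit {τ : State S} {f : Var → Gen S} (h : IsStage CT P σ₀ τ f)
    {σ σ' : State S} {e : Var → Gen S} {x y : Var} (hy : y ∈ τ.vars) (hyx : f y = .wit σ σ' e x) :
    Embeds σ' (extName σ σ' e) τ f ∧ σ'.globals = σ₀.globals := by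
  induction h generalizing y with
  | base => cases hyx
  | grow τ f hτ σ₁ e₁ hσ ρ hρ σ₁' hacc hper ι hι hnew fresh f' hf hf' ih _ =>
    have hold : ∀ y ∈ τ.vars, f' y = .wit σ σ' e x →
        Embeds σ' (extName σ σ' e) (τ.union σ₁' ι) f' ∧ σ'.globals = σ₀.globals := by
      intro y hy hyx
      rw [hf y hy] at hyx
      obtain ⟨h1, h2⟩ := ih hy hyx
      exact ⟨h1.trans (embeds_union hf) (h2.trans hτ.globals_eq.symm), h2⟩
    rcases State.mem_vars_union hy with hy | ⟨z, hz, rfl⟩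
    · exact hold y hy hyx
    · by_cases hzσ : z ∈ σ₁.vars
      · refine hold _ ?_ hyx
        rw [hι z hzσ]
        exact hρ.mem_vars z hzσ
      · rw [hf' z hz hzσ] at hyx
        obtain ⟨rfl, rfl, rfl, -⟩ := Gen.wit.inj hyx
        have hg := Acc.reflTransGen_globals_eq hacc
        exact ⟨⟨ι, embeds_union' hρ hι hf hf' hg (hσ.globals_eq.trans hτ.globals_eq.symm)⟩,
          hg.trans hσ.globals_eq⟩

theorem embeds_base {τ : State S} {f : Var → Gen S} (h : IsStage CT P σ₀ τ f) :
    Embeds σ₀ Gen.base τ f := by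
  induction h with
  | base => exact .refl _ _
  | grow τ f hτ σ e hσ ρ hρ σ' hacc hper ι hι hnew fresh f' hf hf' ih _ =>
    exact ih.trans (embeds_union hf) hτ.globals_eq.symm

/-- A stage can be enlarged by the result of a derivation from a stage contained in it. -/
theorem exists_grow {τ σ σ' : State S} {f e : Var → Gen S} (hτ : IsStage CT P σ₀ τ f)
    (hσ : IsStage CT P σ₀ σ e) (h : Embeds σ e τ f)
    (hacc : Relation.ReflTransGen (Acc CT P) σ σ') (hper : σ' ∈ purelyPersistent S) :
    ∃ τ' f', IsStage CT P σ₀ τ' f' ∧ Embeds τ f τ' f' ∧ Embeds σ' (extName σ σ' e) τ' f' := by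
  classical
  -- If a witness for the derivation occurs already, then so does its result.
  by_cases hocc : ∃ x ∈ σ'.vars, x ∉ σ.vars ∧ ∃ y ∈ τ.vars, f y = .wit σ σ' e x
  · obtain ⟨x, -, -, y, hy, hyx⟩ := hocc
    exact ⟨τ, f, hτ, .refl _ _, (hτ.embeds_of_wit hy hyx).1⟩
  · obtain ⟨ρ, hρ⟩ := h
    obtain ⟨m, hm⟩ := exists_var_bound τ.finite_vars
    have hinj : Set.InjOn (fun x : Var => if x ∈ σ.vars then ρ x else (x + m : ℕ)) σ'.vars := by
      intro x hx y hy hxy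
      by_cases h1 : x ∈ σ.vars <;> by_cases h2 : y ∈ σ.vars
      · simp only [if_pos h1, if_pos h2] at hxy
        apply hσ.injOn h1 h2
        rw [← hρ.name x h1, ← hρ.name y h2, hxy]
      · simp only [if_pos h1, if_neg h2] at hxy
        have := hm _ (hρ.mem_vars x h1)
        rw [hxy] at this
        exact absurd this (Nat.not_lt.2 (Nat.le_add_left _ _))
      · simp only [if_neg h1, if_pos h2] at hxy
        have := hm _ (hρ.mem_vars y h2)
        rw [← hxy] at this
        exact absurd this (Nat.not_lt.2 (Nat.le_add_left _ _))
      · simp only [if_neg h1, if_neg h2] at hxy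
        exact Nat.add_right_cancel hxy
    obtain ⟨ι, hι⟩ := exists_perm_eqOn σ'.finite_vars hinj
    have hsub := Acc.reflTransGen_vars_subset hacc
    have hι₁ : ∀ x ∈ σ.vars, ι x = ρ x := fun x hx => (hι (hsub hx)).trans (if_pos hx)
    have hι₂ : ∀ x ∈ σ'.vars, x ∉ σ.vars → ι x ∉ τ.vars := fun x hx hxσ hxτ => by
      have := hm _ hxτ
      rw [(hι hx).trans (if_neg hxσ)] at this
      exact absurd this (Nat.not_lt.2 (Nat.le_add_left _ _))
    set f' : Var → Gen S := fun y => if y ∈ τ.vars then f y else .wit σ σ' e (ι.symm y) with hf'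
    have hf₁ : ∀ y ∈ τ.vars, f' y = f y := fun y hy => if_pos hy
    have hf₂ : ∀ x ∈ σ'.vars, x ∉ σ.vars → f' (ι x) = .wit σ σ' e x := fun x hx hxσ => by
      rw [hf']
      simp [hι₂ x hx hxσ]
    refine ⟨τ.union σ' ι, f', ?_, embeds_union hf₁, ι, embeds_union' hρ hι₁ hf₁ hf₂
      (Acc.reflTransGen_globals_eq hacc) (hσ.globals_eq.trans hτ.globals_eq.symm)⟩
    refine .grow τ f hτ σ e hσ ρ hρ σ' hacc hper ι hι₁ hι₂ ?_ f' hf₁ hf₂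
    intro x hx hxσ y hy hyx
    exact hocc ⟨x, hx, hxσ, y, hy, hyx⟩

/-- The stages are directed: the derivations that lead to one stage can be repeated in another. -/
theorem directed {τ₁ τ₂ : State S} {f₁ f₂ : Var → Gen S} (h₁ : IsStage CT P σ₀ τ₁ f₁)
    (h₂ : IsStage CT P σ₀ τ₂ f₂) :
    ∃ τ f, IsStage CT P σ₀ τ f ∧ Embeds τ₁ f₁ τ f ∧ Embeds τ₂ f₂ τ f := by
  classical
  induction h₂ with
  | base => exact ⟨τ₁, f₁, h₁, .refl _ _, h₁.embeds_base⟩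
  | grow τ f hτ σ e hσ ρ hρ σ' hacc hper ι hι hnew fresh f' hf hf' ih _ =>
    obtain ⟨τ₃, f₃, h₃, h₁₃, hτ₃⟩ := ih
    have hστ := hσ.globals_eq.trans hτ.globals_eq.symm
    obtain ⟨τ₄, f₄, h₄, h₃₄, ρb, hb⟩ := h₃.exists_grow hσ (Embeds.trans ⟨ρ, hρ⟩ hτ₃ hστ) hacc hper
    obtain ⟨ρa, ha⟩ := hτ₃.trans h₃₄ (hτ.globals_eq.trans h₃.globals_eq.symm)
    refine ⟨τ₄, f₄, h₄, h₁₃.trans h₃₄ (h₁.globals_eq.trans h₃.globals_eq.symm), ?_⟩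
    -- The embeddings of `τ` and `σ'` agree on the variables of `σ`, since they preserve names.
    set π : Var → Var := fun y => if y ∈ τ.vars then ρa y else ρb (ι.symm y) with hπ
    have hπτ : ∀ y ∈ τ.vars, π y = ρa y := fun y hy => if_pos hy
    have hπι : ∀ x ∈ σ'.vars, π (ι x) = ρb x := by
      intro x hx
      by_cases hxσ : x ∈ σ.vars
      · have hxτ : ι x ∈ τ.vars := by
          rw [hι x hxσ]
          exact hρ.mem_vars x hxσ
        rw [hπτ _ hxτ]
        apply h₄.injOn (ha.mem_vars _ hxτ) (hb.mem_vars x hx)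
        rw [ha.name _ hxτ, hb.name x hx, hι x hxσ, hρ.name x hxσ, extName, if_pos hxσ]
      · simp [hπ, hnew x hx hxσ]
    refine ⟨π, fun y hy => ?_, fun y hy => ?_, fun c hc => ?_, fun c hc => ?_, fun x hx => ?_⟩
    · rcases State.mem_vars_union hy with hy | ⟨x, hx, rfl⟩
      · rw [hπτ y hy]
        exact ha.mem_vars y hy
      · rw [hπι x hx]
        exact hb.mem_vars x hx
    · by_cases hyτ : y ∈ τ.vars
      · rw [hπτ y hyτ, ha.name y hyτ, hf y hyτ]
      · obtain ⟨x, hx, rfl⟩ := (State.mem_vars_union hy).resolve_left hyτ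
        have hxσ : x ∉ σ.vars := fun h => hyτ (by
          rw [hι x h]
          exact hρ.mem_vars x h)
        rw [hπι x hx, hb.name x hx, hf' x hx hxσ, extName, if_neg hxσ]
    · rcases Multiset.mem_add.1 hc with hc | hc
      · rw [c.subst_congr (η := ren S ρa) fun x hx =>
          congrArg Term.var (hπτ x (Or.inl (Or.inl ⟨c, hc, hx⟩)))]
        exact ha.chr c hc
      · obtain ⟨c, hc', rfl⟩ := Multiset.mem_map.1 hc
        rw [c.subst_subst, c.subst_congr (θ := fun x => (ren S ι x).subst (ren S π))
          (η := ren S ρb) fun x hx => congrArg Term.var (hπι x (Or.inl (Or.inl ⟨c, hc', hx⟩)))]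
        exact hb.chr c hc'
    · rcases Multiset.mem_add.1 hc with hc | hc
      · rw [c.subst_congr (η := ren S ρa) fun x hx =>
          congrArg Term.var (hπτ x (Or.inl (Or.inr ⟨c, hc, hx⟩)))]
        exact ha.builtin c hc
      · obtain ⟨c, hc', rfl⟩ := Multiset.mem_map.1 hc
        rw [c.subst_subst, c.subst_congr (θ := fun x => (ren S ι x).subst (ren S π))
          (η := ren S ρb) fun x hx => congrArg Term.var (hπι x (Or.inl (Or.inr ⟨c, hc', hx⟩)))]
        exact hb.builtin c hc'
    · rw [hπτ x (Or.inr hx)]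
      exact ha.globals x hx

/-- The stages are accessible states: the derivation from `σ` to `σ'` can be repeated in a stage that
contains `σ`. -/
theorem reaches (hP : P.IsHybrid) (h₀ : σ₀ ∈ purelyPersistent S) {τ : State S} {f : Var → Gen S}
    (h : IsStage CT P σ₀ τ f) : Reaches (HybridEquiv CT) P σ₀ τ := by
  induction h with
  | base => exact (HybridEquiv.refl CT _).reaches P
  | grow τ f hτ σ e hσ ρ hρ σ' hacc hper ι hι hnew fresh f' hf hf' ih _ =>
    refine ih.trans ?_
    have hX : ∀ x ∈ σ.globals, ι x = x := fun x hx => by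
      rw [hι x (Or.inr hx), hρ.globals x hx]
    have hg := hσ.globals_eq.trans hτ.globals_eq.symm
    have hg' := Acc.reflTransGen_globals_eq hacc
    have hmap : σ.globals.map ι.toEmbedding = σ.globals := by
      ext x
      simp only [Finset.mem_map_equiv]
      constructor
      · intro hx
        have := hX _ hx
        rw [Equiv.apply_symm_apply] at this
        rwa [this]
      · intro hx
        rwa [← hX x hx, Equiv.symm_apply_apply]
    have h1 : HybridEquiv CT τ ((σ.rename ι).extend τ.chr τ.builtin) := by
      have e1 : HybridEquiv CT τ ⟨usub (ren S ι) σ.chr + τ.chr, τ.builtin, τ.globals⟩ := by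
        refine hybridEquiv_add_copies (fun k hk => ?_) fun k hk => ?_
        · obtain ⟨c, hc, rfl⟩ := Multiset.mem_map.1 hk
          simpa using hσ.persistent h₀ c hc
        · obtain ⟨c, hc, rfl⟩ := Multiset.mem_map.1 hk
          refine ⟨_, hρ.chr c hc, ?_⟩
          rw [c.subst_congr (θ := ren S ι) (η := ren S ρ) fun x hx =>
            congrArg Term.var (hι x (Or.inl (Or.inl ⟨c, hc, hx⟩)))]
          exact UEq.refl _ _
      refine e1.trans ?_
      rw [State.extend, State.rename]
      dsimp only
      rw [hmap, hg]
      refine hybridEquiv_of_entails (fun M _ hM v hv => (bHolds_add _ _ _).2 ⟨?_, hv⟩)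
        (entails_add_right _ _)
      intro c hc
      obtain ⟨c, hc', rfl⟩ := Multiset.mem_map.1 hc
      rw [c.subst_congr (θ := ren S ι) (η := ren S ρ) fun x hx =>
        congrArg Term.var (hι x (Or.inl (Or.inr ⟨c, hc', hx⟩)))]
      exact hv _ (hρ.builtin c hc')
    have h2 := Acc.reflTransGen_extend (Acc.reflTransGen_rename hacc ι) τ.chr τ.builtin (by
      rw [State.vars_rename, State.vars_rename, ← Set.image_sdiff ι.injective]
      refine Set.disjoint_left.2 ?_
      rintro _ ⟨x, ⟨hx, hxσ⟩, rfl⟩ h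
      exact hnew x hx hxσ (Or.inl h))
    have e2 : (σ'.rename ι).extend τ.chr τ.builtin = τ.union σ' ι := by
      rw [State.extend, State.rename, State.union]
      dsimp only
      rw [hg', hmap, hg, Multiset.add_comm, Multiset.add_comm τ.builtin]
    rw [e2] at h2
    exact (h1.reaches P).trans (Acc.reflTransGen_reaches hP h2)

end IsStage

end


/-! ### The generic model -/

section

variable (CT : ConstraintTheory S) (P : Program S) (σ₀ : State S)

/-- The stages as a type. -/
structure Stage where
  state : State S
  name : Var → Gen S
  isStage : IsStage CT P σ₀ state name

namespace Stage

instance : Preorder (Stage CT P σ₀) where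
  le p q := Embeds p.state p.name q.state q.name
  le_refl p := .refl _ _
  le_trans p q _ h h' := h.trans h' (p.isStage.globals_eq.trans q.isStage.globals_eq.symm)

instance : Nonempty (Stage CT P σ₀) := ⟨⟨σ₀, Gen.base, .base⟩⟩

instance : IsDirectedOrder (Stage CT P σ₀) where
  directed p q :=
    let ⟨τ, f, h, hp, hq⟩ := p.isStage.directed q.isStage
    ⟨⟨τ, f, h⟩, hp, hq⟩

end Stage

/-- The name belongs to a variable of some stage. -/
def Live (g : Gen S) : Prop := ∃ p : Stage CT P σ₀, ∃ x ∈ p.state.vars, p.name x = g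

/-- Terms over the names that occur in the stages. They represent the elements of the generic
model. -/
abbrev PreElement := S.lang.Term {g : Gen S // Live CT P σ₀ g}

end

open Filter

variable {CT : ConstraintTheory S} {P : Program S} {σ₀ : State S}

namespace Stage

open Classical in
/-- The variable of the stage with a given name; it is arbitrary if the name does not occur. -/
noncomputable def inv (p : Stage CT P σ₀) (g : {g : Gen S // Live CT P σ₀ g}) : Var :=
  if h : ∃ x ∈ p.state.vars, p.name x = g then h.choose else 0

/-- The term over the variables of the stage that stands for an element. -/
noncomputable def rep (p : Stage CT P σ₀) (a : PreElement CT P σ₀) : Tm S :=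
  a.subst fun g => .var (p.inv g)

open Classical in
/-- All names in `a` occur in the stage. -/
def Covers (p : Stage CT P σ₀) (a : PreElement CT P σ₀) : Prop :=
  ∀ g ∈ a.varFinset, ∃ x ∈ p.state.vars, p.name x = g

theorem inv_mem {p : Stage CT P σ₀} {g : {g : Gen S // Live CT P σ₀ g}}
    (h : ∃ x ∈ p.state.vars, p.name x = g) : p.inv g ∈ p.state.vars := by
  rw [inv, dif_pos h]
  exact h.choose_spec.1

theorem name_inv {p : Stage CT P σ₀} {g : {g : Gen S // Live CT P σ₀ g}}
    (h : ∃ x ∈ p.state.vars, p.name x = g) : p.name (p.inv g) = g := by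
  rw [inv, dif_pos h]
  exact h.choose_spec.2

theorem inv_eq {p : Stage CT P σ₀} {g : {g : Gen S // Live CT P σ₀ g}} {x : Var}
    (hx : x ∈ p.state.vars) (hg : p.name x = g) : p.inv g = x :=
  p.isStage.injOn (inv_mem ⟨x, hx, hg⟩) hx ((name_inv ⟨x, hx, hg⟩).trans hg.symm)

theorem rep_subst (p : Stage CT P σ₀) (t : Tm S) (a : Var → PreElement CT P σ₀) :
    p.rep (t.subst a) = t.subst fun x => p.rep (a x) := term_subst_subst _ _ _

theorem eventually_covers (a : PreElement CT P σ₀) :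
    ∀ᶠ p : Stage CT P σ₀ in atTop, p.Covers a := by
  classical
  have key : ∀ g : {g : Gen S // Live CT P σ₀ g},
      ∀ᶠ p : Stage CT P σ₀ in atTop, ∃ x ∈ p.state.vars, p.name x = g := by
    rintro ⟨_, p, x, hx, rfl⟩
    filter_upwards [eventually_ge_atTop p] with q hpq
    obtain ⟨ρ, hρ⟩ := hpq
    exact ⟨ρ x, hρ.mem_vars x hx, hρ.name x hx⟩
  have := (eventually_all_finset a.varFinset).2 fun g _ => key g
  filter_upwards [this] with p hp g hg
  exact hp g (by convert hg)

end Stage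

/-- Two terms over the names are identified if the built-in stores of the later stages entail that
they are equal. -/
def genericSetoid (CT : ConstraintTheory S) (P : Program S) (σ₀ : State S) :
    Setoid (PreElement CT P σ₀) where
  r a b := ∀ᶠ p : Stage CT P σ₀ in atTop, ∀ (M : Type u) [S.lang.Structure M], CT.ModeledBy M →
    ∀ v : Var → M, BHolds M v p.state.builtin → (p.rep a).realize v = (p.rep b).realize v
  iseqv := by
    refine ⟨fun a => .of_forall fun p M _ _ v _ => rfl, fun h => ?_, fun h h' => ?_⟩
    · filter_upwards [h] with p hp M _ hM v hv
      exact (hp M hM v hv).symm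
    · filter_upwards [h, h'] with p hp hp' M _ hM v hv
      exact (hp M hM v hv).trans (hp' M hM v hv)

/-- A built-in atom is true if it is entailed by the built-in stores of the later stages, and a
persistent atom is true if, up to equality, it occurs in the later stages. Linear atoms are false;
their interpretation plays no role. -/
instance genericPrestructure (CT : ConstraintTheory S) (P : Program S) (σ₀ : State S) :
    S.lang.Prestructure (genericSetoid CT P σ₀) where
  toStructure :=
    { funMap := fun f a => Term.func f a
      RelMap := fun R a =>
        match R with
        | Sum.inl b => ∀ᶠ p : Stage CT P σ₀ in atTop, Entails CT p.state.builtin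
            {.rel b fun i => p.rep (a i)}
        | Sum.inr (Sum.inl _) => False
        | Sum.inr (Sum.inr k) => ∀ᶠ p : Stage CT P σ₀ in atTop, ∃ c ∈ p.state.chr,
            UEq CT p.state.builtin c (.per k fun i => p.rep (a i)) }
  fun_equiv := by
    intro n f a b hab
    filter_upwards [eventually_all.2 hab] with p hp M _ hM v hv
    exact congrArg (Structure.funMap f) (funext fun i => hp i M hM v hv)
  rel_equiv := by
    intro n R a b hab
    have key : ∀ a b : Fin n → PreElement CT P σ₀,
        (∀ i, (genericSetoid CT P σ₀).r (a i) (b i)) → ∀ᶠ p : Stage CT P σ₀ in atTop,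
          ∀ (M : Type u) [S.lang.Structure M], CT.ModeledBy M → ∀ v : Var → M,
            BHolds M v p.state.builtin →
              (fun i => (p.rep (a i)).realize v) = fun i => (p.rep (b i)).realize v := by
      intro a b hab
      filter_upwards [eventually_all.2 hab] with p hp M _ hM v hv
      exact funext fun i => hp i M hM v hv
    have hab' := key a b hab
    rcases R with R | R | R
    · refine propext (eventually_congr ?_)
      filter_upwards [hab'] with p hp
      refine forall₅_congr fun M _ hM v hv => ?_
      simp only [BHolds, Multiset.mem_singleton, forall_eq, BuiltInConstraint.Holds]
      rw [hp M hM v hv]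
    · rfl
    · refine propext (eventually_congr ?_)
      filter_upwards [hab'] with p hp
      refine exists_congr fun c => and_congr_right fun _ => forall₅_congr fun M _ hM v hv => ?_
      simp only [UserConstraint.ground]
      rw [hp M hM v hv]

/-- The limit of the stages. -/
abbrev GenericModel (CT : ConstraintTheory S) (P : Program S) (σ₀ : State S) : Type u :=
  Quotient (genericSetoid CT P σ₀)

namespace GenericModel

/-- The element represented by a term over the names. -/
abbrev mk (a : PreElement CT P σ₀) : GenericModel CT P σ₀ := Quotient.mk _ a

theorem realize_mk (t : Tm S) (a : Var → PreElement CT P σ₀) :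
    t.realize (fun x => mk (a x)) = mk (t.subst a) := by
  rw [Term.realize_quotient_mk']
  congr 1
  induction t with
  | var x => rfl
  | func f ts ih =>
    simp only [Term.realize, Term.subst]
    exact congrArg (Term.func f) (funext ih)

theorem holds_mk_iff (hcons : ∀ p : Stage CT P σ₀, Consistent CT p.state.builtin)
    (c : BuiltInConstraint S) (a : Var → PreElement CT P σ₀) :
    c.Holds (GenericModel CT P σ₀) (fun x => mk (a x)) ↔ ∀ᶠ p : Stage CT P σ₀ in atTop,
      Entails CT p.state.builtin {c.subst fun x => p.rep (a x)} := by
  cases c with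
  | tru =>
    refine iff_of_true trivial (.of_forall fun p M _ _ v _ c hc => ?_)
    rw [Multiset.mem_singleton.1 hc]
    trivial
  | fls =>
    refine iff_of_false id fun h => ?_
    obtain ⟨p, hp⟩ := h.exists
    obtain ⟨M, _, hM, v, hv⟩ := hcons p
    exact hp M hM v hv _ (Multiset.mem_singleton_self _)
  | eq s t =>
    simp only [BuiltInConstraint.Holds, realize_mk]
    rw [Quotient.eq]
    refine eventually_congr (.of_forall fun p => forall₅_congr fun M _ hM v hv => ?_)
    simp only [BHolds, Multiset.mem_singleton, forall_eq, BuiltInConstraint.Holds,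
      BuiltInConstraint.subst, Stage.rep_subst]
  | rel R ts =>
    simp only [BuiltInConstraint.Holds, realize_mk, BuiltInConstraint.subst]
    refine (relMap_quotient_mk' (L := S.lang) (genericSetoid CT P σ₀) (Sum.inl R)
      fun i => (ts i).subst a).trans ?_
    simp only [Structure.RelMap, Stage.rep_subst]

theorem bHolds_mk_iff (hcons : ∀ p : Stage CT P σ₀, Consistent CT p.state.builtin)
    (E : BStore S) (a : Var → PreElement CT P σ₀) :
    BHolds (GenericModel CT P σ₀) (fun x => mk (a x)) E ↔ ∀ᶠ p : Stage CT P σ₀ in atTop,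
      Entails CT p.state.builtin (bsub (fun x => p.rep (a x)) E) := by
  induction E using Multiset.induction_on with
  | empty =>
    refine iff_of_true (fun c hc => ?_) (.of_forall fun p M _ _ v _ c hc => ?_) <;> simp at hc
  | cons c E ih =>
    rw [bHolds_cons, holds_mk_iff hcons, ih, ← eventually_and]
    refine eventually_congr (.of_forall fun p => ?_)
    simp only [Entails, bsub, Multiset.map_cons, bHolds_cons, ← forall_and]
    refine forall₅_congr fun M _ hM v hv => ?_
    simp [BHolds]

theorem holds_mk_iff_of_isPersistent {c : UserConstraint S} (hc : c.IsPersistent)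
    (a : Var → PreElement CT P σ₀) :
    c.Holds (GenericModel CT P σ₀) (fun x => mk (a x)) ↔ ∀ᶠ p : Stage CT P σ₀ in atTop,
      ∃ d ∈ p.state.chr, UEq CT p.state.builtin d (c.subst fun x => p.rep (a x)) := by
  cases c with
  | lin R ts => exact hc.elim
  | per R ts =>
    simp only [UserConstraint.Holds, realize_mk, UserConstraint.subst]
    refine (relMap_quotient_mk' (L := S.lang) (genericSetoid CT P σ₀) (Sum.inr (Sum.inr R))
      fun i => (ts i).subst a).trans ?_
    simp only [Structure.RelMap, Stage.rep_subst]

open Classical in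
/-- The valuation of variables by their names; `d` is the value of the variables without a live
name. -/
noncomputable def valuation (d : PreElement CT P σ₀) (e : Var → Gen S) :
    Var → PreElement CT P σ₀ := fun x =>
  if h : Live CT P σ₀ (e x) then .var ⟨e x, h⟩ else d

/-- A purely persistent state that is contained in a stage is true in the generic model under the
valuation of its variables by their names. -/
theorem holds_of_embeds (hcons : ∀ p : Stage CT P σ₀, Consistent CT p.state.builtin)
    {τ : State S} {e : Var → Gen S} {p : Stage CT P σ₀} (h : Embeds τ e p.state p.name)
    (hX : τ.globals = σ₀.globals) (hτ : τ ∈ purelyPersistent S) (d : PreElement CT P σ₀) :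
    BHolds (GenericModel CT P σ₀) (fun x => mk (valuation d e x)) τ.builtin ∧
      UHolds (GenericModel CT P σ₀) (fun x => mk (valuation d e x)) τ.chr := by
  have key : ∀ᶠ q : Stage CT P σ₀ in atTop, ∃ ρ, EmbedsVia τ e q.state q.name ρ ∧
      ∀ x ∈ τ.vars, q.rep (valuation d e x) = ren S ρ x := by
    filter_upwards [eventually_ge_atTop p] with q hpq
    obtain ⟨ρ, hρ⟩ := h.trans hpq (hX.trans p.isStage.globals_eq.symm)
    refine ⟨ρ, hρ, fun x hx => ?_⟩
    have hlive : Live CT P σ₀ (e x) := ⟨q, ρ x, hρ.mem_vars x hx, hρ.name x hx⟩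
    rw [valuation, dif_pos hlive]
    exact congrArg Term.var (Stage.inv_eq (hρ.mem_vars x hx) (hρ.name x hx))
  constructor
  · rw [bHolds_mk_iff hcons]
    filter_upwards [key] with q hq M _ hM v hv c hc
    obtain ⟨ρ, hρ, hq⟩ := hq
    obtain ⟨c, hc', rfl⟩ := Multiset.mem_map.1 hc
    rw [c.subst_congr fun x hx => hq x (Or.inl (Or.inr ⟨c, hc', hx⟩))]
    exact hv _ (hρ.builtin c hc')
  · intro c hc
    rw [holds_mk_iff_of_isPersistent (hτ c hc)]
    filter_upwards [key] with q hq
    obtain ⟨ρ, hρ, hq⟩ := hq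
    refine ⟨_, hρ.chr c hc, ?_⟩
    rw [c.subst_congr (θ := fun x => q.rep (valuation d e x)) fun x hx =>
      hq x (Or.inl (Or.inl ⟨c, hc, hx⟩))]
    exact .refl _ _

/-- The generic model is closed under the derivations from a stage. -/
theorem exists_holds_of_acc (hcons : ∀ p : Stage CT P σ₀, Consistent CT p.state.builtin)
    (p : Stage CT P σ₀) {τ : State S} (hacc : Relation.ReflTransGen (Acc CT P) p.state τ)
    (hτ : τ ∈ purelyPersistent S) (d : PreElement CT P σ₀) :
    ∃ v : Var → GenericModel CT P σ₀, BHolds _ v τ.builtin ∧ UHolds _ v τ.chr ∧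
      ∀ a, p.Covers a → (p.rep a).realize v = mk a := by
  classical
  obtain ⟨τ', f', h, hp, hτ'⟩ := p.isStage.exists_grow p.isStage (.refl _ _) hacc hτ
  have hX := (Acc.reflTransGen_globals_eq hacc).trans p.isStage.globals_eq
  obtain ⟨h1, h2⟩ := holds_of_embeds hcons (p := ⟨τ', f', h⟩) hτ' hX hτ d
  refine ⟨_, h1, h2, fun a ha => ?_⟩
  rw [realize_mk, Stage.rep, term_subst_subst]
  congr 1
  refine (term_subst_congr a fun g hg => ?_).trans (term_subst_var a)
  have hg' := ha g (by convert hg)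
  have hname : extName p.state τ p.name (p.inv g) = g := by
    rw [extName, if_pos (Stage.inv_mem hg'), Stage.name_inv hg']
  simp only [Term.subst, valuation, hname]
  rw [dif_pos g.2]

/-- What is true in the generic model is realized in some stage, all derivations from which are
reflected in the model. -/
theorem exists_reaches (hP : P.IsHybrid) (h₀ : σ₀ ∈ purelyPersistent S)
    (hcons : ∀ p : Stage CT P σ₀, Consistent CT p.state.builtin)
    (v : Var → GenericModel CT P σ₀) {K : UStore S} {E : BStore S}
    (hKp : ∀ k ∈ K, k.IsPersistent) (hK : UHolds _ v K) (hE : BHolds _ v E)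
    {V : Set Var} (hV : V.Finite) :
    ∃ (τ : State S) (θ : Var → Tm S), Reaches (HybridEquiv CT) P σ₀ τ ∧ τ ∈ purelyPersistent S ∧
      Entails CT τ.builtin (bsub θ E) ∧
      (∀ k ∈ K, ∃ c ∈ τ.chr, UEq CT τ.builtin c (k.subst θ)) ∧
      ∀ τ', Relation.ReflTransGen (Acc CT P) τ τ' → τ' ∈ purelyPersistent S →
        ∃ w : Var → GenericModel CT P σ₀, BHolds _ w τ'.builtin ∧ UHolds _ w τ'.chr ∧
          ∀ x ∈ V, (θ x).realize w = v x := by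
  obtain ⟨a, rfl⟩ : ∃ a : Var → PreElement CT P σ₀, v = fun x => mk (a x) :=
    ⟨fun x => (v x).out, funext fun x => (Quotient.out_eq _).symm⟩
  have h1 := (bHolds_mk_iff hcons E a).1 hE
  have h2 : ∀ᶠ p : Stage CT P σ₀ in atTop, ∀ k ∈ K, ∃ c ∈ p.state.chr,
      UEq CT p.state.builtin c (k.subst fun x => p.rep (a x)) := by
    classical
    have := (eventually_all_finset K.toFinset).2 fun k hk =>
      (holds_mk_iff_of_isPersistent (hKp k (Multiset.mem_toFinset.1 hk)) a).1
        (hK k (Multiset.mem_toFinset.1 hk))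
    filter_upwards [this] with p hp k hk
    exact hp k (Multiset.mem_toFinset.2 hk)
  have h3 : ∀ᶠ p : Stage CT P σ₀ in atTop, ∀ x ∈ V, p.Covers (a x) :=
    (eventually_all_finite hV).2 fun x _ => Stage.eventually_covers (a x)
  obtain ⟨p, hp1, hp2, hp3⟩ := (h1.and (h2.and h3)).exists
  refine ⟨p.state, fun x => p.rep (a x), p.isStage.reaches hP h₀, p.isStage.persistent h₀, hp1, hp2,
    fun τ' hacc hτ' => ?_⟩
  obtain ⟨w, hw1, hw2, hw3⟩ := exists_holds_of_acc hcons p hacc hτ' (a 0)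
  exact ⟨w, hw1, hw2, fun x hx => hw3 _ (hp3 x hx)⟩

end GenericModel


section

variable {CT : ConstraintTheory S} {P : Program S}

namespace GenericModel

variable {σ₀ : State S}

/-- The generic model is a model of the constraint theory: the conclusion of an axiom whose premise
is true can be added to a stage, with new variables for the existentially quantified ones. -/
theorem modeledBy (hP : P.IsHybrid) (h₀ : σ₀ ∈ purelyPersistent S)
    (hcons : ∀ p : Stage CT P σ₀, Consistent CT p.state.builtin) :
    CT.ModeledBy (GenericModel CT P σ₀) := by
  classical
  intro a ha v hv
  obtain ⟨τ, θ, -, hτ, hE, -, hacc⟩ := exists_reaches hP h₀ hcons v (K := 0) (by simp)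
    (by simp [UHolds]) hv (finite_bfv a.concl)
  obtain ⟨m, hm⟩ := exists_var_bound (τ.finite_vars.union
    ((finite_bfv a.concl).biUnion fun x _ => Finset.finite_toSet (θ x).varFinset))
  set η : Var → Tm S := fun x => if x ∈ a.ex then .var (x + m : ℕ) else θ x with hη
  have hex : EntailsExists CT τ.vars τ.builtin (bsub η a.concl) := by
    intro M _ hM u hu
    obtain ⟨w, hw, hw'⟩ := hM a ha _ ((bHolds_bsub u θ _).1 (hE M hM u hu))
    refine ⟨fun y => if y < m then u y else w (y - m : ℕ),
      fun y hy => if_pos (hm y (Or.inl hy)), ?_⟩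
    rw [bHolds_bsub]
    refine (bHolds_congr _ fun x hx => ?_).2 hw'
    by_cases hxe : x ∈ a.ex
    · simp [hη, hxe]
    · rw [hη, hw (by simpa using hxe)]
      simp only [if_neg hxe]
      exact term_realize_congr _ fun y hy => if_pos (hm y (Or.inr (Set.mem_biUnion hx hy)))
  obtain ⟨w, hw, -, hwv⟩ := hacc ⟨τ.chr, τ.builtin + bsub η a.concl, τ.globals⟩
    (.single (.enrich τ.chr τ.builtin _ τ.globals hex)) hτ
  have hw' := (bHolds_bsub w η _).1 ((bHolds_add _ _ _).1 hw).2
  refine ⟨fun x => if x ∈ a.ex then w (x + m : ℕ) else v x,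
    fun x hx => if_neg (by simpa using hx), ?_⟩
  refine (bHolds_congr _ fun x hx => ?_).2 hw'
  by_cases hxe : x ∈ a.ex
  · simp [hη, hxe]
  · simp [hη, hxe, hwv x hx]

/-- The generic model respects the propagation rules. A rule that applies in the model can be fired
in a stage; the simplification rules take the result to a purely persistent state, which is again
reflected in the model and shows that the linear constraints of the body are reducible. -/
theorem propagation (hP : P.IsHybrid) (h₀ : σ₀ ∈ purelyPersistent S)
    (hgood : ∀ τ, Reaches (HybridEquiv CT) P σ₀ τ → Consistent CT τ.builtin ∧
      ∃ π ∈ purelyPersistent S, Reaches (HybridEquiv CT) P.simp τ π)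
    (r : Rule S) (hr : r ∈ P.rules) (hr₀ : r.removed = 0) (v : Var → GenericModel CT P σ₀)
    (hK : UHolds _ v r.kept) (hG : BHolds _ v r.guard) :
    ∃ w : Var → GenericModel CT P σ₀, Set.EqOn w v r.headVars ∧
      SatAt GroundConstraint.Holds (Reducible _ P.simp) w r.bodyU (r.guard + r.bodyB) := by
  have hcons : ∀ p : Stage CT P σ₀, Consistent CT p.state.builtin := fun p =>
    (hgood _ (p.isStage.reaches hP h₀)).1
  have hM := modeledBy hP h₀ hcons
  obtain ⟨τ, θ, hreach, hτ, hE, hkept, hacc⟩ := exists_reaches hP h₀ hcons v (hP r hr).1 hK hG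
    ((finite_ufv r.kept).union (finite_ufv r.removed))
  obtain ⟨f, E', hfire, -, hE', hf, -⟩ := exists_acc_fire (CT := CT) hr θ 0 τ.chr τ.builtin
    τ.globals Set.finite_empty (by rw [hr₀]; exact .zero) hkept hE
  rw [zero_add] at hfire
  have hreach₁ := hreach.trans (Acc.reflTransGen_reaches hP hfire)
  obtain ⟨π, hπ, hτπ⟩ := (hgood _ hreach₁).2
  obtain ⟨π', hacc', hsim⟩ := (Simulates.refl _).reaches hP.simp hτπ
  have hacc'' := Acc.reflTransGen_mono P.simp_subset hacc'
  obtain ⟨θ', hθ'⟩ := hsim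
    (hgood _ (hreach₁.trans (Acc.reflTransGen_reaches hP hacc''))).1
  have hπ' : linPart π'.chr = 0 := by
    have := hθ'.lin
    rwa [linPart_eq_zero.2 hπ, usub, Multiset.map_zero, Multiset.rel_zero_right] at this
  obtain ⟨w, hw1, hw2, hw3⟩ := hacc π' (hfire.trans hacc'') (linPart_eq_zero.1 hπ')
  obtain ⟨hb, hp, hl⟩ := Acc.reflTransGen_satAt_of_satAt hM hP.simp hacc' (v := w)
    ⟨hw1, fun c hc _ => (c.holds_ground w).2 (hw2 c hc), by
      rw [groundLin, hπ', Multiset.map_zero]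
      exact .zero⟩
  refine ⟨w ∘ f, fun x hx => (hf _ w hb x hx).trans (hw3 x hx), ?_, fun c hc hcp => ?_, ?_⟩
  · exact (bHolds_ren w f _).1 (hE' _ hM w hb)
  · have := hp (c.subst (ren S f)) (Multiset.mem_add.2 (Or.inl (Multiset.mem_map_of_mem _ hc)))
      (by simpa using hcp)
    rwa [UserConstraint.ground_subst] at this
  · have h0 : groundLin w τ.chr = 0 := by
      rw [groundLin, linPart_eq_zero.2 hτ, Multiset.map_zero]
    rwa [groundLin_add, h0, add_zero, groundLin_usub] at hl

end GenericModel

/-! ### States in the semantics are satisfiable -/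

/-- The semantics is closed under derivations, up to equivalence. -/
theorem exists_hybridEquiv_mem_hybridSemantics {σ τ : State S} (hσ : σ ∈ hybridSemantics CT P)
    (h : Reaches (HybridEquiv CT) P σ τ) :
    ∃ τ' ∈ hybridSemantics CT P, HybridEquiv CT τ' τ := by
  have key : ∀ {σ τ : State S}, σ ∈ hybridSemantics CT P →
      Transition (HybridEquiv CT) P σ τ → τ ∈ hybridSemantics CT P := by
    intro σ τ hσ h
    rw [hybridSemantics, ← OrderHom.map_gfp] at hσ
    exact hσ.1 τ h
  induction h with
  | single h =>
    rcases h with h | h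
    · exact ⟨_, key hσ h, .refl _ _⟩
    · exact ⟨_, hσ, h⟩
  | tail _ h ih =>
    obtain ⟨τ', hτ', he⟩ := ih
    rcases h with h | h
    · exact ⟨_, key hτ' (.congr he h (.refl _ _)), .refl _ _⟩
    · exact ⟨τ', hτ', he.trans h⟩

theorem exists_reaches_of_mem_innerSemantics {τ : State S} (h : τ ∈ innerSemantics CT P) :
    ∃ π ∈ purelyPersistent S, Consistent CT π.builtin ∧ Reaches (HybridEquiv CT) P.simp τ π := by
  have key : innerSemantics CT P ≤ {τ | ∃ π ∈ purelyPersistent S, Consistent CT π.builtin ∧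
      Reaches (HybridEquiv CT) P.simp τ π} := by
    refine OrderHom.lfp_le _ ?_
    rintro τ (⟨τ', h, π, hπ, hc, hr⟩ | ⟨hτ, hf⟩)
    · exact ⟨π, hπ, hc, .trans (.single (Or.inl h)) hr⟩
    · rw [mem_falseClass_iff, not_not] at hf
      exact ⟨τ, hτ, hf, (HybridEquiv.refl CT τ).reaches _⟩
  exact key h

theorem consistent_iff_satState (τ : State S) :
    Consistent CT τ.builtin ↔ ∃ (M : Type u) (_ : S.lang.Structure M), CT.ModeledBy M ∧
      ∃ v : Var → M, SatState (fun _ => True) (fun _ => True) v τ := by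
  refine exists_congr fun M => exists_congr fun _ => and_congr_right fun _ => ⟨?_, ?_⟩
  · rintro ⟨v, hv⟩
    exact ⟨v, v, fun _ _ => rfl, hv, fun _ _ _ => trivial, trivial⟩
  · rintro ⟨v, w, -, hw⟩
    exact ⟨w, hw.1⟩

theorem Reaches.consistent {σ τ : State S} (h : Reaches (HybridEquiv CT) P σ τ)
    (hτ : Consistent CT τ.builtin) : Consistent CT σ.builtin := by
  have h' := h.reflTransGen
  clear h
  induction h' with
  | refl => exact hτ
  | tail _ h ih =>
    rcases h with h | h
    · refine ih ?_
      rw [consistent_iff_satState] at hτ ⊢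
      obtain ⟨M, _, hM, v, hv⟩ := hτ
      exact ⟨M, _, hM, v, (h.satState_iff hM v).2 hv⟩
    · refine ih ?_
      obtain ⟨r, ρ, hr, D, E, X, fresh⟩ := h
      obtain ⟨M, _, hM, v, hv⟩ := hτ
      simp only [bHolds_add] at hv
      exact ⟨M, _, hM, v, (bHolds_add _ _ _).2 ⟨hv.1.2, hv.2⟩⟩

/-- A state in the hybrid transition system semantics is satisfiable: it is true in the generic
model of a purely persistent state that is reached by simplification rules. -/
theorem satisfiableWithin_of_mem_hybridSemantics (hP : P.IsHybrid)
    (hconf : Confluent (HybridEquiv CT) P.simp) {σ : State S} (hσ : σ ∈ hybridSemantics CT P) :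
    SatisfiableWithin CT P σ.chr σ.builtin := by
  have hgood : ∀ τ, Reaches (HybridEquiv CT) P σ τ → ∃ π ∈ purelyPersistent S,
      Consistent CT π.builtin ∧ Reaches (HybridEquiv CT) P.simp τ π := by
    intro τ h
    obtain ⟨τ', hτ', he⟩ := exists_hybridEquiv_mem_hybridSemantics hσ h
    rw [hybridSemantics, ← OrderHom.map_gfp] at hτ'
    obtain ⟨π, hπ, hc, hr⟩ := exists_reaches_of_mem_innerSemantics hτ'.2
    exact ⟨π, hπ, hc, (he.symm.reaches _).trans hr⟩
  obtain ⟨π, hπ, -, hσπ⟩ := hgood σ ((HybridEquiv.refl CT σ).reaches P)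
  -- The trivial equation provides a variable, so that the generic model is inhabited.
  set σ₀ : State S := ⟨π.chr, π.builtin + {.eq (.var 0) (.var 0)}, π.globals⟩ with hσ₀
  have hσσ₀ : Reaches (HybridEquiv CT) P.simp σ σ₀ := by
    refine hσπ.trans (HybridEquiv.reaches _ (hybridEquiv_of_entails (C := π.chr) (X := π.globals)
      (fun M _ _ v hv => (bHolds_add _ _ _).2 ⟨hv, fun c hc => ?_⟩) (entails_add_left _ _)))
    rw [Multiset.mem_singleton.1 hc]
    rfl
  have h₀ : σ₀ ∈ purelyPersistent S := hπ
  have hgood₀ : ∀ τ, Reaches (HybridEquiv CT) P σ₀ τ → Consistent CT τ.builtin ∧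
      ∃ π ∈ purelyPersistent S, Reaches (HybridEquiv CT) P.simp τ π := by
    intro τ h
    obtain ⟨π, hπ, hc, hr⟩ := hgood τ ((hσσ₀.mono P.simp_subset).trans h)
    exact ⟨hr.consistent hc, π, hπ, hr⟩
  have hcons : ∀ p : Stage CT P σ₀, Consistent CT p.state.builtin := fun p =>
    (hgood₀ _ (p.isStage.reaches hP h₀)).1
  have hM := GenericModel.modeledBy hP h₀ hcons
  have hlive : Live CT P σ₀ (.base 0) := by
    refine ⟨⟨σ₀, Gen.base, .base⟩, 0, Or.inl (Or.inr ?_), rfl⟩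
    rw [hσ₀]
    exact ⟨_, Multiset.mem_add.2 (Or.inr (Multiset.mem_singleton_self _)),
      Or.inl (by simp [Term.varFinset])⟩
  obtain ⟨hb, hu⟩ := GenericModel.holds_of_embeds hcons (p := ⟨σ₀, Gen.base, .base⟩)
    (.refl _ _) rfl h₀ (.var ⟨_, hlive⟩)
  obtain ⟨w, -, hw⟩ := hσσ₀.satState_of_satState hM hP.simp ⟨_, fun _ _ => rfl, hb,
    fun c hc _ => (c.holds_ground _).2 (hu c hc), by
      rw [groundLin, linPart_eq_zero.2 h₀, Multiset.map_zero]
      exact .zero⟩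
  exact satisfiableWithin_of_model hP hconf hM (GenericModel.propagation hP h₀ hgood₀) hw

/-! ### Satisfiable states are in the semantics -/

theorem satisfiableWithin_iff_satState (τ : State S) :
    SatisfiableWithin CT P τ.chr τ.builtin ↔ ∃ (M : Type u) (_ : S.lang.Structure M),
      CT.ModeledBy M ∧ P.ModeledBy M ∧
        ∃ v : Var → M, SatState GroundConstraint.Holds (fun N => ∀ g ∈ N, g.Holds) v τ := by
  refine exists_congr fun M => exists_congr fun _ => and_congr_right fun _ =>
    and_congr_right fun _ => ⟨?_, ?_⟩
  · rintro ⟨v, hC, hE⟩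
    refine ⟨v, v, fun _ _ => rfl, hE, fun c hc _ => (c.holds_ground v).2 (hC c hc), fun g hg => ?_⟩
    obtain ⟨c, hc, rfl⟩ := Multiset.mem_map.1 hg
    exact (c.holds_ground v).2 (hC c (mem_linPart.1 hc).1)
  · rintro ⟨v, w, -, hb, hp, hl⟩
    refine ⟨w, fun c hc => (c.holds_ground w).1 ?_, hb⟩
    by_cases hcp : c.IsPersistent
    · exact hp c hc hcp
    · exact hl _ (Multiset.mem_map_of_mem _
        (mem_linPart.2 ⟨hc, (UserConstraint.isLinear_iff_not c).2 hcp⟩))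

theorem uHolds_ren {M : Type u} [S.lang.Structure M] (v : Var → M) (π : Var → Var) (C : UStore S) :
    UHolds M v (usub (ren S π) C) ↔ UHolds M (v ∘ π) C := by
  rw [uHolds_usub]
  rfl

/-- A rule application preserves satisfiability: the logical reading of the rule provides values for
the local variables. -/
theorem RuleStep.satisfiableWithin {σ τ : State S} (h : RuleStep P σ τ)
    (hσ : SatisfiableWithin CT P σ.chr σ.builtin) : SatisfiableWithin CT P τ.chr τ.builtin := by
  classical
  obtain ⟨r, ρ, hr, D, E, X, fresh⟩ := h
  obtain ⟨M, _, hM, hPM, v, hu, hb⟩ := hσ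
  simp only [uHolds_add, bHolds_add] at hu hb
  obtain ⟨⟨hK, hH⟩, hD⟩ := hu
  obtain ⟨hG, hE⟩ := hb
  obtain ⟨w, hw, hwG, hwB, hwU⟩ := (hPM r hr (v ∘ ρ)
    ⟨(uHolds_ren v ρ _).1 hK, (bHolds_ren v ρ _).1 hG⟩).1 ((uHolds_ren v ρ _).1 hH)
  -- The local variables take their values from `w`, all other variables keep theirs.
  set u : Var → M := fun y => if y ∈ (r.rename ρ).localVars then w (ρ.symm y) else v y with hu
  have hur : ∀ x ∈ r.vars, (u ∘ ρ) x = w x := by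
    intro x hx
    have hmem : ρ x ∈ (r.rename ρ).localVars ↔ x ∈ r.localVars := by
      rw [Rule.localVars_rename]
      exact ρ.injective.mem_set_image
    rcases (r.mem_vars_iff x).1 hx with hx | hx
    · have : ρ x ∉ (r.rename ρ).localVars := fun h => (hmem.1 h).2 hx
      simp [hu, this, hw hx]
    · simp [hu, hmem.2 hx]
  have huD : ∀ y ∈ ufv D ∪ bfv E, u y = v y := fun y hy =>
    if_neg fun h => Set.disjoint_left.1 fresh h (Or.inl hy)
  refine ⟨M, _, hM, hPM, u, ?_, ?_⟩
  · simp only [uHolds_add]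
    refine ⟨⟨(uHolds_ren u ρ _).2 ((uHolds_congr _ fun x hx => hur x (Or.inr hx)).2 hwU),
      (uHolds_ren u ρ _).2 ((uHolds_congr _ fun x hx => ?_).2 ((uHolds_ren v ρ _).1 hK))⟩,
      (uHolds_congr _ fun x hx => huD x (Or.inl hx)).2 hD⟩
    exact (hur x (Or.inl (Or.inl (Or.inl (Or.inl hx))))).trans (hw (Or.inl hx))
  · simp only [bHolds_add]
    refine ⟨⟨(bHolds_ren u ρ _).2 ((bHolds_congr _ fun x hx => hur x (Or.inl (Or.inr hx))).2 hwB),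
      (bHolds_ren u ρ _).2
        ((bHolds_congr _ fun x hx => hur x (Or.inl (Or.inl (Or.inr hx)))).2 hwG)⟩,
      (bHolds_congr _ fun x hx => huD x (Or.inr hx)).2 hE⟩

theorem Reaches.satisfiableWithin {σ τ : State S} (h : Reaches (HybridEquiv CT) P σ τ)
    (hσ : SatisfiableWithin CT P σ.chr σ.builtin) : SatisfiableWithin CT P τ.chr τ.builtin := by
  have h' := h.reflTransGen
  clear h
  induction h' with
  | refl => exact hσ
  | tail _ h ih =>
    rcases h with h | h
    · rw [satisfiableWithin_iff_satState] at ih ⊢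
      obtain ⟨M, _, hM, hPM, v, hv⟩ := ih
      exact ⟨M, _, hM, hPM, v, (h.satState_iff hM v).1 hv⟩
    · exact h.satisfiableWithin ih

theorem not_mem_falseClass_of_satisfiableWithin {τ : State S}
    (h : SatisfiableWithin CT P τ.chr τ.builtin) : τ ∉ falseClass CT := by
  obtain ⟨M, _, hM, -, v, -, hv⟩ := h
  rw [mem_falseClass_iff, not_not]
  exact ⟨M, _, hM, v, hv⟩

theorem mem_innerSemantics_of_hybridEquiv {τ τ' : State S} (h : HybridEquiv CT τ τ')
    (hτ : SatisfiableWithin CT P τ.chr τ.builtin) (hτ' : τ' ∈ innerSemantics CT P) :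
    τ ∈ innerSemantics CT P := by
  rw [innerSemantics, ← OrderHom.map_lfp] at hτ' ⊢
  rcases hτ' with ⟨υ, h', hυ⟩ | ⟨hp, -⟩
  · exact Or.inl ⟨υ, .congr h h' (.refl _ _), hυ⟩
  · refine Or.inr ⟨?_, not_mem_falseClass_of_satisfiableWithin hτ⟩
    obtain ⟨M, _, hM, -, v, hv⟩ := (satisfiableWithin_iff_satState τ).1 hτ
    exact h.symm.purelyPersistent_iff hM v ((h.satState_iff hM v).1 hv) hp

theorem mem_innerSemantics_of_reaches {τ π : State S} (h : Reaches (HybridEquiv CT) P.simp τ π)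
    (hπ : π ∈ purelyPersistent S) (hτ : SatisfiableWithin CT P τ.chr τ.builtin) :
    τ ∈ innerSemantics CT P := by
  have step : ∀ {τ τ' : State S}, Transition (HybridEquiv CT) P.simp τ τ' ∨ HybridEquiv CT τ τ' →
      SatisfiableWithin CT P τ.chr τ.builtin →
      (SatisfiableWithin CT P τ'.chr τ'.builtin → τ' ∈ innerSemantics CT P) →
      τ ∈ innerSemantics CT P := by
    intro τ τ' h hτ hτ'
    have hτ'' := hτ' (Reaches.satisfiableWithin
      (.single (h.imp_left (Transition.mono P.simp_subset))) hτ)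
    rcases h with h | h
    · rw [innerSemantics, ← OrderHom.map_lfp]
      exact Or.inl ⟨τ', h, hτ''⟩
    · exact mem_innerSemantics_of_hybridEquiv h hτ hτ''
  have hπ' : SatisfiableWithin CT P π.chr π.builtin → π ∈ innerSemantics CT P := by
    intro h
    rw [innerSemantics, ← OrderHom.map_lfp]
    exact Or.inr ⟨hπ, not_mem_falseClass_of_satisfiableWithin h⟩
  induction h using Relation.TransGen.head_induction_on with
  | single h => exact step h hτ hπ'
  | head h _ ih => exact step h hτ ih

/-- A satisfiable data-sufficient state is in the hybrid transition system semantics: the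
satisfiable states among the accessible ones are a post-fixed point. -/
theorem mem_hybridSemantics_of_satisfiableWithin {σ : State S} (hds : DataSufficient CT P σ)
    (hσ : SatisfiableWithin CT P σ.chr σ.builtin) : σ ∈ hybridSemantics CT P := by
  have key : {τ | Reaches (HybridEquiv CT) P σ τ ∧ SatisfiableWithin CT P τ.chr τ.builtin} ≤
      hybridSemantics CT P := by
    refine OrderHom.le_gfp _ ?_
    rintro τ ⟨hr, hs⟩
    refine ⟨fun τ' h => ?_, ?_⟩
    · have h' : Reaches (HybridEquiv CT) P τ τ' := .single (Or.inl h)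
      exact ⟨hr.trans h', h'.satisfiableWithin hs⟩
    · obtain ⟨π, hπ, h⟩ := hds τ hr
      exact mem_innerSemantics_of_reaches h hπ hs
  exact key ⟨(HybridEquiv.refl CT σ).reaches P, hσ⟩

end

end CHR

theorem mainTheorem2 {S : CHR.Signature.{u}} (CT : CHR.ConstraintTheory S) (P : CHR.Program S)
    (hP : P.IsHybrid) (hconf : CHR.Confluent (CHR.HybridEquiv CT) P.simp)
    (Ls Ps : CHR.UStore S) (hL : ∀ c ∈ Ls, c.IsLinear) (hPs : ∀ c ∈ Ps, c.IsPersistent)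
    (E : CHR.BStore S) (X : Finset CHR.Var)
    (hds : CHR.DataSufficient CT P ⟨Ls + Ps, E, X⟩) :
    (⟨Ls + Ps, E, X⟩ : CHR.State S) ∈ CHR.hybridSemantics CT P ↔
      CHR.SatisfiableWithin CT P (Ls + Ps) E :=
  ⟨CHR.satisfiableWithin_of_mem_hybridSemantics hP hconf,
    CHR.mem_hybridSemantics_of_satisfiableWithin hds⟩
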